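/- **Setting.** Let $\widehat\Omega=(0,1)^3$ and $\Omega=F(\widehat\Omega)$ with $F(\zeta)=A\zeta+b$, $A\in\mathbb R^{3\times3}$ invertible, $b\in\mathbb R^3$. For $D\in\{\widehat\Omega,\Omega\}$ consider the Hessian complex $$P_1(D)\hookrightarrow H^2(D)\xrightarrow{\nabla^2}H(D,\mathrm{curl},\mathbb S)\xrightarrow{\nabla\times}H(D,\mathrm{div},\mathbb T)\xrightarrow{\nabla\cdot}L^2(D;\mathbb R^3)\to0,$$ where $P_1$ are the polynomials of degree $\le1$, $\nabla\times$ and $\nabla\cdot$ act row-wise and weakly, $H(D,\mathrm{curl},\mathbb S)$ consists of the symmetric $S\in L^2(D;\mathbb R^{3\times3})$ with $\nabla\times S\in L^2$, and $H(D,\mathrm{div},\mathbb T)$ of the trace-free $T\in L^2(D;\mathbb R^{3\times3})$ with $\nabla\cdot T\in L^2$. The norms are the $H^2$ norm and the graph norms. *Splines.* For $l=1,2,3$ let $1\le r_l\le p_l-1$ and let $\Xi_l=\{\xi^l_1\le\dots\le\xi^l_{n_l+p_l+1}\}$ be a $p_l$-open knot vector on $[0,1]$ (exactly $p_l+1$ knots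 equal $0$ and exactly $p_l+1$ equal $1$) whose internal knots have multiplicity at most $p_l-r_l$. For one such knot vector, $B_{i,q}$ are the B-splines given by the Cox–de Boor recursion, and for $k\in\{0,1,2\}$ we put $S_{p-k}^{r-k}=\mathrm{span}\{B_{i,p-k}:k+1\le i\le n\}$. The dual functionals of $B_{1,p},\dots,B_{n,p}$ are $$\lambda_i v=\int_{\xi_i}^{\xi_{i+p+1}}v\,\frac{d^{p+1}}{dt^{p+1}}\Big[g\Big(\tfrac{2t-\xi_i-\xi_{i+p+1}}{\xi_{i+p+1}-\xi_i}\Big)\tfrac1{p!}\prod_{\nu=1}^{p}(t-\xi_{i+\nu})\Big]dt,$$ with a fixed transition function $g=g_l\in C^{p}(\mathbb R)$ such that $g^{(p)}$ is Lipschitz, $g=0$ on $(-\infty,-1]$ and $g=1$ on $[1,\infty)$. The univariate projections are $$\Pi^{(0)}v=\sum_i(\lambda_iv)B_{i,p},\qquad \Pi^{(1)}v=\tfrac{d}{d\zeta}\Pi^{(0)}\!\int_0^\zeta v,\qquad \Pi^{(2)}v=\tfrac{d}{d\zeta}\Pi^{(1)}\!\int_0^\zeta v .$$ For $k=(k_1,k_2,k_3)\in\{0,1,2\}^3$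 write $\Pi^{k}=\Pi^{(k_1)}\otimes\Pi^{(k_2)}\otimes\Pi^{(k_3)}$ (the $l$-th factor acts in the $l$-th variable and uses $\Xi_l,p_l,g_l$) and $S^{k}=S^{r_1-k_1}_{p_1-k_1}\otimes S^{r_2-k_2}_{p_2-k_2}\otimes S^{r_3-k_3}_{p_3-k_3}$. With unit vectors $e_i$ and $\mathbf 1=(1,1,1)$, the parametric projections are $$\widehat\Pi^1_h=\Pi^{0},\quad(\widehat\Pi^2_hS)_{ij}=\Pi^{e_i+e_j}S_{ij},\quad(\widehat\Pi^3_hT)_{ij}=\Pi^{e_i+\mathbf 1-e_j}T_{ij},\quad(\widehat\Pi^4_hv)_i=\Pi^{e_i+\mathbf 1}v_i ,$$ and the parametric spline spaces are $\widehat V^1_h=S^0$, $\widehat V_h^2=\{S \text{ symmetric}: S_{ij}\in S^{e_i+e_j}\}$, $\widehat V_h^3=\{T\text{ trace-free}:T_{ij}\in S^{e_i+\mathbf 1-e_j}\}$, $\widehat V_h^4=\{v:v_i\in S^{e_i+\mathbf 1}\}$. With $$\mathcal Y_1\phi=\phi\circ F,\quad \mathcal Y_2S=A^T(S\circ F)A,\quad\mathcal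 Y_3T=\det(A)\,A^T(T\circ F)A^{-T},\quad\mathcal Y_4v=\det(A)\,A^T(v\circ F),$$ put $V_h^i=\mathcal Y_i^{-1}(\widehat V_h^i)$ and $\Pi_h^i=\mathcal Y_i^{-1}\circ\widehat\Pi_h^i\circ\mathcal Y_i$. Functions are identified when they agree almost everywhere. **Statement.** 1. The $\widehat\Pi^i_h$ map the $i$-th space of the Hessian complex on $\widehat\Omega$ (counting from $H^2$) into $\widehat V_h^i$, restrict to the identity on $\widehat V_h^i$, and $$\widehat\nabla^2\widehat\Pi^1_h\widehat\phi=\widehat\Pi^2_h\widehat\nabla^2\widehat\phi,\qquad\widehat\nabla\times\widehat\Pi^2_h\widehat S=\widehat\Pi^3_h(\widehat\nabla\times\widehat S),\qquad\widehat\nabla\cdot\widehat\Pi^3_h\widehat T=\widehat\Pi^4_h(\widehat\nabla\cdot\widehat T)$$ for all $\widehat\phi\in H^2(\widehat\Omega)$, $\widehat S\in H(\widehat\Omega,\mathrm{curl},\mathbb S)$, $\widehat T\in H(\widehat\Omega,\mathrm{div},\mathbb T)$. 2. On $\Omega$ the diagram of the Hessian complex, the spline spaces and the projections commutes: $\Pi^1_hq=q$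 for $q\in P_1(\Omega)$, and $\nabla^2\Pi^1_h=\Pi^2_h\nabla^2$ on $H^2(\Omega)$, $\nabla\times\Pi^2_h=\Pi^3_h\nabla\times$ on $H(\Omega,\mathrm{curl},\mathbb S)$, $\nabla\cdot\Pi^3_h=\Pi^4_h\nabla\cdot$ on $H(\Omega,\mathrm{div},\mathbb T)$. 3. The Hessian sequence on $\Omega$ is a complex and $P_1(\Omega)\hookrightarrow V_h^1\to V_h^2\to V_h^3\to V_h^4\to 0$ is a subcomplex of it: each $V_h^i$ lies in the corresponding space, $P_1(\Omega)\subset V_h^1$, $\nabla^2V_h^1\subset V_h^2$, $\nabla\times V_h^2\subset V_h^3$, $\nabla\cdot V_h^3\subset V_h^4$. Each $\Pi_h^i$ maps the corresponding space into $V_h^i$ and is the identity on $V_h^i$. 4. The projections are bounded. For every $\theta$ there is a constant $C$, depending only on $\theta$, $A$, $b$, the $p_l$ and the $g_l$, such that for all knot vectors as above in which any two neighbouring non-empty knot spans of the same direction have lengths with ratio at most $\theta$, each $\Pi_h^i$ is a well-defined linear operator on $L^2(\Omega)$ (scalar, matrix and vector fields respectively) of norm at most $C$, and $\Pi^1_h,\Pi^2_h,\Pi^3_h$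 are bounded by $C$ in the norms of $H^2(\Omega)$, $H(\Omega,\mathrm{curl})$, $H(\Omega,\mathrm{div})$. -/

import Mathlib

open MeasureTheory

noncomputable section

namespace HessianSpline

/-- Points of three-dimensional space. -/
abbrev E := Fin 3 → ℝ

/-- Real `3 × 3` matrices. -/
abbrev Mat := Matrix (Fin 3) (Fin 3) ℝ

/-! ### Square-integrable scalar, vector and matrix fields -/

/-- Value types of fields (scalars, vectors, matrices) with their real components. -/
class HasComponents (W : Type) (ι : outParam Type) where
  comp : W → ι → ℝ

instance : HasComponents ℝ Unit := ⟨fun w _ => w⟩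

instance : HasComponents (Fin 3 → ℝ) (Fin 3) := ⟨fun w => w⟩

instance : HasComponents Mat (Fin 3 × Fin 3) := ⟨fun w ij => w ij.1 ij.2⟩

/-- All components are square-integrable on `D`. -/
def MemL2 {W ι : Type} [HasComponents W ι] (D : Set E) (f : E → W) : Prop :=
  ∀ i : ι, MemLp (fun x => HasComponents.comp (f x) i) 2 (volume.restrict D)

/-- The squared `L²(D)` norm: the sum of the squared `L²(D)` norms of the components. -/
def l2NormSq {W ι : Type} [HasComponents W ι] [Fintype ι] (D : Set E) (f : E → W) : ℝ :=
  ∑ i : ι, ∫ x in D, (HasComponents.comp (f x) i) ^ 2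

/-- `P` induces a well-defined linear operator on `L²(D)` of operator norm at most `C`. -/
structure IsBoundedL2 {W ι : Type} [HasComponents W ι] [Fintype ι] [AddCommGroup W] [Module ℝ W]
    (D : Set E) (C : ℝ) (P : (E → W) → (E → W)) : Prop where
  memL2 : ∀ f, MemL2 D f → MemL2 D (P f)
  congr : ∀ f f', MemL2 D f → MemL2 D f' → f =ᵐ[volume.restrict D] f' →
    P f =ᵐ[volume.restrict D] P f'
  add : ∀ f f', MemL2 D f → MemL2 D f' → P (f + f') =ᵐ[volume.restrict D] P f + P f'
  smul : ∀ (c : ℝ) f, MemL2 D f → P (c • f) =ᵐ[volume.restrict D] c • P f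
  bound : ∀ f, MemL2 D f → l2NormSq D (P f) ≤ C ^ 2 * l2NormSq D f

/-! ### Weak derivatives and the spaces of the Hessian complex -/

/-- Smooth functions with compact support inside `D`. -/
structure IsTest (D : Set E) (ψ : E → ℝ) : Prop where
  smooth : ContDiff ℝ (⊤ : ℕ∞) ψ
  compact : HasCompactSupport ψ
  supp : tsupport ψ ⊆ D

/-- Classical partial derivative. -/
def pd (i : Fin 3) (ψ : E → ℝ) (x : E) : ℝ := fderiv ℝ ψ x (Pi.single i 1)

/-- `G` is the weak gradient of `φ` on `D`. -/
def IsWeakGrad (D : Set E) (φ : E → ℝ) (G : E → Fin 3 → ℝ) : Prop :=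
  ∀ (i : Fin 3) (ψ : E → ℝ), IsTest D ψ →
    ∫ x in D, φ x * pd i ψ x = -∫ x in D, G x i * ψ x

/-- `H` is the weak Hessian of `φ` on `D`. -/
def IsWeakHess (D : Set E) (φ : E → ℝ) (H : E → Mat) : Prop :=
  ∀ (i j : Fin 3) (ψ : E → ℝ), IsTest D ψ →
    ∫ x in D, φ x * pd i (pd j ψ) x = ∫ x in D, H x i j * ψ x

/-- `C` is the weak row-wise curl of `S` on `D`. Indices are cyclic, so that the `j`-th component
of the curl of a row `s` is `∂_{j+1} s_{j+2} - ∂_{j+2} s_{j+1}`. -/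
def IsWeakCurl (D : Set E) (S C : E → Mat) : Prop :=
  ∀ (i j : Fin 3) (ψ : E → ℝ), IsTest D ψ →
    ∫ x in D, (S x i (j + 2) * pd (j + 1) ψ x - S x i (j + 1) * pd (j + 2) ψ x) =
      -∫ x in D, C x i j * ψ x

/-- `v` is the weak row-wise divergence of `T` on `D`. -/
def IsWeakDiv (D : Set E) (T : E → Mat) (v : E → Fin 3 → ℝ) : Prop :=
  ∀ (i : Fin 3) (ψ : E → ℝ), IsTest D ψ →
    ∫ x in D, ∑ j, T x i j * pd j ψ x = -∫ x in D, v x i * ψ x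

/-- `φ ∈ H²(D)`, with gradient `G` and Hessian `H`. -/
structure IsH2 (D : Set E) (φ : E → ℝ) (G : E → Fin 3 → ℝ) (H : E → Mat) : Prop where
  memL2 : MemL2 D φ
  grad_memL2 : MemL2 D G
  hess_memL2 : MemL2 D H
  grad : IsWeakGrad D φ G
  hess : IsWeakHess D φ H

/-- `S ∈ H(D, curl, 𝕊)`, with `curl S = C`. -/
structure IsHcurlS (D : Set E) (S C : E → Mat) : Prop where
  memL2 : MemL2 D S
  symm : ∀ᵐ x ∂(volume.restrict D), (S x).transpose = S x
  curl_memL2 : MemL2 D C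
  curl : IsWeakCurl D S C

/-- `T ∈ H(D, div, 𝕋)`, with `div T = v`. -/
structure IsHdivT (D : Set E) (T : E → Mat) (v : E → Fin 3 → ℝ) : Prop where
  memL2 : MemL2 D T
  trace : ∀ᵐ x ∂(volume.restrict D), (T x).trace = 0
  div_memL2 : MemL2 D v
  div : IsWeakDiv D T v

/-- Polynomials of degree at most one. -/
def P1 : Set (E → ℝ) := {q | ∃ (c : ℝ) (a : E), ∀ x, q x = c + a ⬝ᵥ x}

/-! ### Univariate B-splines and projections -/

/-- B-splines by the Cox–de Boor recursion (knots and B-splines are numbered from `0`). -/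
def bspline (ξ : ℕ → ℝ) : ℕ → ℕ → ℝ → ℝ
  | 0, j, x => if ξ j ≤ x ∧ x < ξ (j + 1) then 1 else 0
  | p + 1, j, x =>
      (x - ξ j) / (ξ (j + p + 1) - ξ j) * bspline ξ p j x +
        (ξ (j + p + 2) - x) / (ξ (j + p + 2) - ξ (j + 1)) * bspline ξ p (j + 1) x

/-- A `p`-open knot vector `ξ 0 ≤ … ≤ ξ (n + p)` on `[0,1]` all of whose internal knots have
multiplicity at most `p - r`, so that the splines of degree `p` are of class `C^r`.
The sequence is continued by `1` beyond the index `n + p`; those values are never used. -/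
structure OpenKnots (p r : ℕ) where
  n : ℕ
  ξ : ℕ → ℝ
  lt : r < p
  mono : Monotone ξ
  eq_zero : ∀ i, i ≤ p → ξ i = 0
  eq_one : ∀ i, n ≤ i → ξ i = 1
  internal : ∀ i, p < i → i < n → 0 < ξ i ∧ ξ i < 1
  mult : ∀ i, p < i → i < n →
    ((Finset.range (n + p + 1)).filter (fun j => ξ j = ξ i)).card ≤ p - r

/-- Neighbouring mesh intervals have comparable lengths. -/
def LocallyQuasiUniform {p r : ℕ} (θ : ℝ) (K : OpenKnots p r) : Prop :=
  ∀ i j, K.ξ i < K.ξ (i + 1) → K.ξ j < K.ξ (j + 1) → K.ξ (i + 1) = K.ξ j →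
    K.ξ (i + 1) - K.ξ i ≤ θ * (K.ξ (j + 1) - K.ξ j) ∧
    K.ξ (j + 1) - K.ξ j ≤ θ * (K.ξ (i + 1) - K.ξ i)

/-- A transition function from `0` (left of `-1`) to `1` (right of `1`), of class `C^{p,1}`. -/
structure IsTransition (p : ℕ) (g : ℝ → ℝ) : Prop where
  contDiff : ContDiff ℝ p g
  lipschitz : ∃ L, LipschitzWith L (iteratedDeriv p g)
  left : ∀ t, t ≤ -1 → g t = 0
  right : ∀ t, 1 ≤ t → g t = 1

/-- The function whose derivative of order `p + 1` represents the `i`-th dual functional: the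
polynomial `∏_{ν=1}^{p} (t - ξ_{i+ν}) / p!`, switched on across the support of the `i`-th
B-spline. -/
def dualPotential (p : ℕ) (ξ : ℕ → ℝ) (g : ℝ → ℝ) (i : ℕ) (t : ℝ) : ℝ :=
  g ((2 * t - ξ i - ξ (i + p + 1)) / (ξ (i + p + 1) - ξ i)) *
    ((∏ ν ∈ Finset.range p, (t - ξ (i + ν + 1))) / (p.factorial : ℝ))

/-- The dual functional of the `i`-th B-spline of degree `p`. -/
def dualFunctional (p : ℕ) (ξ : ℕ → ℝ) (g : ℝ → ℝ) (i : ℕ) (v : ℝ → ℝ) : ℝ :=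
  ∫ t in (ξ i)..(ξ (i + p + 1)), v t * iteratedDeriv (p + 1) (dualPotential p ξ g i) t

/-- `v ↦ ∑ᵢ λᵢ(v) Bᵢ`. -/
def splineProj {p r : ℕ} (K : OpenKnots p r) (g : ℝ → ℝ) (v : ℝ → ℝ) : ℝ → ℝ := fun x =>
  ∑ i ∈ Finset.range K.n, dualFunctional p K.ξ g i v * bspline K.ξ p i x

/-- The primitive vanishing at `0`. -/
def prim (v : ℝ → ℝ) : ℝ → ℝ := fun x => ∫ t in (0 : ℝ)..x, v t

/-- The projection onto the splines of degree `p - 1`. -/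
def splineProjC1 {p r : ℕ} (K : OpenKnots p r) (g : ℝ → ℝ) (v : ℝ → ℝ) : ℝ → ℝ :=
  deriv (splineProj K g (prim v))

/-- The projection onto the splines of degree `p - 2`. -/
def splineProjC2 {p r : ℕ} (K : OpenKnots p r) (g : ℝ → ℝ) (v : ℝ → ℝ) : ℝ → ℝ :=
  deriv (splineProjC1 K g (prim v))

/-- The projection onto the splines of degree `p - k`, for `k = 0, 1, 2`. -/
def uniProj {p r : ℕ} (K : OpenKnots p r) (g : ℝ → ℝ) (k : Fin 3) : (ℝ → ℝ) → ℝ → ℝ :=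
  ![splineProj K g, splineProjC1 K g, splineProjC2 K g] k

/-! ### Tensor products on the unit cube -/

/-- The open unit cube. -/
def cube : Set E := Set.pi Set.univ (fun _ => Set.Ioo (0 : ℝ) 1)

/-- The tensor product of three univariate operators; each acts in its own coordinate. -/
def tensorOp (P : Fin 3 → (ℝ → ℝ) → ℝ → ℝ) (v : E → ℝ) : E → ℝ := fun x =>
  P 0 (fun a => P 1 (fun b => P 2 (fun c => v ![a, b, c]) (x 2)) (x 1)) (x 0)

variable {p r : Fin 3 → ℕ}

/-- The tensor product projection whose degree in direction `l` is `p l - k l`. -/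
def tensorProj (K : ∀ l, OpenKnots (p l) (r l)) (g : Fin 3 → ℝ → ℝ) (k : Fin 3 → Fin 3) :
    (E → ℝ) → E → ℝ :=
  tensorOp (fun l => uniProj (K l) (g l) (k l))

/-- The tensor product spline space of degree `p l - k l` and regularity `r l - k l` in direction
`l`. The knot vector of degree `p l - k l` arises from the one of degree `p l` by dropping the
first and the last `k l` knots, so its B-splines are those numbered `k l, …, n - 1`. -/
def tensorSpace (K : ∀ l, OpenKnots (p l) (r l)) (k : Fin 3 → Fin 3) : Submodule ℝ (E → ℝ) :=
  Submodule.span ℝ {s | ∃ j : Fin 3 → ℕ, (∀ l, (k l : ℕ) ≤ j l ∧ j l < (K l).n) ∧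
    s = fun x => ∏ l, bspline (K l).ξ (p l - (k l : ℕ)) (j l) (x l)}

/-- Degree reductions at the level of scalar fields. -/
def drop1 : Fin 3 → Fin 3 := ![0, 0, 0]

/-- Degree reductions for the entries of symmetric matrix fields. -/
def drop2 : Fin 3 → Fin 3 → Fin 3 → Fin 3 :=
  ![![![2, 0, 0], ![1, 1, 0], ![1, 0, 1]],
    ![![1, 1, 0], ![0, 2, 0], ![0, 1, 1]],
    ![![1, 0, 1], ![0, 1, 1], ![0, 0, 2]]]

/-- Degree reductions for the entries of trace-free matrix fields. -/
def drop3 : Fin 3 → Fin 3 → Fin 3 → Fin 3 :=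
  ![![![1, 1, 1], ![2, 0, 1], ![2, 1, 0]],
    ![![0, 2, 1], ![1, 1, 1], ![1, 2, 0]],
    ![![0, 1, 2], ![1, 0, 2], ![1, 1, 1]]]

/-- Degree reductions for the components of vector fields. -/
def drop4 : Fin 3 → Fin 3 → Fin 3 := ![![2, 1, 1], ![1, 2, 1], ![1, 1, 2]]

/-- The spline space of scalar fields on the cube. -/
def hatV1 (K : ∀ l, OpenKnots (p l) (r l)) : Set (E → ℝ) :=
  {φ | ∃ s ∈ tensorSpace K drop1, φ =ᵐ[volume.restrict cube] s}

/-- The spline space of symmetric matrix fields on the cube. -/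
def hatV2 (K : ∀ l, OpenKnots (p l) (r l)) : Set (E → Mat) :=
  {S | ∃ s : E → Mat, (∀ i j, (fun x => s x i j) ∈ tensorSpace K (drop2 i j)) ∧
    (∀ x, (s x).transpose = s x) ∧ S =ᵐ[volume.restrict cube] s}

/-- The spline space of trace-free matrix fields on the cube. -/
def hatV3 (K : ∀ l, OpenKnots (p l) (r l)) : Set (E → Mat) :=
  {T | ∃ s : E → Mat, (∀ i j, (fun x => s x i j) ∈ tensorSpace K (drop3 i j)) ∧
    (∀ x, (s x).trace = 0) ∧ T =ᵐ[volume.restrict cube] s}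

/-- The spline space of vector fields on the cube. -/
def hatV4 (K : ∀ l, OpenKnots (p l) (r l)) : Set (E → Fin 3 → ℝ) :=
  {v | ∃ s : E → Fin 3 → ℝ, (∀ i, (fun x => s x i) ∈ tensorSpace K (drop4 i)) ∧
    v =ᵐ[volume.restrict cube] s}

/-- The projection of scalar fields on the cube. -/
def hatPi1 (K : ∀ l, OpenKnots (p l) (r l)) (g : Fin 3 → ℝ → ℝ) (φ : E → ℝ) : E → ℝ :=
  tensorProj K g drop1 φ

/-- The projection of symmetric matrix fields on the cube (entry by entry). -/
def hatPi2 (K : ∀ l, OpenKnots (p l) (r l)) (g : Fin 3 → ℝ → ℝ) (S : E → Mat) : E → Mat :=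
  fun x => Matrix.of fun i j => tensorProj K g (drop2 i j) (fun y => S y i j) x

/-- The projection of trace-free matrix fields on the cube (entry by entry). -/
def hatPi3 (K : ∀ l, OpenKnots (p l) (r l)) (g : Fin 3 → ℝ → ℝ) (T : E → Mat) : E → Mat :=
  fun x => Matrix.of fun i j => tensorProj K g (drop3 i j) (fun y => T y i j) x

/-- The projection of vector fields on the cube (component by component). -/
def hatPi4 (K : ∀ l, OpenKnots (p l) (r l)) (g : Fin 3 → ℝ → ℝ) (v : E → Fin 3 → ℝ) :
    E → Fin 3 → ℝ :=
  fun x i => tensorProj K g (drop4 i) (fun y => v y i) x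

/-! ### The physical domain -/

/-- The affine parametrization. -/
def param (A : Mat) (b : E) (x : E) : E := A.mulVec x + b

/-- The inverse of the parametrization. -/
def paramInv (A : Mat) (b : E) (y : E) : E := A⁻¹.mulVec (y - b)

/-- The physical domain. -/
def physDomain (A : Mat) (b : E) : Set E := param A b '' cube

/-- Pull-back of scalar fields. -/
def Y1 (A : Mat) (b : E) (φ : E → ℝ) : E → ℝ := fun x => φ (param A b x)

/-- Pull-back of symmetric matrix fields. -/
def Y2 (A : Mat) (b : E) (S : E → Mat) : E → Mat := fun x =>
  A.transpose * S (param A b x) * A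

/-- Pull-back of trace-free matrix fields. -/
def Y3 (A : Mat) (b : E) (T : E → Mat) : E → Mat := fun x =>
  A.det • (A.transpose * T (param A b x) * A.transpose⁻¹)

/-- Pull-back of vector fields. -/
def Y4 (A : Mat) (b : E) (v : E → Fin 3 → ℝ) : E → Fin 3 → ℝ := fun x =>
  A.det • A.transpose.mulVec (v (param A b x))

/-- Inverse of `Y1`. -/
def Y1inv (A : Mat) (b : E) (φ : E → ℝ) : E → ℝ := fun y => φ (paramInv A b y)

/-- Inverse of `Y2`. -/
def Y2inv (A : Mat) (b : E) (S : E → Mat) : E → Mat := fun y =>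
  A.transpose⁻¹ * S (paramInv A b y) * A⁻¹

/-- Inverse of `Y3`. -/
def Y3inv (A : Mat) (b : E) (T : E → Mat) : E → Mat := fun y =>
  A.det⁻¹ • (A.transpose⁻¹ * T (paramInv A b y) * A.transpose)

/-- Inverse of `Y4`. -/
def Y4inv (A : Mat) (b : E) (v : E → Fin 3 → ℝ) : E → Fin 3 → ℝ := fun y =>
  A.det⁻¹ • A.transpose⁻¹.mulVec (v (paramInv A b y))

theorem param_paramInv {A : Mat} (hA : A.det ≠ 0) (b y : E) : param A b (paramInv A b y) = y := by
  have h : IsUnit A.det := isUnit_iff_ne_zero.mpr hA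
  simp [param, paramInv, Matrix.mulVec_mulVec, Matrix.mul_nonsing_inv A h]

theorem paramInv_param {A : Mat} (hA : A.det ≠ 0) (b x : E) : paramInv A b (param A b x) = x := by
  have h : IsUnit A.det := isUnit_iff_ne_zero.mpr hA
  simp [param, paramInv, Matrix.mulVec_mulVec, Matrix.nonsing_inv_mul A h]

theorem Y1_inverse {A : Mat} (hA : A.det ≠ 0) (b : E) :
    Function.LeftInverse (Y1inv A b) (Y1 A b) ∧ Function.RightInverse (Y1inv A b) (Y1 A b) := by
  constructor <;> intro f <;> funext x <;>
    simp [Y1, Y1inv, param_paramInv hA, paramInv_param hA]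

theorem Y2_inverse {A : Mat} (hA : A.det ≠ 0) (b : E) :
    Function.LeftInverse (Y2inv A b) (Y2 A b) ∧ Function.RightInverse (Y2inv A b) (Y2 A b) := by
  have h : IsUnit A.det := isUnit_iff_ne_zero.mpr hA
  have h' : IsUnit A.transpose.det := by rwa [Matrix.det_transpose]
  constructor <;> intro f <;> funext x <;>
    simp only [Y2, Y2inv, param_paramInv hA, paramInv_param hA, Matrix.mul_assoc,
      Matrix.mul_nonsing_inv A h, Matrix.nonsing_inv_mul A h, Matrix.mul_one,
      Matrix.mul_nonsing_inv_cancel_left _ _ h', Matrix.nonsing_inv_mul_cancel_left _ _ h']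

theorem Y3_inverse {A : Mat} (hA : A.det ≠ 0) (b : E) :
    Function.LeftInverse (Y3inv A b) (Y3 A b) ∧ Function.RightInverse (Y3inv A b) (Y3 A b) := by
  have h : IsUnit A.det := isUnit_iff_ne_zero.mpr hA
  have h' : IsUnit A.transpose.det := by rwa [Matrix.det_transpose]
  constructor <;> intro f <;> funext x <;>
    simp only [Y3, Y3inv, param_paramInv hA, paramInv_param hA, Matrix.mul_assoc,
      Matrix.mul_smul, Matrix.smul_mul, smul_smul, mul_inv_cancel₀ hA, inv_mul_cancel₀ hA,
      one_smul, Matrix.mul_nonsing_inv _ h', Matrix.nonsing_inv_mul _ h', Matrix.mul_one,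
      Matrix.mul_nonsing_inv_cancel_left _ _ h', Matrix.nonsing_inv_mul_cancel_left _ _ h']

theorem Y4_inverse {A : Mat} (hA : A.det ≠ 0) (b : E) :
    Function.LeftInverse (Y4inv A b) (Y4 A b) ∧ Function.RightInverse (Y4inv A b) (Y4 A b) := by
  have h : IsUnit A.det := isUnit_iff_ne_zero.mpr hA
  have h' : IsUnit A.transpose.det := by rwa [Matrix.det_transpose]
  constructor <;> intro f <;> funext x <;>
    simp only [Y4, Y4inv, param_paramInv hA, paramInv_param hA, Matrix.mulVec_smul,
      smul_smul, mul_inv_cancel₀ hA, inv_mul_cancel₀ hA, one_smul, Matrix.mulVec_mulVec,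
      Matrix.mul_nonsing_inv _ h', Matrix.nonsing_inv_mul _ h', Matrix.one_mulVec]

/-- Spline space of scalar fields on the physical domain. -/
def V1 (K : ∀ l, OpenKnots (p l) (r l)) (A : Mat) (b : E) : Set (E → ℝ) :=
  {φ | Y1 A b φ ∈ hatV1 K}

/-- Spline space of symmetric matrix fields on the physical domain. -/
def V2 (K : ∀ l, OpenKnots (p l) (r l)) (A : Mat) (b : E) : Set (E → Mat) :=
  {S | Y2 A b S ∈ hatV2 K}

/-- Spline space of trace-free matrix fields on the physical domain. -/
def V3 (K : ∀ l, OpenKnots (p l) (r l)) (A : Mat) (b : E) : Set (E → Mat) :=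
  {T | Y3 A b T ∈ hatV3 K}

/-- Spline space of vector fields on the physical domain. -/
def V4 (K : ∀ l, OpenKnots (p l) (r l)) (A : Mat) (b : E) : Set (E → Fin 3 → ℝ) :=
  {v | Y4 A b v ∈ hatV4 K}

/-- Projection of scalar fields on the physical domain. -/
def Pi1 (K : ∀ l, OpenKnots (p l) (r l)) (g : Fin 3 → ℝ → ℝ) (A : Mat) (b : E) (φ : E → ℝ) :
    E → ℝ :=
  Y1inv A b (hatPi1 K g (Y1 A b φ))

/-- Projection of symmetric matrix fields on the physical domain. -/
def Pi2 (K : ∀ l, OpenKnots (p l) (r l)) (g : Fin 3 → ℝ → ℝ) (A : Mat) (b : E) (S : E → Mat) :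
    E → Mat :=
  Y2inv A b (hatPi2 K g (Y2 A b S))

/-- Projection of trace-free matrix fields on the physical domain. -/
def Pi3 (K : ∀ l, OpenKnots (p l) (r l)) (g : Fin 3 → ℝ → ℝ) (A : Mat) (b : E) (T : E → Mat) :
    E → Mat :=
  Y3inv A b (hatPi3 K g (Y3 A b T))

/-- Projection of vector fields on the physical domain. -/
def Pi4 (K : ∀ l, OpenKnots (p l) (r l)) (g : Fin 3 → ℝ → ℝ) (A : Mat) (b : E)
    (v : E → Fin 3 → ℝ) : E → Fin 3 → ℝ :=
  Y4inv A b (hatPi4 K g (Y4 A b v))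

end HessianSpline

end

noncomputable section

namespace HessianSpline

open Set Filter Topology

section

/-! ### Elementary properties of B-splines -/

section Bspline

variable {ξ : ℕ → ℝ}

theorem bspline_zero_apply (j : ℕ) (x : ℝ) :
    bspline ξ 0 j x = if ξ j ≤ x ∧ x < ξ (j + 1) then 1 else 0 := rfl

theorem bspline_succ_apply (q j : ℕ) (x : ℝ) :
    bspline ξ (q + 1) j x =
      (x - ξ j) / (ξ (j + q + 1) - ξ j) * bspline ξ q j x +
        (ξ (j + q + 2) - x) / (ξ (j + q + 2) - ξ (j + 1)) * bspline ξ q (j + 1) x := rfl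

theorem bspline_eq_zero_of_notMem (hξ : Monotone ξ) (q : ℕ) :
    ∀ (j : ℕ) {x : ℝ}, ¬(ξ j ≤ x ∧ x < ξ (j + q + 1)) → bspline ξ q j x = 0 := by
  induction q with
  | zero => intro j x h; simpa [bspline_zero_apply] using h
  | succ q ih =>
    intro j x h
    have h1 : ξ j ≤ ξ (j + 1) := hξ (by omega)
    have h2 : ξ (j + q + 1) ≤ ξ (j + q + 2) := hξ (by omega)
    rw [bspline_succ_apply, ih j, ih (j + 1)]
    · simp
    · rintro ⟨h3, h4⟩
      exact h ⟨h1.trans h3, by convert h4 using 2; omega⟩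
    · rintro ⟨h3, h4⟩
      exact h ⟨h3, h4.trans_le h2⟩

theorem bspline_eq_zero_of_knots_eq (hξ : Monotone ξ) {q j : ℕ} (h : ξ j = ξ (j + q + 1))
    (x : ℝ) : bspline ξ q j x = 0 :=
  bspline_eq_zero_of_notMem hξ q j (by rw [h]; exact fun h' => (h'.1.trans_lt h'.2).false)

theorem bspline_nonneg (hξ : Monotone ξ) (q : ℕ) : ∀ (j : ℕ) (x : ℝ), 0 ≤ bspline ξ q j x := by
  induction q with
  | zero => intro j x; rw [bspline_zero_apply]; split_ifs <;> norm_num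
  | succ q ih =>
    intro j x
    by_cases h : ξ j ≤ x ∧ x < ξ (j + (q + 1) + 1)
    · rw [bspline_succ_apply]
      have h1 : ξ j ≤ ξ (j + q + 1) := hξ (by omega)
      have h2 : ξ (j + 1) ≤ ξ (j + q + 2) := hξ (by omega)
      have h3 : x ≤ ξ (j + q + 2) := h.2.le
      exact add_nonneg
        (mul_nonneg (div_nonneg (sub_nonneg.2 h.1) (sub_nonneg.2 h1)) (ih _ _))
        (mul_nonneg (div_nonneg (sub_nonneg.2 h3) (sub_nonneg.2 h2)) (ih _ _))
    · rw [bspline_eq_zero_of_notMem hξ _ _ h]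

theorem measurable_bspline (ξ : ℕ → ℝ) (q : ℕ) : ∀ j, Measurable (bspline ξ q j) := by
  induction q with
  | zero =>
    intro j
    have : bspline ξ 0 j = (Ico (ξ j) (ξ (j + 1))).indicator (fun _ => (1 : ℝ)) := by
      ext x; simp [bspline_zero_apply, indicator, mem_Ico]
    rw [this]
    exact measurable_const.indicator measurableSet_Ico
  | succ q ih =>
    intro j
    have : bspline ξ (q + 1) j = fun x =>
      (x - ξ j) / (ξ (j + q + 1) - ξ j) * bspline ξ q j x +
        (ξ (j + q + 2) - x) / (ξ (j + q + 2) - ξ (j + 1)) * bspline ξ q (j + 1) x := rfl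
    rw [this]
    have h1 := ih j
    have h2 := ih (j + 1)
    fun_prop

/-- The Cox–de Boor weights of a B-spline add up to one wherever it is nonzero. -/
theorem coxDeBoor_weights (hξ : Monotone ξ) (q j : ℕ) (x : ℝ) :
    (ξ (j + q + 1) - x) / (ξ (j + q + 1) - ξ j) * bspline ξ q j x =
      bspline ξ q j x - (x - ξ j) / (ξ (j + q + 1) - ξ j) * bspline ξ q j x := by
  rcases eq_or_ne (ξ j) (ξ (j + q + 1)) with h | h
  · simp [bspline_eq_zero_of_knots_eq hξ h]
  · have : ξ (j + q + 1) - ξ j ≠ 0 := sub_ne_zero.2 h.symm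
    field_simp
    ring

theorem sum_mul_bspline_succ (hξ : Monotone ξ) (c : ℕ → ℝ) (q N : ℕ) (x : ℝ) :
    ∑ i ∈ Finset.range N, c i * bspline ξ (q + 1) i x =
      (∑ i ∈ Finset.range N, c i * ((x - ξ i) / (ξ (i + q + 1) - ξ i) * bspline ξ q i x)) +
      ∑ i ∈ Finset.range N, c i * (bspline ξ q (i + 1) x -
        (x - ξ (i + 1)) / (ξ (i + 1 + q + 1) - ξ (i + 1)) * bspline ξ q (i + 1) x) := by
  rw [← Finset.sum_add_distrib]
  refine Finset.sum_congr rfl fun i _ => ?_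
  rw [bspline_succ_apply, ← coxDeBoor_weights hξ, show i + 1 + q + 1 = i + q + 2 by omega]
  ring

theorem sum_bspline_zero (hξ : Monotone ξ) (N : ℕ) (x : ℝ) :
    ∑ i ∈ Finset.range N, bspline ξ 0 i x = if ξ 0 ≤ x ∧ x < ξ N then 1 else 0 := by
  induction N with
  | zero => rw [if_neg (fun h => (h.1.trans_lt h.2).false)]; simp
  | succ N ih =>
    rw [Finset.sum_range_succ, ih, bspline_zero_apply]
    have h1 : ξ 0 ≤ ξ N := hξ (by omega)
    have h2 : ξ N ≤ ξ (N + 1) := hξ (by omega)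
    split_ifs <;> grind

theorem sum_bspline_le_one (hξ : Monotone ξ) (q : ℕ) :
    ∀ (N : ℕ) (x : ℝ), ∑ i ∈ Finset.range N, bspline ξ q i x ≤ 1 := by
  induction q with
  | zero =>
    intro N x
    rw [sum_bspline_zero hξ]; split_ifs <;> norm_num
  | succ q ih =>
    intro N x
    have h := sum_mul_bspline_succ hξ (fun _ => 1) q N x
    simp only [one_mul] at h
    set w : ℕ → ℝ := fun i => (x - ξ i) / (ξ (i + q + 1) - ξ i) * bspline ξ q i x with hw
    have hw0 : w 0 ≤ bspline ξ q 0 x := by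
      have h0 := coxDeBoor_weights hξ q 0 x
      by_cases h1 : ξ 0 ≤ x ∧ x < ξ (0 + q + 1)
      · have : 0 ≤ (ξ (0 + q + 1) - x) / (ξ (0 + q + 1) - ξ 0) * bspline ξ q 0 x :=
          mul_nonneg (div_nonneg (by linarith [h1.2]) (by linarith [h1.1, h1.2]))
            (bspline_nonneg hξ _ _ _)
        simp only [hw]; linarith
      · simp [hw, bspline_eq_zero_of_notMem hξ _ _ h1]
    have hwN : 0 ≤ w N := by
      by_cases h1 : ξ N ≤ x ∧ x < ξ (N + q + 1)
      · exact mul_nonneg (div_nonneg (by linarith [h1.1]) (by linarith [h1.1, h1.2]))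
            (bspline_nonneg hξ _ _ _)
      · simp [hw, bspline_eq_zero_of_notMem hξ _ _ h1]
    have e2 : ∑ i ∈ Finset.range N, (bspline ξ q (i + 1) x - w (i + 1)) =
        (∑ i ∈ Finset.range (N + 1), bspline ξ q i x - bspline ξ q 0 x) -
          (∑ i ∈ Finset.range N, w i + w N - w 0) := by
      rw [Finset.sum_sub_distrib, Finset.sum_range_succ' (fun i => bspline ξ q i x),
        ← Finset.sum_range_succ w, Finset.sum_range_succ' w]
      ring
    rw [h, e2]
    linarith [ih (N + 1) x]

theorem bspline_le_one (hξ : Monotone ξ) (q j : ℕ) (x : ℝ) : bspline ξ q j x ≤ 1 :=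
  (Finset.single_le_sum (f := fun i => bspline ξ q i x) (fun i _ => bspline_nonneg hξ q i x)
    (Finset.self_mem_range_succ j)).trans (sum_bspline_le_one hξ q (j + 1) x)

theorem abs_bspline_le_one (hξ : Monotone ξ) (q j : ℕ) (x : ℝ) : |bspline ξ q j x| ≤ 1 := by
  rw [abs_of_nonneg (bspline_nonneg hξ q j x)]; exact bspline_le_one hξ q j x

/-- The derivative of a B-spline away from the knots. -/
theorem hasDerivAt_bspline (hξ : Monotone ξ) {x : ℝ} (hx : ∀ j, ξ j ≠ x) (q : ℕ) : ∀ j,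
    HasDerivAt (bspline ξ q j) (q * (bspline ξ (q - 1) j x / (ξ (j + q) - ξ j) -
      bspline ξ (q - 1) (j + 1) x / (ξ (j + q + 1) - ξ (j + 1)))) x := by
  induction q with
  | zero =>
    intro j
    have hev : bspline ξ 0 j =ᶠ[𝓝 x] fun _ => bspline ξ 0 j x := by
      rcases (hx j).lt_or_gt with h1 | h1 <;> rcases (hx (j + 1)).lt_or_gt with h2 | h2 <;>
        [filter_upwards [lt_mem_nhds h1, lt_mem_nhds h2] with y h3 h4;
         filter_upwards [lt_mem_nhds h1, gt_mem_nhds h2] with y h3 h4;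
         filter_upwards [gt_mem_nhds h1, lt_mem_nhds h2] with y h3 h4;
         filter_upwards [gt_mem_nhds h1, gt_mem_nhds h2] with y h3 h4] <;>
      · simp only [bspline_zero_apply]
        split_ifs <;> grind
    simpa using (hasDerivAt_const x (bspline ξ 0 j x)).congr_of_eventuallyEq hev
  | succ q ih =>
    intro j
    have hd : HasDerivAt (bspline ξ (q + 1) j)
        (1 / (ξ (j + q + 1) - ξ j) * bspline ξ q j x + (x - ξ j) / (ξ (j + q + 1) - ξ j) *
          (q * (bspline ξ (q - 1) j x / (ξ (j + q) - ξ j) -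
            bspline ξ (q - 1) (j + 1) x / (ξ (j + q + 1) - ξ (j + 1)))) +
        ((-1) / (ξ (j + q + 2) - ξ (j + 1)) * bspline ξ q (j + 1) x +
          (ξ (j + q + 2) - x) / (ξ (j + q + 2) - ξ (j + 1)) *
          (q * (bspline ξ (q - 1) (j + 1) x / (ξ (j + 1 + q) - ξ (j + 1)) -
            bspline ξ (q - 1) (j + 1 + 1) x / (ξ (j + 1 + q + 1) - ξ (j + 1 + 1)))))) x := by
      have h1 : HasDerivAt (fun y => (y - ξ j) / (ξ (j + q + 1) - ξ j))
          (1 / (ξ (j + q + 1) - ξ j)) x := ((hasDerivAt_id x).sub_const _).div_const _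
      have h2 : HasDerivAt (fun y => (ξ (j + q + 2) - y) / (ξ (j + q + 2) - ξ (j + 1)))
          ((-1) / (ξ (j + q + 2) - ξ (j + 1))) x := ((hasDerivAt_id x).const_sub _).div_const _
      exact (h1.mul (ih j)).add (h2.mul (ih (j + 1)))
    convert hd using 1
    rw [Nat.add_sub_cancel]
    rcases q with _ | q
    · simp; ring_nf
    rw [Nat.add_sub_cancel, show j + 1 + (q + 1) = j + (q + 1) + 1 by omega,
      show j + 1 + 1 = j + 2 by omega, show j + (q + 1) + 1 + 1 = j + (q + 1) + 2 by omega,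
      bspline_succ_apply, bspline_succ_apply, show j + q + 1 = j + (q + 1) by omega,
      show j + q + 2 = j + (q + 1) + 1 by omega, show j + 1 + q + 1 = j + (q + 1) + 1 by omega,
      show j + 1 + q + 2 = j + (q + 1) + 2 by omega, show j + 1 + 1 = j + 2 by omega]
    push_cast
    have hm1 : ξ j ≤ ξ (j + 1) := hξ (by omega)
    have hm2 : ξ (j + 1) ≤ ξ (j + (q + 1)) := hξ (by omega)
    have hm3 : ξ (j + (q + 1)) ≤ ξ (j + (q + 1) + 1) := hξ (by omega)
    have hm4 : ξ (j + (q + 1) + 1) ≤ ξ (j + (q + 1) + 2) := hξ (by omega)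
    rcases eq_or_ne (ξ (j + 1)) (ξ (j + (q + 1) + 1)) with hb | hb
    · have : bspline ξ q (j + 1) x = 0 :=
        bspline_eq_zero_of_knots_eq hξ (by convert hb using 2; omega) x
      rw [this]; ring_nf
    · have ha : ξ (j + (q + 1) + 1) - ξ j ≠ 0 := by
        intro h; exact hb (by linarith)
      have hc : ξ (j + (q + 1) + 2) - ξ (j + 1) ≠ 0 := by
        intro h; exact hb (by linarith)
      have hb' : ξ (j + (q + 1) + 1) - ξ (j + 1) ≠ 0 := sub_ne_zero.2 hb.symm
      generalize bspline ξ q j x = u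
      generalize bspline ξ q (j + 1) x = v
      generalize bspline ξ q (j + 2) x = w
      generalize ξ j = t₀ at *
      generalize ξ (j + 1) = t₁ at *
      generalize ξ (j + 2) = t₂ at *
      generalize ξ (j + (q + 1) + 2) = s₂ at *
      generalize ξ (j + (q + 1) + 1) = s₁ at *
      generalize ξ (j + (q + 1)) = s₀ at *
      simp only [div_eq_mul_inv]
      generalize (s₀ - t₀)⁻¹ = c₀
      generalize (s₂ - t₂)⁻¹ = c₂
      field_simp
      ring

end Bspline

end

section

/-! ### B-splines as Peano kernels -/

theorem setIntegral_Ioo_eq_intervalIntegral (f : ℝ → ℝ) {a b : ℝ} (h : a ≤ b) :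
    ∫ t in Ioo a b, f t = ∫ t in a..b, f t := by
  rw [intervalIntegral.integral_of_le h, integral_Ioc_eq_integral_Ioo]

/-- Absolute continuity on the unit interval. -/
abbrev AC (H : ℝ → ℝ) : Prop := AbsolutelyContinuousOnInterval H 0 1

theorem AC.continuousOn_Icc {H : ℝ → ℝ} (h : AC H) : ContinuousOn H (Icc 0 1) := by
  simpa [uIcc_of_le] using AbsolutelyContinuousOnInterval.continuousOn h

theorem AC.integrableOn_deriv {H : ℝ → ℝ} (h : AC H) : IntegrableOn (deriv H) (Ioo 0 1) :=
  (intervalIntegrable_iff_integrableOn_Ioo_of_le zero_le_one).1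
    (AbsolutelyContinuousOnInterval.intervalIntegrable_deriv h)

theorem AC.ae_differentiableAt_Ioo {H : ℝ → ℝ} (h : AC H) :
    ∀ᵐ t ∂(volume.restrict (Ioo (0 : ℝ) 1)), DifferentiableAt ℝ H t := by
  rw [ae_restrict_iff' measurableSet_Ioo]
  filter_upwards [AbsolutelyContinuousOnInterval.ae_differentiableAt h] with t ht ht'
  exact ht (by rw [uIcc_of_le zero_le_one]; exact Ioo_subset_Icc_self ht')

theorem AC.linear (α β : ℝ) : AC (fun t => α * t + β) :=
  ContDiffOn.absolutelyContinuousOnInterval (by fun_prop)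

theorem AC.linear_mul (α β : ℝ) {H : ℝ → ℝ} (h : AC H) : AC (fun t => (α * t + β) * H t) :=
  AbsolutelyContinuousOnInterval.fun_mul (AC.linear α β) h

theorem AC.setIntegral_deriv {H : ℝ → ℝ} (h : AC H) {a b : ℝ} (ha : 0 ≤ a) (hab : a ≤ b)
    (hb : b ≤ 1) : ∫ t in Ioo a b, deriv H t = H b - H a := by
  rw [setIntegral_Ioo_eq_intervalIntegral _ hab]
  refine AbsolutelyContinuousOnInterval.integral_deriv_eq_sub
    (AbsolutelyContinuousOnInterval.mono h ?_)
  rw [uIcc_of_le hab, uIcc_of_le zero_le_one]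
  exact Icc_subset_Icc ha hb

section Peano

variable {ξ : ℕ → ℝ}

theorem integrableOn_bspline_mul (hξ : Monotone ξ) (q j : ℕ) {F : ℝ → ℝ} {s : Set ℝ}
    (hF : IntegrableOn F s) : IntegrableOn (fun t => bspline ξ q j t * F t) s :=
  Integrable.bdd_mul hF (measurable_bspline ξ q j).aestronglyMeasurable
    (Eventually.of_forall fun t => by
      rw [Real.norm_eq_abs]; exact abs_bspline_le_one hξ q j t)

theorem integrableOn_Ioo_of_continuousOn {H : ℝ → ℝ} (h : ContinuousOn H (Icc 0 1)) :
    IntegrableOn H (Ioo 0 1) :=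
  (h.integrableOn_compact isCompact_Icc).mono_set Ioo_subset_Icc_self

/-- The mean of a function against the `j`-th B-spline of degree `m - 1`, normalised to have total
mass one; if all the knots coincide it is the value at this knot. -/
def knotMean (ξ : ℕ → ℝ) (m j : ℕ) (H : ℝ → ℝ) : ℝ :=
  if ξ j < ξ (j + m) then
    m / (ξ (j + m) - ξ j) * ∫ t in Ioo (0 : ℝ) 1, bspline ξ (m - 1) j t * H t
  else H (ξ j)

theorem knotMean_zero (j : ℕ) (H : ℝ → ℝ) : knotMean ξ 0 j H = H (ξ j) := by simp [knotMean]

theorem knotMean_of_eq {m j : ℕ} (h : ξ j = ξ (j + m)) (H : ℝ → ℝ) :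
    knotMean ξ m j H = H (ξ j) := by
  rw [knotMean, if_neg (by rw [h]; exact lt_irrefl _)]

theorem knotMean_of_lt {m j : ℕ} (h : ξ j < ξ (j + m)) (H : ℝ → ℝ) :
    knotMean ξ m j H =
      m / (ξ (j + m) - ξ j) * ∫ t in Ioo (0 : ℝ) 1, bspline ξ (m - 1) j t * H t := by
  rw [knotMean, if_pos h]

theorem integral_bspline_linear_mul (hξ : Monotone ξ) (q j : ℕ) {F : ℝ → ℝ} (α β : ℝ)
    (hF : IntegrableOn F (Ioo 0 1)) :
    ∫ t in Ioo (0 : ℝ) 1, bspline ξ q j t * ((α * t + β) * F t) =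
      α * (∫ t in Ioo (0 : ℝ) 1, bspline ξ q j t * (t * F t)) +
        β * ∫ t in Ioo (0 : ℝ) 1, bspline ξ q j t * F t := by
  have h1 : IntegrableOn (fun t => t * F t) (Ioo 0 1) :=
    Integrable.bdd_mul hF measurable_id.aestronglyMeasurable (c := 1)
      ((ae_restrict_iff' measurableSet_Ioo).2 (Eventually.of_forall fun t ht => by
        change |t| ≤ 1; rw [abs_of_pos ht.1]; exact ht.2.le))
  rw [← integral_const_mul, ← integral_const_mul, ← integral_add]
  · congr 1; ext t; ring
  · exact (integrableOn_bspline_mul hξ q j h1).const_mul _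
  · exact (integrableOn_bspline_mul hξ q j hF).const_mul _

theorem knotMean_linear_mul (hξ : Monotone ξ) (m j : ℕ) {H : ℝ → ℝ} (α β : ℝ)
    (hH : ContinuousOn H (Icc 0 1)) :
    knotMean ξ m j (fun t => (α * t + β) * H t) =
      α * knotMean ξ m j (fun t => t * H t) + β * knotMean ξ m j H := by
  rcases (hξ (Nat.le_add_right j m)).eq_or_lt with h | h
  · simp only [knotMean_of_eq h]; ring
  · simp only [knotMean_of_lt h]
    rw [integral_bspline_linear_mul hξ _ _ _ _ (integrableOn_Ioo_of_continuousOn hH)]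
    ring

theorem knotMean_sub (hξ : Monotone ξ) (m j : ℕ) {H H' : ℝ → ℝ}
    (hH : ContinuousOn H (Icc 0 1)) (hH' : ContinuousOn H' (Icc 0 1)) :
    knotMean ξ m j (fun t => H t - H' t) = knotMean ξ m j H - knotMean ξ m j H' := by
  rcases (hξ (Nat.le_add_right j m)).eq_or_lt with h | h
  · simp only [knotMean_of_eq h]
  · simp only [knotMean_of_lt h, mul_sub]
    rw [integral_sub, mul_sub]
    · exact integrableOn_bspline_mul hξ _ _ (integrableOn_Ioo_of_continuousOn hH)
    · exact integrableOn_bspline_mul hξ _ _ (integrableOn_Ioo_of_continuousOn hH')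

theorem integral_bspline_succ_mul (hξ : Monotone ξ) (q j : ℕ) {F : ℝ → ℝ}
    (hF : IntegrableOn F (Ioo 0 1)) :
    ∫ t in Ioo (0 : ℝ) 1, bspline ξ (q + 1) j t * F t =
      (∫ t in Ioo (0 : ℝ) 1, bspline ξ q j t * ((1 * t + -ξ j) * F t)) / (ξ (j + q + 1) - ξ j) +
      (∫ t in Ioo (0 : ℝ) 1, bspline ξ q (j + 1) t * (((-1) * t + ξ (j + q + 2)) * F t)) /
        (ξ (j + q + 2) - ξ (j + 1)) := by
  have hl : ∀ α β : ℝ, IntegrableOn (fun t => (α * t + β) * F t) (Ioo 0 1) := fun α β =>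
    Integrable.bdd_mul hF (by fun_prop : Measurable fun t : ℝ => α * t + β).aestronglyMeasurable
      (c := |α| + |β|)
      ((ae_restrict_iff' measurableSet_Ioo).2 (Eventually.of_forall fun t ht => by
        rw [Real.norm_eq_abs]
        refine (abs_add_le _ _).trans ?_
        rw [abs_mul, abs_of_pos ht.1]
        have := mul_le_mul_of_nonneg_left ht.2.le (abs_nonneg α)
        linarith))
  rw [← integral_div, ← integral_div, ← integral_add]
  · congr 1; ext t; rw [bspline_succ_apply]; ring
  · exact (integrableOn_bspline_mul hξ q j (hl _ _)).div_const _
  · exact (integrableOn_bspline_mul hξ q (j + 1) (hl _ _)).div_const _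

theorem mul_integral_bspline_mul (hξ : Monotone ξ) (q j : ℕ) {H : ℝ → ℝ}
    (hH : ContinuousOn H (Icc 0 1)) :
    (q : ℝ) * ∫ t in Ioo (0 : ℝ) 1, bspline ξ q j t * H t =
      knotMean ξ q j (fun t => t * H t) - ξ j * knotMean ξ q j H +
      (ξ (j + q + 1) * knotMean ξ q (j + 1) H - knotMean ξ q (j + 1) (fun t => t * H t)) := by
  rcases q with _ | q
  · simp [knotMean_zero]
  have hI := integrableOn_Ioo_of_continuousOn hH
  rw [integral_bspline_succ_mul hξ q j hI, integral_bspline_linear_mul hξ _ _ _ _ hI,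
    integral_bspline_linear_mul hξ _ _ _ _ hI]
  have e1 : j + 1 + (q + 1) = j + q + 2 := by omega
  have e2 : j + (q + 1) = j + q + 1 := by omega
  have e3 : j + q + 1 + 1 = j + q + 2 := by omega
  have k : ∀ (i : ℕ) (F : ℝ → ℝ), ξ i < ξ (i + (q + 1)) → knotMean ξ (q + 1) i F =
      (q + 1) / (ξ (i + (q + 1)) - ξ i) * ∫ t in Ioo (0 : ℝ) 1, bspline ξ q i t * F t := by
    intro i F h; rw [knotMean_of_lt h]; push_cast; rfl
  rcases (hξ (show j ≤ j + (q + 1) by omega)).eq_or_lt with h | h <;>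
    rcases (hξ (show j + 1 ≤ j + 1 + (q + 1) by omega)).eq_or_lt with h' | h'
  · rw [knotMean_of_eq h, knotMean_of_eq h, knotMean_of_eq h', knotMean_of_eq h']
    rw [e1] at h'
    rw [e2] at h ⊢
    simp only [e3, ← h, ← h', sub_self, div_zero]
    ring
  · rw [knotMean_of_eq h, knotMean_of_eq h, k _ _ h', k _ _ h', e1]
    rw [e2] at h ⊢
    simp only [e3, ← h, sub_self, div_zero]
    push_cast; ring
  · rw [k _ _ h, k _ _ h, knotMean_of_eq h', knotMean_of_eq h']
    rw [e1] at h'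
    rw [e2]
    simp only [e3, ← h', sub_self, div_zero]
    push_cast; ring
  · rw [k _ _ h, k _ _ h, k _ _ h', k _ _ h', e1, e2, e3]
    push_cast; ring

theorem ae_deriv_linear_mul {H : ℝ → ℝ} (hH : AC H) (α β : ℝ) :
    ∀ᵐ t ∂(volume.restrict (Ioo (0 : ℝ) 1)),
      deriv (fun t => (α * t + β) * H t) t = α * H t + (α * t + β) * deriv H t := by
  filter_upwards [hH.ae_differentiableAt_Ioo] with t ht
  have h1 : HasDerivAt (fun t : ℝ => α * t + β) α t := by
    simpa using ((hasDerivAt_id t).const_mul α).add_const β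
  exact (h1.mul ht.hasDerivAt).deriv

theorem integral_bspline_linear_mul_deriv (hξ : Monotone ξ) (q j : ℕ) {H : ℝ → ℝ} (hH : AC H)
    (α β : ℝ) :
    ∫ t in Ioo (0 : ℝ) 1, bspline ξ q j t * ((α * t + β) * deriv H t) =
      (∫ t in Ioo (0 : ℝ) 1, bspline ξ q j t * deriv (fun t => (α * t + β) * H t) t) -
        α * ∫ t in Ioo (0 : ℝ) 1, bspline ξ q j t * H t := by
  have hI := integrableOn_Ioo_of_continuousOn hH.continuousOn_Icc
  rw [← integral_const_mul, ← integral_sub]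
  · refine integral_congr_ae ?_
    filter_upwards [ae_deriv_linear_mul hH α β] with t ht
    rw [ht]; ring
  · exact integrableOn_bspline_mul hξ q j (hH.linear_mul α β).integrableOn_deriv
  · exact (integrableOn_bspline_mul hξ q j hI).const_mul _

theorem knotMean_of_knots_eq (hξ : Monotone ξ) {m j i : ℕ} (h : ξ j = ξ (i + m)) (hji : j ≤ i)
    (H : ℝ → ℝ) : knotMean ξ m i H = H (ξ j) := by
  have h1 : ξ j ≤ ξ i := hξ hji
  have h2 : ξ i ≤ ξ (i + m) := hξ (by omega)
  rw [knotMean_of_eq (by linarith), show ξ i = ξ j by linarith]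

/-- Integration by parts against a B-spline; this holds for knots of any multiplicity. -/
theorem integral_bspline_mul_deriv (hξ : Monotone ξ) (h01 : ∀ j, ξ j ∈ Icc (0 : ℝ) 1) (q : ℕ) :
    ∀ (j : ℕ) {H : ℝ → ℝ}, AC H →
      ∫ t in Ioo (0 : ℝ) 1, bspline ξ q j t * deriv H t =
        knotMean ξ q (j + 1) H - knotMean ξ q j H := by
  induction q with
  | zero =>
    intro j H hH
    rw [knotMean_zero, knotMean_zero,
      ← hH.setIntegral_deriv (h01 j).1 (hξ (Nat.le_succ j)) (h01 (j + 1)).2]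
    have : ∀ t, bspline ξ 0 j t * deriv H t = (Ico (ξ j) (ξ (j + 1))).indicator (deriv H) t := by
      intro t; simp [bspline_zero_apply, indicator, mem_Ico]
    simp_rw [this]
    rw [← integral_Ico_eq_integral_Ioo, ← integral_Ico_eq_integral_Ioo,
      setIntegral_indicator measurableSet_Ico]
    congr 2
    rw [Ico_inter_Ico]
    congr 1
    · exact max_eq_right (h01 j).1
    · exact min_eq_right (h01 (j + 1)).2
  | succ q ih =>
    intro j H hH
    have hc := hH.continuousOn_Icc
    rw [integral_bspline_succ_mul hξ q j hH.integrableOn_deriv,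
      integral_bspline_linear_mul_deriv hξ _ _ hH, integral_bspline_linear_mul_deriv hξ _ _ hH,
      ih j (hH.linear_mul _ _), ih (j + 1) (hH.linear_mul _ _),
      knotMean_linear_mul hξ _ _ _ _ hc, knotMean_linear_mul hξ _ _ _ _ hc,
      knotMean_linear_mul hξ _ _ _ _ hc, knotMean_linear_mul hξ _ _ _ _ hc]
    have hq1 := mul_integral_bspline_mul hξ q j hc
    have hq2 := mul_integral_bspline_mul hξ q (j + 1) hc
    have m1 : ξ j ≤ ξ (j + 1) := hξ (by omega)
    have m2 : ξ (j + 1) ≤ ξ (j + q + 1) := hξ (by omega)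
    have m3 : ξ (j + q + 1) ≤ ξ (j + q + 2) := hξ (by omega)
    rw [show j + 1 + q + 1 = j + q + 2 by omega] at hq2
    have e1 : j + (q + 1) = j + q + 1 := by omega
    have e2 : j + 1 + (q + 1) = j + q + 2 := by omega
    rcases (m1.trans m2).eq_or_lt with h | h <;> rcases (m2.trans m3).eq_or_lt with h' | h'
    · rw [knotMean_of_knots_eq hξ (m := q + 1) (j := j) (i := j + 1) (by rw [e2]; linarith)
        (by omega), knotMean_of_knots_eq hξ (m := q + 1) (j := j) (i := j) (by rw [e1]; linarith)
        le_rfl, ← h, ← h']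
      simp
    · rw [knotMean_of_knots_eq hξ (m := q + 1) (j := j) (i := j) (by rw [e1]; linarith) le_rfl,
        knotMean_of_lt (m := q + 1) (j := j + 1) (by rw [e2]; exact h'), e2, Nat.add_sub_cancel]
      have k1 : ∀ H, knotMean ξ q (j + 1) H = H (ξ j) := fun H =>
        knotMean_of_knots_eq hξ (by rw [h]; congr 1; omega) (by omega) H
      simp only [k1] at hq1 hq2 ⊢
      rw [← h]
      simp only [sub_self, div_zero]
      have : ξ (j + q + 2) - ξ (j + 1) ≠ 0 := by linarith
      have h5 : ξ (j + 1) = ξ j := by linarith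
      field_simp
      push_cast
      rw [h5] at hq2
      linear_combination (-1) * hq2 - H (ξ j) * h5
    · rw [knotMean_of_knots_eq hξ (m := q + 1) (j := j + 1) (i := j + 1) (by rw [e2]; linarith)
        le_rfl, knotMean_of_lt (m := q + 1) (j := j) (by rw [e1]; exact h), e1,
        Nat.add_sub_cancel]
      have k1 : ∀ H, knotMean ξ q (j + 1) H = H (ξ (j + 1)) := fun H =>
        knotMean_of_knots_eq hξ (by rw [show j + 1 + q = j + q + 1 by omega]; linarith)
          (by omega) H
      simp only [k1] at hq1 hq2 ⊢
      rw [← h']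
      simp only [sub_self, div_zero]
      have : ξ (j + q + 1) - ξ j ≠ 0 := by linarith
      have h5 : ξ (j + q + 1) = ξ (j + 1) := by linarith
      field_simp
      push_cast
      rw [h5] at hq1
      linear_combination hq1 - H (ξ (j + 1)) * h5
    · rw [knotMean_of_lt (m := q + 1) (j := j) (by rw [e1]; exact h),
        knotMean_of_lt (m := q + 1) (j := j + 1) (by rw [e2]; exact h'), e1, e2,
        Nat.add_sub_cancel]
      have n1 : ξ (j + q + 1) - ξ j ≠ 0 := by linarith
      have n2 : ξ (j + q + 2) - ξ (j + 1) ≠ 0 := by linarith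
      push_cast
      field_simp
      linear_combination (ξ (j + q + 2) - ξ (j + 1)) * hq1 - (ξ (j + q + 1) - ξ j) * hq2

theorem knotMean_const_one (hξ : Monotone ξ) (h01 : ∀ j, ξ j ∈ Icc (0 : ℝ) 1) (m : ℕ) :
    ∀ j, knotMean ξ m j (fun _ => 1) = 1 := by
  induction m with
  | zero => intro j; simp [knotMean_zero]
  | succ m ih =>
    intro j
    rcases (hξ (show j ≤ j + (m + 1) by omega)).eq_or_lt with h | h
    · rw [knotMean_of_eq h]
    · rw [knotMean_of_lt h, Nat.add_sub_cancel]
      have h1 := mul_integral_bspline_mul hξ m j (H := fun _ => 1) continuousOn_const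
      have h2 := integral_bspline_mul_deriv hξ h01 m j (H := fun t => 1 * t + 0) (AC.linear 1 0)
      have h3 : deriv (fun t : ℝ => 1 * t + 0) = fun _ => 1 := by
        ext t; simp
      rw [h3] at h2
      simp only [ih, mul_one, one_mul, add_zero] at h1 h2 ⊢
      rw [show j + (m + 1) = j + m + 1 by omega] at *
      have : ξ (j + m + 1) - ξ j ≠ 0 := by linarith
      field_simp
      push_cast
      linear_combination h1 + h2

theorem integral_bspline (hξ : Monotone ξ) (h01 : ∀ j, ξ j ∈ Icc (0 : ℝ) 1) (q j : ℕ) :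
    ((q : ℝ) + 1) * ∫ t in Ioo (0 : ℝ) 1, bspline ξ q j t = ξ (j + q + 1) - ξ j := by
  have h := knotMean_const_one hξ h01 (q + 1) j
  rcases (hξ (show j ≤ j + (q + 1) by omega)).eq_or_lt with h' | h'
  · simp only [bspline_eq_zero_of_knots_eq hξ h', integral_zero, mul_zero]
    rw [add_assoc, ← h', sub_self]
  · rw [knotMean_of_lt h', Nat.add_sub_cancel, ← add_assoc] at h
    rw [← add_assoc] at h'
    have : ξ (j + q + 1) - ξ j ≠ 0 := by linarith
    simp only [mul_one] at h
    field_simp at h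
    push_cast at h
    exact h

/-- Normalised divided differences vanish on functions that vanish at the knots, counted with
multiplicity. -/
theorem knotMean_iteratedDeriv_eq_zero (hξ : Monotone ξ) (h01 : ∀ j, ξ j ∈ Icc (0 : ℝ) 1)
    {f : ℝ → ℝ} (m : ℕ) : ∀ (j : ℕ), (∀ d < m, AC (iteratedDeriv d f)) →
    (∀ c d, j ≤ c → c ≤ d → d ≤ j + m → ξ c = ξ d → iteratedDeriv (d - c) f (ξ c) = 0) →
    knotMean ξ m j (iteratedDeriv m f) = 0 := by
  induction m with
  | zero => intro j _ h; rw [knotMean_zero]; simpa using h j j le_rfl le_rfl le_rfl rfl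
  | succ m ih =>
    intro j hAC h
    rcases (hξ (show j ≤ j + (m + 1) by omega)).eq_or_lt with h' | h'
    · rw [knotMean_of_eq h']
      simpa using h j (j + (m + 1)) le_rfl (by omega) le_rfl h'
    · rw [knotMean_of_lt h', Nat.add_sub_cancel, iteratedDeriv_succ,
        integral_bspline_mul_deriv hξ h01 m j (hAC m (by omega)),
        ih j (fun d hd => hAC d (by omega)) (fun c d h1 h2 h3 => h c d h1 h2 (by omega)),
        ih (j + 1) (fun d hd => hAC d (by omega))
          (fun c d h1 h2 h3 => h c d (by omega) h2 (by omega))]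
      simp

end Peano

end

section

/-! ### Potentials of the dual functionals -/

theorem iteratedDeriv_sub_mul {f : ℝ → ℝ} (a : ℝ) (d : ℕ) (hf : ContDiff ℝ d f) (t : ℝ) :
    iteratedDeriv d (fun t => (t - a) * f t) t =
      (t - a) * iteratedDeriv d f t + d * iteratedDeriv (d - 1) f t := by
  induction d generalizing t with
  | zero => simp
  | succ d ih =>
    have h1 : ContDiff ℝ d f := hf.of_le (by exact_mod_cast Nat.le_succ d)
    have h2 : Differentiable ℝ (iteratedDeriv d f) := hf.differentiable_iteratedDeriv d (by
      exact_mod_cast Nat.lt_succ_self d)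
    have h3 : HasDerivAt (iteratedDeriv d f) (iteratedDeriv (d + 1) f t) t := by
      rw [iteratedDeriv_succ]; exact (h2 t).hasDerivAt
    rw [iteratedDeriv_succ, funext (ih h1)]
    have h4 : HasDerivAt (fun t => (t - a) * iteratedDeriv d f t)
        (1 * iteratedDeriv d f t + (t - a) * iteratedDeriv (d + 1) f t) t :=
      ((hasDerivAt_id t).sub_const a).mul h3
    rcases d with _ | d
    · simpa [add_comm] using h4.deriv
    · have h5 : Differentiable ℝ (iteratedDeriv d f) := hf.differentiable_iteratedDeriv d (by
        exact_mod_cast (by omega : d < d + 1 + 1))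
      have h6 : HasDerivAt (iteratedDeriv d f) (iteratedDeriv (d + 1) f t) t := by
        rw [iteratedDeriv_succ]; exact (h5 t).hasDerivAt
      have := (h4.add (h6.const_mul ((d + 1 : ℕ) : ℝ))).deriv
      simp only [Nat.add_sub_cancel]
      refine Eq.trans this ?_
      push_cast; ring

theorem iteratedDeriv_const_mul_sub {f₁ f₂ : ℝ → ℝ} {d : ℕ} (c : ℝ) (h₁ : ContDiff ℝ d f₁)
    (h₂ : ContDiff ℝ d f₂) (t : ℝ) :
    iteratedDeriv d (fun t => c * (f₁ t - f₂ t)) t =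
      c * (iteratedDeriv d f₁ t - iteratedDeriv d f₂ t) := by
  rw [iteratedDeriv_const_mul_field]
  congr 1
  exact iteratedDeriv_sub h₁.contDiffAt h₂.contDiffAt

theorem iteratedDeriv_prod_sub (a : ℕ → ℝ) (m : ℕ) :
    iteratedDeriv m (fun t => ∏ ν ∈ Finset.range m, (t - a ν)) = fun _ => (m.factorial : ℝ) := by
  induction m with
  | zero => simp
  | succ m ih =>
    have hc : ∀ n : ℕ, ContDiff ℝ n (fun t : ℝ => ∏ ν ∈ Finset.range m, (t - a ν)) := fun n =>
      contDiff_prod fun ν _ => contDiff_id.sub contDiff_const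
    have : (fun t : ℝ => ∏ ν ∈ Finset.range (m + 1), (t - a ν)) =
        fun t => (t - a m) * ∏ ν ∈ Finset.range m, (t - a ν) := by
      ext t; rw [Finset.prod_range_succ, mul_comm]
    ext t
    rw [this, iteratedDeriv_sub_mul _ _ (hc _), Nat.add_sub_cancel, iteratedDeriv_succ, ih]
    simp [Nat.factorial_succ]

/-- The polynomial of degree `m` vanishing at the `m` knots following the `i`-th one. -/
def nodePoly (ξ : ℕ → ℝ) (m i : ℕ) (t : ℝ) : ℝ :=
  (∏ ν ∈ Finset.range m, (t - ξ (i + ν + 1))) / (m.factorial : ℝ)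

theorem contDiff_nodePoly (ξ : ℕ → ℝ) (m i : ℕ) {n : WithTop ℕ∞} :
    ContDiff ℝ n (nodePoly ξ m i) :=
  (contDiff_prod fun _ _ => contDiff_id.sub contDiff_const).div_const _

theorem iteratedDeriv_nodePoly (ξ : ℕ → ℝ) (m i : ℕ) :
    iteratedDeriv m (nodePoly ξ m i) = fun _ => 1 := by
  have : nodePoly ξ m i = fun t => (∏ ν ∈ Finset.range m, (t - ξ (i + ν + 1))) /
      (m.factorial : ℝ) := rfl
  rw [this]
  ext t
  rw [iteratedDeriv_div_const, iteratedDeriv_prod_sub (fun ν => ξ (i + ν + 1))]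
  exact div_self (Nat.cast_ne_zero.2 m.factorial_ne_zero)

theorem nodePoly_recursion {ξ : ℕ → ℝ} {m i : ℕ} (hi : 1 ≤ i) (h : ξ i < ξ (i + (m + 1)))
    (t : ℝ) : ((m + 1 : ℕ) : ℝ) / (ξ (i + (m + 1)) - ξ i) *
      (nodePoly ξ (m + 1) (i - 1) t - nodePoly ξ (m + 1) i t) = nodePoly ξ m i t := by
  obtain ⟨i, rfl⟩ : ∃ i', i = i' + 1 := ⟨i - 1, by omega⟩
  simp only [nodePoly, Nat.add_sub_cancel]
  rw [Finset.prod_range_succ', Finset.prod_range_succ, Nat.factorial_succ]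
  have e : ∀ ν, i + (ν + 1) + 1 = i + 1 + ν + 1 := fun ν => by omega
  simp only [e]
  generalize ∏ ν ∈ Finset.range m, (t - ξ (i + 1 + ν + 1)) = P
  have h1 : (m.factorial : ℝ) ≠ 0 := by exact_mod_cast m.factorial_ne_zero
  have h2 : ξ (i + 1 + (m + 1)) - ξ (i + 1) ≠ 0 := by linarith
  rw [show i + 1 + m + 1 = i + 1 + (m + 1) by omega, show i + 0 + 1 = i + 1 by omega]
  push_cast
  field_simp
  ring

/-- The potential whose derivative of order `p + 1 - k` represents the functional that is dual to
the `i`-th B-spline of degree `p - k`. -/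
def potential (p : ℕ) (ξ : ℕ → ℝ) (g : ℝ → ℝ) : ℕ → ℕ → ℝ → ℝ
  | 0, i, t => dualPotential p ξ g i t
  | k + 1, i, t => ((p - k : ℕ) : ℝ) / (ξ (i + (p - k)) - ξ i) *
      (potential p ξ g k (i - 1) t - potential p ξ g k i t)

/-- The representing function of the functional dual to the `i`-th B-spline of degree `p - k`. -/
def dualKernel (p : ℕ) (ξ : ℕ → ℝ) (g : ℝ → ℝ) (k i : ℕ) : ℝ → ℝ :=
  iteratedDeriv (p + 1 - k) (potential p ξ g k i)

section Potential

variable {p : ℕ} {ξ : ℕ → ℝ} {g : ℝ → ℝ}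

theorem potential_zero (i : ℕ) : potential p ξ g 0 i = dualPotential p ξ g i := rfl

theorem potential_succ (k i : ℕ) : potential p ξ g (k + 1) i = fun t =>
    ((p - k : ℕ) : ℝ) / (ξ (i + (p - k)) - ξ i) *
      (potential p ξ g k (i - 1) t - potential p ξ g k i t) := rfl

theorem dualPotential_eq (i : ℕ) (t : ℝ) : dualPotential p ξ g i t =
    g ((2 * t - ξ i - ξ (i + p + 1)) / (ξ (i + p + 1) - ξ i)) * nodePoly ξ p i t := rfl

theorem contDiff_transition_comp (hg : IsTransition p g) (a b c : ℝ) :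
    ContDiff ℝ p (fun t => g ((2 * t - a - b) / c)) :=
  hg.contDiff.comp (by fun_prop)

theorem contDiff_potential (hg : IsTransition p g) (k : ℕ) :
    ∀ i, ContDiff ℝ p (potential p ξ g k i) := by
  induction k with
  | zero => intro i; exact (contDiff_transition_comp hg _ _ _).mul (contDiff_nodePoly ξ p i)
  | succ k ih => intro i; exact contDiff_const.mul ((ih (i - 1)).sub (ih i))

theorem contDiff_potential_le (hg : IsTransition p g) (k i : ℕ) {d : ℕ} (hd : d ≤ p) :
    ContDiff ℝ d (potential p ξ g k i) :=
  (contDiff_potential hg k i).of_le (by exact_mod_cast hd)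

theorem iteratedDeriv_transition_comp (hg : IsTransition p g) (a b c : ℝ) {d : ℕ} (hd : d ≤ p)
    (t : ℝ) : iteratedDeriv d (fun t => g ((2 * t - a - b) / c)) t =
      (2 / c) ^ d * iteratedDeriv d g ((2 * t - a - b) / c) := by
  have hgd : ContDiff ℝ d g := hg.contDiff.of_le (by exact_mod_cast hd)
  have h1 : (fun t => g ((2 * t - a - b) / c)) =
      fun t => (fun s => g (s + (-a - b) / c)) (2 / c * t) := by
    ext t; congr 1; ring
  rw [h1, iteratedDeriv_comp_const_mul (f := fun s => g (s + (-a - b) / c)) (by fun_prop),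
    iteratedDeriv_comp_add_const]
  simp only
  congr 2; ring

theorem AC.of_contDiff {f : ℝ → ℝ} (hf : ContDiff ℝ 1 f) : AC f :=
  hf.contDiffOn.absolutelyContinuousOnInterval

theorem AC_iteratedDeriv_of_lt {f : ℝ → ℝ} (hf : ContDiff ℝ p f) {d : ℕ} (hd : d < p) :
    AC (iteratedDeriv d f) :=
  AC.of_contDiff (by
    rw [iteratedDeriv_eq_iterate]
    exact_mod_cast ContDiff.iterate_deriv' 1 d (hf.of_le (by exact_mod_cast (by omega : 1 + d ≤ p))))

/-- Functions of class `C^p` whose derivative of order `p` is absolutely continuous. -/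
structure IsRegular (p : ℕ) (f : ℝ → ℝ) : Prop where
  contDiff : ContDiff ℝ p f
  ac : AC (iteratedDeriv p f)

theorem IsRegular.sub_mul {f : ℝ → ℝ} (hf : IsRegular p f) (a : ℝ) :
    IsRegular p (fun t => (t - a) * f t) := by
  refine ⟨(contDiff_id.sub contDiff_const).mul hf.contDiff, ?_⟩
  rw [funext (iteratedDeriv_sub_mul a p hf.contDiff)]
  have h1 : AC (fun t => (t - a) * iteratedDeriv p f t) := by
    simpa [sub_eq_add_neg] using hf.ac.linear_mul 1 (-a)
  refine AbsolutelyContinuousOnInterval.fun_add h1 ?_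
  rcases p with _ | p
  · simpa using AC.linear 0 0
  · exact AbsolutelyContinuousOnInterval.const_mul _
      (AC_iteratedDeriv_of_lt hf.contDiff (by omega))

theorem IsRegular.const_mul {f : ℝ → ℝ} (hf : IsRegular p f) (c : ℝ) :
    IsRegular p (fun t => c * f t) := by
  refine ⟨contDiff_const.mul hf.contDiff, ?_⟩
  have : iteratedDeriv p (fun t => c * f t) = fun t => c * iteratedDeriv p f t :=
    funext fun t => iteratedDeriv_const_mul_field c f
  rw [this]
  exact AbsolutelyContinuousOnInterval.const_mul c hf.ac

theorem IsRegular.sub {f₁ f₂ : ℝ → ℝ} (h₁ : IsRegular p f₁) (h₂ : IsRegular p f₂) :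
    IsRegular p (fun t => f₁ t - f₂ t) := by
  refine ⟨h₁.contDiff.sub h₂.contDiff, ?_⟩
  have : iteratedDeriv p (fun t => f₁ t - f₂ t) =
      fun t => iteratedDeriv p f₁ t - iteratedDeriv p f₂ t :=
    funext fun t => iteratedDeriv_sub h₁.contDiff.contDiffAt h₂.contDiff.contDiffAt
  rw [this]
  exact AbsolutelyContinuousOnInterval.fun_sub h₁.ac h₂.ac

theorem IsRegular.prod_mul {f : ℝ → ℝ} (hf : IsRegular p f) (a : ℕ → ℝ) (m : ℕ) :
    IsRegular p (fun t => (∏ ν ∈ Finset.range m, (t - a ν)) * f t) := by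
  induction m with
  | zero => simpa using hf
  | succ m ih =>
    convert ih.sub_mul (a m) using 2 with t
    rw [Finset.prod_range_succ]; ring

theorem isRegular_transition_comp (hg : IsTransition p g) (a b c : ℝ) :
    IsRegular p (fun t => g ((2 * t - a - b) / c)) := by
  refine ⟨contDiff_transition_comp hg a b c, ?_⟩
  rw [funext (iteratedDeriv_transition_comp hg a b c le_rfl)]
  obtain ⟨L, hL⟩ := hg.lipschitz
  have h1 : LipschitzWith (Real.nnabs (2 / c)) (fun t : ℝ => (2 * t - a - b) / c) :=
    LipschitzWith.of_dist_le_mul fun x y => le_of_eq (by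
      rw [Real.dist_eq, Real.dist_eq, Real.coe_nnabs, ← abs_mul]; congr 1; ring)
  exact AbsolutelyContinuousOnInterval.const_mul _
    ((hL.comp h1).lipschitzOnWith.absolutelyContinuousOnInterval)

theorem isRegular_potential (hg : IsTransition p g) (k : ℕ) :
    ∀ i, IsRegular p (potential p ξ g k i) := by
  induction k with
  | zero =>
    intro i
    convert ((isRegular_transition_comp hg (ξ i) (ξ (i + p + 1)) (ξ (i + p + 1) - ξ i)).prod_mul
      (fun ν => ξ (i + ν + 1)) p).const_mul ((p.factorial : ℝ)⁻¹) using 2 with t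
    rw [potential_zero, dualPotential]; ring
  | succ k ih => intro i; exact ((ih (i - 1)).sub (ih i)).const_mul _

theorem AC_iteratedDeriv_potential (hg : IsTransition p g) (k i : ℕ) {d : ℕ} (hd : d ≤ p) :
    AC (iteratedDeriv d (potential p ξ g k i)) := by
  rcases hd.eq_or_lt with rfl | hd
  · exact (isRegular_potential hg k i).ac
  · exact AC_iteratedDeriv_of_lt (contDiff_potential hg k i) hd

/-! ### Values of the potentials at the knots -/

theorem iteratedDeriv_eq_zero_of_eqOn_Iic {f : ℝ → ℝ} {a : ℝ} {d : ℕ} (hf : ContDiff ℝ d f)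
    (h : ∀ t ≤ a, f t = 0) {t : ℝ} (ht : t ≤ a) : iteratedDeriv d f t = 0 := by
  have h1 : ∀ s ∈ Iio a, iteratedDeriv d f s = 0 := fun s hs => by
    have : f =ᶠ[𝓝 s] fun _ => 0 := by
      filter_upwards [Iio_mem_nhds hs] with u hu using h u (le_of_lt hu)
    rw [this.iteratedDeriv_eq d]; simp
  have h2 : Continuous (iteratedDeriv d f) := hf.continuous_iteratedDeriv d le_rfl
  have h3 : IsClosed {s | iteratedDeriv d f s = 0} := isClosed_eq h2 continuous_const
  have h4 : closure (Iio a) ⊆ {s | iteratedDeriv d f s = 0} := closure_minimal h1 h3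
  rw [closure_Iio] at h4
  exact h4 ht

theorem iteratedDeriv_eq_zero_of_eqOn_Ici {f : ℝ → ℝ} {a : ℝ} {d : ℕ} (hf : ContDiff ℝ d f)
    (h : ∀ t, a ≤ t → f t = 0) {t : ℝ} (ht : a ≤ t) : iteratedDeriv d f t = 0 := by
  have h1 : ∀ s ∈ Ioi a, iteratedDeriv d f s = 0 := fun s hs => by
    have : f =ᶠ[𝓝 s] fun _ => 0 := by
      filter_upwards [Ioi_mem_nhds hs] with u hu using h u (le_of_lt hu)
    rw [this.iteratedDeriv_eq d]; simp
  have h2 : Continuous (iteratedDeriv d f) := hf.continuous_iteratedDeriv d le_rfl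
  have h3 : IsClosed {s | iteratedDeriv d f s = 0} := isClosed_eq h2 continuous_const
  have h4 : closure (Ioi a) ⊆ {s | iteratedDeriv d f s = 0} := closure_minimal h1 h3
  rw [closure_Ioi] at h4
  exact h4 ht

theorem iteratedDeriv_pow_mul_eq_zero {F : ℝ → ℝ} (z : ℝ) (m d : ℕ) (hF : ContDiff ℝ d F)
    (hd : d < m) : iteratedDeriv d (fun t => (t - z) ^ m * F t) z = 0 := by
  induction m generalizing d F with
  | zero => omega
  | succ m ih =>
    have e : (fun t => (t - z) ^ (m + 1) * F t) = fun t => (t - z) * ((t - z) ^ m * F t) := by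
      ext t; ring
    have hc : ContDiff ℝ d (fun t => (t - z) ^ m * F t) := by fun_prop
    rw [e, iteratedDeriv_sub_mul z d hc, sub_self, zero_mul, zero_add]
    rcases d with _ | d
    · simp
    · rw [Nat.add_sub_cancel,
        ih d (hF.of_le (by exact_mod_cast Nat.le_succ d)) (by omega), mul_zero]

theorem iteratedDeriv_nodePoly_mul_eq_zero {F : ℝ → ℝ} {m i c d : ℕ} (hF : ContDiff ℝ m F)
    (hξ : Monotone ξ) (hc : i + 1 ≤ c) (hcd : c ≤ d) (hd : d ≤ i + m) (h : ξ c = ξ d) :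
    iteratedDeriv (d - c) (fun t => F t * nodePoly ξ m i t) (ξ c) = 0 := by
  have h1 : ∀ t, F t * nodePoly ξ m i t = (t - ξ c) ^ (d - c + 1) *
      ((∏ ν ∈ Finset.range m \ Finset.Icc (c - i - 1) (d - i - 1), (t - ξ (i + ν + 1))) /
        (m.factorial : ℝ) * F t) := by
    intro t
    have hsub : Finset.Icc (c - i - 1) (d - i - 1) ⊆ Finset.range m := by
      intro ν; simp only [Finset.mem_Icc, Finset.mem_range]; omega
    rw [nodePoly, ← Finset.prod_sdiff hsub, Finset.prod_congr rfl (g := fun _ => t - ξ c)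
      (s₁ := Finset.Icc (c - i - 1) (d - i - 1))]
    · rw [Finset.prod_const, Nat.card_Icc, show d - i - 1 + 1 - (c - i - 1) = d - c + 1 by omega]
      ring
    · intro ν hν
      rw [Finset.mem_Icc] at hν
      have h2 : ξ c ≤ ξ (i + ν + 1) := hξ (by omega)
      have h3 : ξ (i + ν + 1) ≤ ξ d := hξ (by omega)
      rw [show ξ (i + ν + 1) = ξ c by linarith]
  rw [funext h1]
  refine iteratedDeriv_pow_mul_eq_zero _ _ _ ?_ (Nat.lt_succ_self _)
  refine ContDiff.mul ((contDiff_prod fun _ _ => contDiff_id.sub contDiff_const).div_const _)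
    (hF.of_le ?_)
  exact_mod_cast (by omega : d - c ≤ m)

theorem dualPotential_eq_zero (hg : IsTransition p g) {i : ℕ} (h : ξ i < ξ (i + p + 1)) {t : ℝ}
    (ht : t ≤ ξ i) : dualPotential p ξ g i t = 0 := by
  rw [dualPotential_eq, hg.left, zero_mul]
  rw [div_le_iff₀ (by linarith)]; linarith

theorem dualPotential_eq_nodePoly (hg : IsTransition p g) {i : ℕ} (h : ξ i < ξ (i + p + 1)) {t : ℝ}
    (ht : ξ (i + p + 1) ≤ t) : dualPotential p ξ g i t = nodePoly ξ p i t := by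
  rw [dualPotential_eq, hg.right, one_mul]
  rw [le_div_iff₀ (by linarith)]; linarith

/-- The knots do not degenerate for the B-splines of degree `p - k` with indices from `a + k` to
`b`. -/
def KnotsSeparated (p : ℕ) (ξ : ℕ → ℝ) (k a b : ℕ) : Prop :=
  ∀ k' ≤ k, ∀ i, a + k' ≤ i → i ≤ b → ξ i < ξ (i + (p + 1 - k'))

theorem KnotsSeparated.mono {k k' a a' b b' : ℕ} (h : KnotsSeparated p ξ k a b) (hk : k' ≤ k)
    (ha : a ≤ a') (hb : b' ≤ b) : KnotsSeparated p ξ k' a' b' :=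
  fun l hl i h1 h2 => h l (hl.trans hk) i (by omega) (h2.trans hb)

theorem potential_eq_zero (hg : IsTransition p g) (hξ : Monotone ξ) (k : ℕ) :
    ∀ i, k ≤ i → KnotsSeparated p ξ k (i - k) i → ∀ t ≤ ξ (i - k), potential p ξ g k i t = 0 := by
  induction k with
  | zero =>
    intro i _ hs t ht
    exact dualPotential_eq_zero hg (hs 0 le_rfl i (by omega) le_rfl) ht
  | succ k ih =>
    intro i hi hs t ht
    have h1 := ih (i - 1) (by omega) (hs.mono (by omega) (by omega) (by omega)) t
      (by rwa [show i - 1 - k = i - (k + 1) by omega])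
    have h2 := ih i (by omega) (hs.mono (by omega) (by omega) le_rfl) t
      (ht.trans (hξ (by omega)))
    simp only [potential_succ, h1, h2, sub_self, mul_zero]

theorem potential_eq_nodePoly (hg : IsTransition p g) (hξ : Monotone ξ) (k : ℕ) (hk : k ≤ p) :
    ∀ i, k ≤ i → KnotsSeparated p ξ k (i - k) i → ∀ t, ξ (i + p + 1) ≤ t →
      potential p ξ g k i t = nodePoly ξ (p - k) i t := by
  induction k with
  | zero =>
    intro i _ hs t ht
    exact dualPotential_eq_nodePoly hg (hs 0 le_rfl i (by omega) le_rfl) ht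
  | succ k ih =>
    intro i hi hs t ht
    have h1 := ih (by omega) (i - 1) (by omega) (hs.mono (by omega) (by omega) (by omega)) t
      ((hξ (by omega)).trans ht)
    have h2 := ih (by omega) i (by omega) (hs.mono (by omega) (by omega) le_rfl) t ht
    have h3 := hs (k + 1) le_rfl i (by omega) le_rfl
    simp only [potential_succ, h1, h2]
    rw [show p - k = (p - (k + 1)) + 1 by omega]
    exact nodePoly_recursion (by omega) (by convert h3 using 2; omega) t

theorem iteratedDeriv_potential_knot_left (hg : IsTransition p g) (hξ : Monotone ξ) (k : ℕ)
    (hk : k ≤ p) : ∀ i, k ≤ i → KnotsSeparated p ξ k (i - k) i → ∀ c d, c ≤ d → d ≤ i + (p - k) →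
      ξ c = ξ d → d - c ≤ p → iteratedDeriv (d - c) (potential p ξ g k i) (ξ c) = 0 := by
  induction k with
  | zero =>
    intro i _ hs c d hcd hd h hp
    have hi := hs 0 le_rfl i (by omega) le_rfl
    rcases le_or_gt c i with hc | hc
    · exact iteratedDeriv_eq_zero_of_eqOn_Iic (contDiff_potential_le hg 0 i hp)
        (fun t ht => dualPotential_eq_zero hg hi ht) (hξ hc)
    · exact iteratedDeriv_nodePoly_mul_eq_zero
        (contDiff_transition_comp hg (ξ i) (ξ (i + p + 1)) (ξ (i + p + 1) - ξ i)) hξ hc hcd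
        (by omega) h
  | succ k ih =>
    intro i hi hs c d hcd hd h hp
    rw [potential_succ, iteratedDeriv_const_mul_sub _ (contDiff_potential_le hg _ _ hp)
      (contDiff_potential_le hg _ _ hp),
      ih (by omega) (i - 1) (by omega) (hs.mono (by omega) (by omega) (by omega)) c d hcd
        (by omega) h hp,
      ih (by omega) i (by omega) (hs.mono (by omega) (by omega) le_rfl) c d hcd
        (by omega) h hp, sub_self, mul_zero]

theorem iteratedDeriv_potential_knot_right (hg : IsTransition p g) (hξ : Monotone ξ) (k : ℕ)
    (hk : k ≤ p) : ∀ i, k ≤ i → KnotsSeparated p ξ k (i - k) i → ∀ c d, i + 1 ≤ c → c ≤ d →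
      ξ c = ξ d → d - c ≤ p →
      iteratedDeriv (d - c) (potential p ξ g k i) (ξ c) =
        iteratedDeriv (d - c) (nodePoly ξ (p - k) i) (ξ c) := by
  induction k with
  | zero =>
    intro i _ hs c d hc hcd h hp
    have hi := hs 0 le_rfl i (by omega) le_rfl
    rw [← sub_eq_zero, ← iteratedDeriv_sub (contDiff_potential_le hg 0 i hp).contDiffAt
      (contDiff_nodePoly ξ _ i).contDiffAt]
    rcases le_or_gt (i + p + 1) d with hd | hd
    · refine iteratedDeriv_eq_zero_of_eqOn_Ici
        ((contDiff_potential_le hg 0 i hp).sub (contDiff_nodePoly ξ _ i)) (a := ξ (i + p + 1))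
        (fun t ht => ?_) (by rw [h]; exact hξ hd)
      change potential p ξ g 0 i t - nodePoly ξ (p - 0) i t = 0
      rw [potential_zero, dualPotential_eq_nodePoly hg hi ht, Nat.sub_zero, sub_self]
    · have e : potential p ξ g 0 i - nodePoly ξ (p - 0) i = fun t =>
          (g ((2 * t - ξ i - ξ (i + p + 1)) / (ξ (i + p + 1) - ξ i)) - 1) * nodePoly ξ p i t := by
        ext t
        simp only [Pi.sub_apply, potential_zero, dualPotential_eq, Nat.sub_zero]
        ring
      rw [e]
      exact iteratedDeriv_nodePoly_mul_eq_zero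
        ((contDiff_transition_comp hg (ξ i) (ξ (i + p + 1)) (ξ (i + p + 1) - ξ i)).sub
          contDiff_const) hξ hc hcd (by omega) h
  | succ k ih =>
    intro i hi hs c d hc hcd h hp
    have h3 := hs (k + 1) le_rfl i (by omega) le_rfl
    have e : nodePoly ξ (p - (k + 1)) i = fun t => ((p - k : ℕ) : ℝ) / (ξ (i + (p - k)) - ξ i) *
        (nodePoly ξ (p - k) (i - 1) t - nodePoly ξ (p - k) i t) := by
      ext t
      rw [show p - k = (p - (k + 1)) + 1 by omega]
      exact (nodePoly_recursion (by omega) (by convert h3 using 2; omega) t).symm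
    rw [e, potential_succ, iteratedDeriv_const_mul_sub _ (contDiff_potential_le hg _ _ hp)
      (contDiff_potential_le hg _ _ hp),
      iteratedDeriv_const_mul_sub _ (contDiff_nodePoly ξ _ _) (contDiff_nodePoly ξ _ _),
      ih (by omega) (i - 1) (by omega) (hs.mono (by omega) (by omega) (by omega)) c d (by omega)
        hcd h hp,
      ih (by omega) i (by omega) (hs.mono (by omega) (by omega) le_rfl) c d hc hcd h hp]

/-- The dual kernels are biorthogonal to the B-splines. -/
theorem integral_bspline_mul_dualKernel (hg : IsTransition p g) (hξ : Monotone ξ)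
    (h01 : ∀ j, ξ j ∈ Icc (0 : ℝ) 1) {k i : ℕ} (hk : k ≤ p) (hi : k ≤ i)
    (hs : KnotsSeparated p ξ k (i - k) i) (j : ℕ) :
    ∫ t in Ioo (0 : ℝ) 1, bspline ξ (p - k) j t * dualKernel p ξ g k i t =
      if j = i then 1 else 0 := by
  have hq : p - k ≤ p := Nat.sub_le _ _
  have left : ∀ j ≤ i, knotMean ξ (p - k) j (iteratedDeriv (p - k) (potential p ξ g k i)) = 0 :=
    fun j hj => knotMean_iteratedDeriv_eq_zero hξ h01 _ j
      (fun d hd => AC_iteratedDeriv_potential hg k i (by omega))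
      (fun c d h1 h2 h3 h4 => iteratedDeriv_potential_knot_left hg hξ k hk i hi hs c d h2
        (by omega) h4 (by omega))
  have right : ∀ j, i + 1 ≤ j →
      knotMean ξ (p - k) j (iteratedDeriv (p - k) (potential p ξ g k i)) = 1 := by
    intro j hj
    have h0 := knotMean_iteratedDeriv_eq_zero hξ h01
      (f := fun t => potential p ξ g k i t - nodePoly ξ (p - k) i t) (p - k) j
      (fun d hd => AC_iteratedDeriv_of_lt (p := p)
        ((contDiff_potential hg k i).sub (contDiff_nodePoly ξ _ i)) (by omega))
      (fun c d h1 h2 h3 h4 => by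
        have := iteratedDeriv_potential_knot_right hg hξ k hk i hi hs c d (by omega) h2 h4
          (by omega)
        refine (iteratedDeriv_fun_sub (contDiff_potential_le hg k i (by omega)).contDiffAt
          (contDiff_nodePoly ξ _ i).contDiffAt).trans ?_
        rw [this, sub_self])
    have e : iteratedDeriv (p - k) (fun t => potential p ξ g k i t - nodePoly ξ (p - k) i t) =
        fun t => iteratedDeriv (p - k) (potential p ξ g k i) t - 1 := by
      ext t
      refine (iteratedDeriv_fun_sub (contDiff_potential_le hg k i hq).contDiffAt
        (contDiff_nodePoly ξ _ i).contDiffAt).trans ?_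
      rw [iteratedDeriv_nodePoly]
    rw [e, knotMean_sub hξ _ _ (AC_iteratedDeriv_potential hg k i hq).continuousOn_Icc
      continuousOn_const, knotMean_const_one hξ h01] at h0
    linarith
  have e : dualKernel p ξ g k i = deriv (iteratedDeriv (p - k) (potential p ξ g k i)) := by
    rw [dualKernel, ← iteratedDeriv_succ]; congr 1; omega
  rw [e, integral_bspline_mul_deriv hξ h01 _ j (AC_iteratedDeriv_potential hg k i hq)]
  rcases lt_trichotomy j i with h | h | h
  · rw [left _ h, left _ h.le, if_neg h.ne, sub_self]
  · rw [h, right _ le_rfl, left _ le_rfl, if_pos rfl, sub_zero]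
  · rw [right _ (by omega), right _ h, if_neg h.ne', sub_self]

end Potential

end

section

/-! ### Bounds for the dual kernels -/

section Bounds

variable {p : ℕ} {ξ : ℕ → ℝ} {g : ℝ → ℝ}

theorem iteratedDeriv_const_abs_le_one {c : ℝ} (hc : |c| ≤ 1) (d : ℕ) (t : ℝ) :
    |iteratedDeriv d (fun _ : ℝ => c) t| ≤ 1 := by
  rw [iteratedDeriv_const]; split_ifs <;> simp [hc]

theorem IsTransition.exists_bound (hg : IsTransition p g) :
    ∃ M : ℝ, 1 ≤ M ∧ (∀ d ≤ p, ∀ t, |iteratedDeriv d g t| ≤ M) ∧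
      ∀ t u, |iteratedDeriv p g t - iteratedDeriv p g u| ≤ M * |t - u| := by
  obtain ⟨L, hL⟩ := hg.lipschitz
  have h1 : ∀ d : ℕ, ∃ M : ℝ, d ≤ p → ∀ t ∈ Icc (-1 : ℝ) 1, |iteratedDeriv d g t| ≤ M := by
    intro d
    by_cases hd : d ≤ p
    · obtain ⟨M, hM⟩ := isCompact_Icc.exists_bound_of_continuousOn (s := Icc (-1 : ℝ) 1)
        (hg.contDiff.continuous_iteratedDeriv d (by exact_mod_cast hd)).continuousOn
      exact ⟨M, fun _ => hM⟩
    · exact ⟨0, fun h => absurd h hd⟩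
  choose M hM using h1
  refine ⟨1 + L + ∑ d ∈ Finset.range (p + 1), |M d|, ?_, ?_, ?_⟩
  · have : 0 ≤ ∑ d ∈ Finset.range (p + 1), |M d| := Finset.sum_nonneg fun _ _ => abs_nonneg _
    linarith [L.2]
  · intro d hd t
    have hle : |M d| ≤ ∑ d ∈ Finset.range (p + 1), |M d| :=
      Finset.single_le_sum (f := fun d => |M d|) (fun _ _ => abs_nonneg _)
        (Finset.mem_range.2 (by omega))
    have hL0 : (0 : ℝ) ≤ L := L.2
    by_cases ht : t ∈ Icc (-1 : ℝ) 1
    · linarith [hM d hd t ht, le_abs_self (M d)]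
    · have : |iteratedDeriv d g t| ≤ 1 := by
        rw [mem_Icc, not_and_or, not_le, not_le] at ht
        rcases ht with ht | ht
        · have : g =ᶠ[𝓝 t] fun _ => 0 := by
            filter_upwards [Iio_mem_nhds ht] with s hs using hg.left s (le_of_lt hs)
          rw [this.iteratedDeriv_eq]
          exact iteratedDeriv_const_abs_le_one (by simp) d t
        · have : g =ᶠ[𝓝 t] fun _ => 1 := by
            filter_upwards [Ioi_mem_nhds ht] with s hs using hg.right s (le_of_lt hs)
          rw [this.iteratedDeriv_eq]
          exact iteratedDeriv_const_abs_le_one (by simp) d t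
      linarith [abs_nonneg (M d)]
  · intro t u
    have := hL.dist_le_mul t u
    rw [Real.dist_eq, Real.dist_eq] at this
    refine this.trans (mul_le_mul_of_nonneg_right ?_ (abs_nonneg _))
    have : 0 ≤ ∑ d ∈ Finset.range (p + 1), |M d| := Finset.sum_nonneg fun _ _ => abs_nonneg _
    linarith

/-- Derivatives up to order `p + 1` on `s` scale like those of a polynomial of degree `N` on an
interval of length `H`. -/
structure ScaledBound (p : ℕ) (s : Set ℝ) (H C : ℝ) (N : ℕ) (f : ℝ → ℝ) : Prop where
  contDiff : ContDiff ℝ p f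
  bound : ∀ d ≤ p, ∀ t ∈ s, |iteratedDeriv d f t| ≤ C * (H ^ N / H ^ d)
  lip : ∀ t ∈ s, ∀ u ∈ s, |iteratedDeriv p f t - iteratedDeriv p f u| ≤
    C * (H ^ N / H ^ (p + 1)) * |t - u|

theorem ScaledBound.sub_mul {s : Set ℝ} (hs : Convex ℝ s) {H C : ℝ} (hH : 0 < H) (hC : 0 ≤ C)
    {N : ℕ} {f : ℝ → ℝ} (hf : ScaledBound p s H C N f) {a : ℝ} (ha : ∀ t ∈ s, |t - a| ≤ H) :
    ScaledBound p s H ((p + 2) * C) (N + 1) (fun t => (t - a) * f t) := by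
  refine ⟨(contDiff_id.sub contDiff_const).mul hf.contDiff, ?_, ?_⟩
  · intro d hd t ht
    rw [iteratedDeriv_sub_mul a d (hf.contDiff.of_le (by exact_mod_cast hd))]
    refine (abs_add_le _ _).trans ?_
    rw [abs_mul, abs_mul, Nat.abs_cast]
    have h1 : |t - a| * |iteratedDeriv d f t| ≤ C * (H ^ (N + 1) / H ^ d) := by
      calc |t - a| * |iteratedDeriv d f t| ≤ H * (C * (H ^ N / H ^ d)) :=
            mul_le_mul (ha t ht) (hf.bound d hd t ht) (abs_nonneg _) hH.le
        _ = C * (H ^ (N + 1) / H ^ d) := by ring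
    have h2 : (d : ℝ) * |iteratedDeriv (d - 1) f t| ≤ p * (C * (H ^ (N + 1) / H ^ d)) := by
      rcases d with _ | d
      · simp; positivity
      · rw [Nat.add_sub_cancel]
        refine mul_le_mul (by exact_mod_cast hd) ?_ (abs_nonneg _) (by positivity)
        refine (hf.bound d (by omega) t ht).trans (le_of_eq ?_)
        rw [pow_succ, pow_succ, mul_div_mul_right _ _ hH.ne']
    have h3 : 0 ≤ C * (H ^ (N + 1) / H ^ d) := by positivity
    linarith
  · intro t ht u hu
    rw [iteratedDeriv_sub_mul a p hf.contDiff, iteratedDeriv_sub_mul a p hf.contDiff]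
    have e : C * (H ^ (N + 1) / H ^ (p + 1)) = C * (H ^ N / H ^ p) := by
      rw [pow_succ, pow_succ, mul_div_mul_right _ _ hH.ne']
    have h1 : |(t - u) * iteratedDeriv p f t| ≤ C * (H ^ (N + 1) / H ^ (p + 1)) * |t - u| := by
      rw [abs_mul, mul_comm, e]
      exact mul_le_mul_of_nonneg_right (hf.bound p le_rfl t ht) (abs_nonneg _)
    have h2 : |(u - a) * (iteratedDeriv p f t - iteratedDeriv p f u)| ≤
        C * (H ^ (N + 1) / H ^ (p + 1)) * |t - u| := by
      rw [abs_mul]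
      calc |u - a| * |iteratedDeriv p f t - iteratedDeriv p f u|
          ≤ H * (C * (H ^ N / H ^ (p + 1)) * |t - u|) :=
            mul_le_mul (ha u hu) (hf.lip t ht u hu) (abs_nonneg _) hH.le
        _ = C * (H ^ (N + 1) / H ^ (p + 1)) * |t - u| := by ring
    have h3 : |(p : ℝ) * (iteratedDeriv (p - 1) f t - iteratedDeriv (p - 1) f u)| ≤
        p * (C * (H ^ (N + 1) / H ^ (p + 1)) * |t - u|) := by
      rcases p with _ | p
      · simp
      · rw [abs_mul, Nat.abs_cast]
        refine mul_le_mul_of_nonneg_left ?_ (Nat.cast_nonneg _)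
        rw [Nat.add_sub_cancel, e]
        have hd : ∀ x ∈ s, HasDerivWithinAt (iteratedDeriv p f) (iteratedDeriv (p + 1) f x) s x := by
          intro x _
          rw [iteratedDeriv_succ]
          exact ((hf.contDiff.differentiable_iteratedDeriv p
            (by exact_mod_cast Nat.lt_succ_self p)) x).hasDerivAt.hasDerivWithinAt
        have := hs.norm_image_sub_le_of_norm_hasDerivWithin_le hd
          (fun x hx => hf.bound (p + 1) le_rfl x hx) hu ht
        simpa [Real.norm_eq_abs] using this
    calc _ = |(t - u) * iteratedDeriv p f t + (u - a) * (iteratedDeriv p f t - iteratedDeriv p f u) +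
          p * (iteratedDeriv (p - 1) f t - iteratedDeriv (p - 1) f u)| := by congr 1; ring
      _ ≤ _ := (abs_add_le _ _).trans (add_le_add_left (abs_add_le _ _) _)
      _ ≤ _ := by nlinarith [h1, h2, h3]

theorem ScaledBound.const_mul_sub {s : Set ℝ} {H C A c : ℝ} (hH : 0 < H)
    {N : ℕ} {f₁ f₂ : ℝ → ℝ} (h₁ : ScaledBound p s H C (N + 1) f₁)
    (h₂ : ScaledBound p s H C (N + 1) f₂) (hc : |c| ≤ A / H) :
    ScaledBound p s H (2 * A * C) N (fun t => c * (f₁ t - f₂ t)) := by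
  have hA : 0 ≤ A / H := (abs_nonneg c).trans hc
  refine ⟨contDiff_const.mul (h₁.contDiff.sub h₂.contDiff), ?_, ?_⟩
  · intro d hd t ht
    rw [iteratedDeriv_const_mul_sub c (h₁.contDiff.of_le (by exact_mod_cast hd))
      (h₂.contDiff.of_le (by exact_mod_cast hd)), abs_mul]
    calc |c| * |iteratedDeriv d f₁ t - iteratedDeriv d f₂ t|
        ≤ A / H * (C * (H ^ (N + 1) / H ^ d) + C * (H ^ (N + 1) / H ^ d)) :=
          mul_le_mul hc ((abs_sub _ _).trans (add_le_add (h₁.bound d hd t ht)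
            (h₂.bound d hd t ht))) (abs_nonneg _) hA
      _ = 2 * A * C * (H ^ N / H ^ d) := by field_simp; ring
  · intro t ht u hu
    rw [iteratedDeriv_const_mul_sub c h₁.contDiff h₂.contDiff,
      iteratedDeriv_const_mul_sub c h₁.contDiff h₂.contDiff, ← mul_sub, abs_mul]
    have e : iteratedDeriv p f₁ t - iteratedDeriv p f₂ t -
        (iteratedDeriv p f₁ u - iteratedDeriv p f₂ u) =
        (iteratedDeriv p f₁ t - iteratedDeriv p f₁ u) -
        (iteratedDeriv p f₂ t - iteratedDeriv p f₂ u) := by ring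
    rw [e]
    calc |c| * _
        ≤ A / H * (C * (H ^ (N + 1) / H ^ (p + 1)) * |t - u| +
            C * (H ^ (N + 1) / H ^ (p + 1)) * |t - u|) :=
          mul_le_mul hc ((abs_sub _ _).trans (add_le_add (h₁.lip t ht u hu)
            (h₂.lip t ht u hu))) (abs_nonneg _) hA
      _ = 2 * A * C * (H ^ N / H ^ (p + 1)) * |t - u| := by field_simp; ring

theorem ScaledBound.const_mul {s : Set ℝ} {H C c : ℝ} {N : ℕ} {f : ℝ → ℝ}
    (hf : ScaledBound p s H C N f) (hc : |c| ≤ 1) : ScaledBound p s H C N (fun t => c * f t) := by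
  have key : ∀ x y : ℝ, |x| ≤ y → |c * x| ≤ y := fun x y h => by
    rw [abs_mul]
    exact (mul_le_of_le_one_left (abs_nonneg x) hc).trans h
  refine ⟨contDiff_const.mul hf.contDiff, fun d hd t ht => ?_, fun t ht u hu => ?_⟩
  · rw [iteratedDeriv_const_mul_field]
    exact key _ _ (hf.bound d hd t ht)
  · rw [iteratedDeriv_const_mul_field, iteratedDeriv_const_mul_field, ← mul_sub]
    exact key _ _ (hf.lip t ht u hu)

theorem ScaledBound.prod_mul {s : Set ℝ} (hs : Convex ℝ s) {H C : ℝ} (hH : 0 < H) (hC : 0 ≤ C)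
    {f : ℝ → ℝ} (hf : ScaledBound p s H C 0 f) {a : ℕ → ℝ} (m : ℕ)
    (ha : ∀ ν < m, ∀ t ∈ s, |t - a ν| ≤ H) :
    ScaledBound p s H (((p : ℝ) + 2) ^ m * C) m
      (fun t => (∏ ν ∈ Finset.range m, (t - a ν)) * f t) := by
  induction m with
  | zero => simpa using hf
  | succ m ih =>
    have := (ih fun ν hν => ha ν (by omega)).sub_mul hs hH (by positivity) (ha m (by omega))
    convert this using 1
    · ring
    · ext t; rw [Finset.prod_range_succ]; ring

theorem scaledBound_transition_comp (hg : IsTransition p g) {M : ℝ} (hM0 : 1 ≤ M)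
    (hM : ∀ d ≤ p, ∀ t, |iteratedDeriv d g t| ≤ M)
    (hL : ∀ t u, |iteratedDeriv p g t - iteratedDeriv p g u| ≤ M * |t - u|)
    {s : Set ℝ} {a b c H R : ℝ} (hH : 0 < H) (hR : 1 ≤ R) (hHc : H ≤ R * c) :
    ScaledBound p s H ((2 * R) ^ (p + 1) * M) 0 (fun t => g ((2 * t - a - b) / c)) := by
  have hc : 0 < c := by
    by_contra h
    nlinarith
  have h2 : 2 / c ≤ 2 * R / H := by
    rw [div_le_div_iff₀ hc hH]; nlinarith
  have h2' : 0 ≤ 2 / c := by positivity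
  have hp : ∀ d ≤ p + 1, (2 / c) ^ d ≤ (2 * R) ^ (p + 1) / H ^ d := fun d hd => by
    calc (2 / c) ^ d ≤ (2 * R / H) ^ d := pow_le_pow_left₀ h2' h2 d
      _ = (2 * R) ^ d / H ^ d := div_pow _ _ _
      _ ≤ _ := by
        gcongr
        linarith
  refine ⟨contDiff_transition_comp hg a b c, fun d hd t _ => ?_, fun t _ u _ => ?_⟩
  · rw [iteratedDeriv_transition_comp hg a b c hd, abs_mul, abs_of_nonneg (pow_nonneg h2' d)]
    calc (2 / c) ^ d * _ ≤ (2 * R) ^ (p + 1) / H ^ d * M :=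
          mul_le_mul (hp d (by omega)) (hM d hd _) (abs_nonneg _) (by positivity)
      _ = _ := by ring
  · rw [iteratedDeriv_transition_comp hg a b c le_rfl,
      iteratedDeriv_transition_comp hg a b c le_rfl, ← mul_sub, abs_mul,
      abs_of_nonneg (pow_nonneg h2' p)]
    have e : |(2 * t - a - b) / c - (2 * u - a - b) / c| = 2 / c * |t - u| := by
      rw [← abs_of_nonneg h2', ← abs_mul]; congr 1; ring
    calc (2 / c) ^ p * _ ≤ (2 / c) ^ p * (M * (2 / c * |t - u|)) := by
          refine mul_le_mul_of_nonneg_left ((hL _ _).trans (le_of_eq ?_)) (pow_nonneg h2' p)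
          rw [e]
      _ = (2 / c) ^ (p + 1) * (M * |t - u|) := by ring
      _ ≤ (2 * R) ^ (p + 1) / H ^ (p + 1) * (M * |t - u|) :=
          mul_le_mul_of_nonneg_right (hp _ le_rfl) (by positivity)
      _ = _ := by ring

/-- A constant bounding the scaled dual kernels. -/
def kernelConst (p : ℕ) (M R : ℝ) (k : ℕ) : ℝ :=
  (2 * (p * R)) ^ k * (((p : ℝ) + 2) ^ p * ((2 * R) ^ (p + 1) * M))

theorem kernelConst_nonneg (p : ℕ) {M R : ℝ} (hM : 1 ≤ M) (hR : 1 ≤ R) (k : ℕ) :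
    0 ≤ kernelConst p M R k := by unfold kernelConst; positivity

theorem scaledBound_potential (hg : IsTransition p g) {M : ℝ} (hM0 : 1 ≤ M)
    (hM : ∀ d ≤ p, ∀ t, |iteratedDeriv d g t| ≤ M)
    (hL : ∀ t u, |iteratedDeriv p g t - iteratedDeriv p g u| ≤ M * |t - u|)
    {s : Set ℝ} (hs : Convex ℝ s) {H R : ℝ} (hH : 0 < H) (hR : 1 ≤ R) {a b : ℕ}
    (hab : ∀ m, a ≤ m → m ≤ b + p + 1 → ∀ t ∈ s, |t - ξ m| ≤ H) (k : ℕ) (hk : k ≤ p)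
    (hsep : ∀ k' ≤ k, ∀ i, a + k' ≤ i → i ≤ b → H ≤ R * (ξ (i + (p + 1 - k')) - ξ i)) :
    ∀ i, a + k ≤ i → i ≤ b →
      ScaledBound p s H (kernelConst p M R k) (p - k) (potential p ξ g k i) := by
  induction k with
  | zero =>
    intro i hi hib
    have h1 := (scaledBound_transition_comp hg hM0 hM hL (s := s) (a := ξ i)
      (b := ξ (i + p + 1)) hH hR (hsep 0 le_rfl i hi hib)).prod_mul hs hH (by positivity)
      (a := fun ν => ξ (i + ν + 1)) p (fun ν hν t ht => hab _ (by omega) (by omega) t ht)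
    have h2 := h1.const_mul (c := (p.factorial : ℝ)⁻¹) (by
      rw [abs_of_nonneg (by positivity)]
      exact inv_le_one_of_one_le₀ (by exact_mod_cast p.factorial_pos))
    convert h2 using 1
    · simp [kernelConst]
    · simp
    · ext t; rw [potential_zero, dualPotential, Nat.sub_zero]
      rw [show i + (p + 1) = i + p + 1 by omega]
      ring
  | succ k ih =>
    intro i hi hib
    have ih' := ih (by omega) (fun k' hk' => hsep k' (by omega))
    have h1 := ih' (i - 1) (by omega) (by omega)
    have h2 := ih' i (by omega) hib
    have h3 := hsep (k + 1) le_rfl i hi hib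
    rw [show p + 1 - (k + 1) = p - k by omega] at h3
    rw [show p - k = (p - (k + 1)) + 1 by omega] at h1 h2
    have hpos : 0 < ξ (i + (p - k)) - ξ i := by
      by_contra h
      nlinarith
    have h4 := h1.const_mul_sub (c := ((p - k : ℕ) : ℝ) / (ξ (i + (p - k)) - ξ i))
      (A := p * R) hH h2 (by
        rw [abs_of_nonneg (by positivity), div_le_div_iff₀ hpos hH]
        have : ((p - k : ℕ) : ℝ) ≤ p := by exact_mod_cast Nat.sub_le p k
        calc ((p - k : ℕ) : ℝ) * H ≤ p * (R * (ξ (i + (p - k)) - ξ i)) :=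
              mul_le_mul this h3 hH.le (Nat.cast_nonneg _)
          _ = _ := by ring)
    convert h4 using 1
    · unfold kernelConst; ring
    · rfl

theorem abs_dualKernel_le (hg : IsTransition p g) {M : ℝ} (hM0 : 1 ≤ M)
    (hM : ∀ d ≤ p, ∀ t, |iteratedDeriv d g t| ≤ M)
    (hL : ∀ t u, |iteratedDeriv p g t - iteratedDeriv p g u| ≤ M * |t - u|)
    (hξ : Monotone ξ) {R : ℝ} (hR : 1 ≤ R) {k i : ℕ} (hk : k ≤ p) (hi : k ≤ i)
    (hH : ξ (i - k) < ξ (i + p + 1))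
    (hsep : ∀ k' ≤ k, ∀ i', i - k + k' ≤ i' → i' ≤ i →
      ξ (i + p + 1) - ξ (i - k) ≤ R * (ξ (i' + (p + 1 - k')) - ξ i')) {t : ℝ}
    (ht : t ∈ Ioo (ξ (i - k)) (ξ (i + p + 1))) :
    |dualKernel p ξ g k i t| ≤ kernelConst p M R k / (ξ (i + p + 1) - ξ (i - k)) := by
  set H := ξ (i + p + 1) - ξ (i - k) with hHdef
  have hH0 : 0 < H := by linarith
  have hC := kernelConst_nonneg p hM0 hR k
  have hb := scaledBound_potential hg hM0 hM hL (convex_Icc (ξ (i - k)) (ξ (i + p + 1))) hH0 hR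
    (a := i - k) (b := i) (fun m h1 h2 t ht => by
      have h3 : ξ (i - k) ≤ ξ m := hξ h1
      have h4 : ξ m ≤ ξ (i + p + 1) := hξ h2
      rw [abs_le]
      constructor <;> linarith [ht.1, ht.2]) k hk hsep i (by omega) le_rfl
  rcases k with _ | k
  · rw [dualKernel, Nat.sub_zero, iteratedDeriv_succ, ← Real.norm_eq_abs]
    have h1 : LipschitzOnWith (Real.toNNReal (kernelConst p M R 0 / H))
        (iteratedDeriv p (potential p ξ g 0 i)) (Icc (ξ (i - 0)) (ξ (i + p + 1))) := by
      refine LipschitzOnWith.of_dist_le_mul fun x hx y hy => ?_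
      rw [Real.dist_eq, Real.dist_eq, Real.coe_toNNReal _ (by positivity)]
      refine (hb.lip x hx y hy).trans (le_of_eq ?_)
      rw [Nat.sub_zero, pow_succ]
      field_simp
    have := norm_deriv_le_of_lipschitzOn (Icc_mem_nhds ht.1 ht.2) h1
    rwa [Real.coe_toNNReal _ (by positivity)] at this
  · refine (hb.bound (p + 1 - (k + 1)) (by omega) t (Ioo_subset_Icc_self ht)).trans (le_of_eq ?_)
    rw [show p + 1 - (k + 1) = (p - (k + 1)) + 1 by omega, pow_succ]
    field_simp

theorem dualKernel_eq_zero_left (hg : IsTransition p g) (hξ : Monotone ξ) {k i : ℕ}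
    (hi : k ≤ i) (hs : KnotsSeparated p ξ k (i - k) i) {t : ℝ} (ht : t < ξ (i - k)) :
    dualKernel p ξ g k i t = 0 := by
  have : potential p ξ g k i =ᶠ[𝓝 t] fun _ => 0 := by
    filter_upwards [Iio_mem_nhds ht] with u hu
    exact potential_eq_zero hg hξ k i hi hs u (le_of_lt hu)
  rw [dualKernel, this.iteratedDeriv_eq]; simp

theorem dualKernel_eq_zero_right (hg : IsTransition p g) (hξ : Monotone ξ) {k i : ℕ} (hk : k ≤ p)
    (hi : k ≤ i) (hs : KnotsSeparated p ξ k (i - k) i) {t : ℝ} (ht : ξ (i + p + 1) < t) :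
    dualKernel p ξ g k i t = 0 := by
  have : potential p ξ g k i =ᶠ[𝓝 t] nodePoly ξ (p - k) i := by
    filter_upwards [Ioi_mem_nhds ht] with u hu
    exact potential_eq_nodePoly hg hξ k hk i hi hs u (le_of_lt hu)
  rw [dualKernel, this.iteratedDeriv_eq, show p + 1 - k = (p - k) + 1 by omega,
    iteratedDeriv_succ, iteratedDeriv_nodePoly]
  simp

theorem iteratedDeriv_potential_eq_one (hg : IsTransition p g) (hξ : Monotone ξ) {k i : ℕ}
    (hk : k ≤ p) (hi : k ≤ i) (hs : KnotsSeparated p ξ k (i - k) i) {t : ℝ}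
    (ht : ξ (i + p + 1) ≤ t) : iteratedDeriv (p - k) (potential p ξ g k i) t = 1 := by
  have h := iteratedDeriv_eq_zero_of_eqOn_Ici (d := p - k) (a := ξ (i + p + 1))
    ((contDiff_potential_le hg k i (Nat.sub_le p k)).sub (contDiff_nodePoly ξ (p - k) i))
    (fun t ht => by rw [potential_eq_nodePoly hg hξ k hk i hi hs t ht, sub_self]) ht
  have e := iteratedDeriv_fun_sub (x := t) (contDiff_potential_le (ξ := ξ) hg k i (Nat.sub_le p k)).contDiffAt
    (contDiff_nodePoly ξ (p - k) i).contDiffAt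
  rw [h, iteratedDeriv_nodePoly] at e
  linarith

theorem iteratedDeriv_potential_eq_zero (hg : IsTransition p g) (hξ : Monotone ξ) {k i : ℕ}
    (hi : k ≤ i) (hs : KnotsSeparated p ξ k (i - k) i) {t : ℝ}
    (ht : t ≤ ξ (i - k)) : iteratedDeriv (p - k) (potential p ξ g k i) t = 0 :=
  iteratedDeriv_eq_zero_of_eqOn_Iic (contDiff_potential_le hg k i (Nat.sub_le p k))
    (potential_eq_zero hg hξ k i hi hs) ht

theorem dualKernel_succ (hg : IsTransition p g) {k : ℕ} (hk : k < p) (i : ℕ) (t : ℝ) :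
    dualKernel p ξ g (k + 1) i t = ((p - k : ℕ) : ℝ) / (ξ (i + (p - k)) - ξ i) *
      (iteratedDeriv (p - k) (potential p ξ g k (i - 1)) t -
        iteratedDeriv (p - k) (potential p ξ g k i) t) := by
  rw [dualKernel, potential_succ, show p + 1 - (k + 1) = p - k by omega,
    iteratedDeriv_const_mul_sub _ (contDiff_potential_le hg _ _ (Nat.sub_le p k))
      (contDiff_potential_le hg _ _ (Nat.sub_le p k))]

theorem deriv_iteratedDeriv_potential {k : ℕ} (hk : k ≤ p) (i : ℕ) :
    deriv (iteratedDeriv (p - k) (potential p ξ g k i)) = dualKernel p ξ g k i := by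
  rw [dualKernel, ← iteratedDeriv_succ]; congr 1; omega

theorem AC_dualKernel_succ (hg : IsTransition p g) {k : ℕ} (hk : k < p) (i : ℕ) :
    AC (dualKernel p ξ g (k + 1) i) :=
  AC_iteratedDeriv_potential hg (k + 1) i (by omega)

theorem ae_deriv_dualKernel_succ (hg : IsTransition p g) {k : ℕ} (hk : k < p) (i : ℕ) :
    ∀ᵐ t ∂(volume.restrict (Ioo (0 : ℝ) 1)), deriv (dualKernel p ξ g (k + 1) i) t =
      ((p - k : ℕ) : ℝ) / (ξ (i + (p - k)) - ξ i) *
        (dualKernel p ξ g k (i - 1) t - dualKernel p ξ g k i t) := by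
  filter_upwards [(AC_iteratedDeriv_potential (ξ := ξ) hg k (i - 1)
      (Nat.sub_le p k)).ae_differentiableAt_Ioo,
    (AC_iteratedDeriv_potential (ξ := ξ) hg k i (Nat.sub_le p k)).ae_differentiableAt_Ioo]
    with t h1 h2
  rw [funext (dualKernel_succ hg hk i)]
  have := ((h1.hasDerivAt.sub h2.hasDerivAt).const_mul
    (((p - k : ℕ) : ℝ) / (ξ (i + (p - k)) - ξ i))).deriv
  rw [deriv_iteratedDeriv_potential hk.le, deriv_iteratedDeriv_potential hk.le] at this
  exact this

theorem dualKernel_succ_eq_zero_left (hg : IsTransition p g) (hξ : Monotone ξ) {k i : ℕ}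
    (hi : k + 1 ≤ i) (hs : KnotsSeparated p ξ (k + 1) (i - (k + 1)) i) (hk : k < p) {t : ℝ}
    (ht : t ≤ ξ (i - (k + 1))) : dualKernel p ξ g (k + 1) i t = 0 := by
  rw [dualKernel_succ hg hk,
    iteratedDeriv_potential_eq_zero hg hξ (by omega) (hs.mono (by omega) (by omega) (by omega))
      (by convert ht using 2; omega),
    iteratedDeriv_potential_eq_zero hg hξ (by omega) (hs.mono (by omega) (by omega) le_rfl)
      (ht.trans (hξ (by omega))), sub_self, mul_zero]

theorem dualKernel_succ_eq_zero_right (hg : IsTransition p g) (hξ : Monotone ξ) {k i : ℕ}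
    (hi : k + 1 ≤ i) (hs : KnotsSeparated p ξ (k + 1) (i - (k + 1)) i) (hk : k < p) {t : ℝ}
    (ht : ξ (i + p + 1) ≤ t) : dualKernel p ξ g (k + 1) i t = 0 := by
  rw [dualKernel_succ hg hk,
    iteratedDeriv_potential_eq_one hg hξ hk.le (by omega)
      (hs.mono (by omega) (by omega) (by omega)) ((hξ (by omega)).trans ht),
    iteratedDeriv_potential_eq_one hg hξ hk.le (by omega)
      (hs.mono (by omega) (by omega) le_rfl) ht, sub_self, mul_zero]

theorem measurable_dualKernel {k : ℕ} (hk : k ≤ p) (i : ℕ) : Measurable (dualKernel p ξ g k i) := by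
  rw [← deriv_iteratedDeriv_potential hk]; exact measurable_deriv _

end Bounds

end

section

/-! ### Open knot vectors -/

section OpenKnots

variable {p r : ℕ} (K : OpenKnots p r)

theorem OpenKnots.p_lt_n : p < K.n := by
  by_contra h
  have h1 := K.eq_zero K.n (by omega)
  have h2 := K.eq_one K.n le_rfl
  linarith

theorem OpenKnots.pos_of_lt {i : ℕ} (hi : p < i) : 0 < K.ξ i := by
  rcases lt_or_ge i K.n with h | h
  · exact (K.internal i hi h).1
  · rw [K.eq_one i h]; norm_num

theorem OpenKnots.lt_one_of_lt {i : ℕ} (hi : i < K.n) : K.ξ i < 1 := by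
  rcases lt_or_ge p i with h | h
  · exact (K.internal i h hi).2
  · rw [K.eq_zero i h]; norm_num

theorem OpenKnots.mem_Icc (i : ℕ) : K.ξ i ∈ Icc (0 : ℝ) 1 := by
  constructor
  · rw [← K.eq_zero 0 (Nat.zero_le p)]; exact K.mono (Nat.zero_le i)
  · rw [← K.eq_one (K.n + i) (by omega)]; exact K.mono (by omega)

theorem OpenKnots.separated {k : ℕ} (hk : k ≤ r + 1) {a b : ℕ} (hb : b < K.n) :
    KnotsSeparated p K.ξ k a b := by
  intro k' hk' i hai hib
  have hlt := K.lt
  refine lt_of_le_of_ne (K.mono (by omega)) fun heq => ?_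
  have h1 : 0 < K.ξ (i + (p + 1 - k')) := K.pos_of_lt (by omega)
  have h2 : K.ξ i < 1 := K.lt_one_of_lt (by omega)
  have hi : p < i := by
    by_contra h
    rw [K.eq_zero i (by omega)] at heq
    linarith
  have hin : i + (p + 1 - k') < K.n := by
    by_contra h
    rw [K.eq_one (i + (p + 1 - k')) (by omega)] at heq
    linarith
  have h3 := K.mult i hi (by omega)
  have h4 : Finset.Icc i (i + (p + 1 - k')) ⊆
      (Finset.range (K.n + p + 1)).filter (fun j => K.ξ j = K.ξ i) := by
    intro j hj
    rw [Finset.mem_Icc] at hj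
    rw [Finset.mem_filter, Finset.mem_range]
    refine ⟨by omega, le_antisymm ?_ (K.mono hj.1)⟩
    rw [heq]; exact K.mono hj.2
  have h5 := Finset.card_le_card h4
  rw [Nat.card_Icc] at h5
  omega

theorem OpenKnots.bspline_first {q i : ℕ} (h : i + q < p) (x : ℝ) : bspline K.ξ q i x = 0 :=
  bspline_eq_zero_of_knots_eq K.mono (by rw [K.eq_zero _ (by omega), K.eq_zero _ (by omega)]) x

theorem OpenKnots.bspline_last {q i : ℕ} (h : K.n ≤ i) (x : ℝ) : bspline K.ξ q i x = 0 :=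
  bspline_eq_zero_of_knots_eq K.mono (by rw [K.eq_one _ h, K.eq_one _ (by omega)]) x

theorem OpenKnots.sum_mul_bspline_succ {q : ℕ} (hq : q < p) (c : ℕ → ℝ) (x : ℝ) :
    ∑ i ∈ Finset.range K.n, c i * bspline K.ξ (q + 1) i x =
      ∑ i ∈ Finset.range K.n, (c (i - 1) + (c i - c (i - 1)) *
        ((x - K.ξ i) / (K.ξ (i + q + 1) - K.ξ i))) * bspline K.ξ q i x := by
  rw [HessianSpline.sum_mul_bspline_succ K.mono]
  obtain ⟨N, hN⟩ : ∃ N, K.n = N + 1 := ⟨K.n - 1, by have := K.p_lt_n; omega⟩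
  have h0 : bspline K.ξ q 0 x = 0 := K.bspline_first (by omega) x
  have h1 : bspline K.ξ q (N + 1) x = 0 := K.bspline_last (by omega) x
  rw [hN, Finset.sum_range_succ' (fun i => c i * ((x - K.ξ i) / (K.ξ (i + q + 1) - K.ξ i) *
    bspline K.ξ q i x)), Finset.sum_range_succ (fun i => c i * (bspline K.ξ q (i + 1) x - _)),
    Finset.sum_range_succ' (fun i => (c (i - 1) + (c i - c (i - 1)) *
        ((x - K.ξ i) / (K.ξ (i + q + 1) - K.ξ i))) * bspline K.ξ q i x), h0, h1]
  simp only [mul_zero, add_zero, sub_self, Nat.add_sub_cancel]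
  rw [← Finset.sum_add_distrib]
  refine Finset.sum_congr rfl fun i _ => ?_
  ring

theorem OpenKnots.sum_bspline {q : ℕ} (hq : q ≤ p) {x : ℝ} (hx : x ∈ Ico (0 : ℝ) 1) :
    ∑ i ∈ Finset.range K.n, bspline K.ξ q i x = 1 := by
  induction q with
  | zero =>
    rw [sum_bspline_zero K.mono, if_pos]
    rw [K.eq_zero 0 (Nat.zero_le p), K.eq_one K.n le_rfl]; exact hx
  | succ q ih =>
    have := K.sum_mul_bspline_succ (q := q) (by omega) (fun _ => 1) x
    simp only [one_mul, sub_self, zero_mul, add_zero] at this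
    rw [this, ih (by omega)]

/-- The identity is a spline, with the (unnormalised) Greville abscissae as coefficients. -/
theorem OpenKnots.sum_greville {q : ℕ} (hq : q ≤ p) {x : ℝ} (hx : x ∈ Ico (0 : ℝ) 1) :
    ∑ i ∈ Finset.range K.n, (∑ ν ∈ Finset.range q, K.ξ (i + ν + 1)) * bspline K.ξ q i x =
      q * x := by
  induction q with
  | zero => simp
  | succ q ih =>
    rw [K.sum_mul_bspline_succ (q := q) (by omega)]
    have h1 : ∀ i ∈ Finset.range K.n,
        ((∑ ν ∈ Finset.range (q + 1), K.ξ (i - 1 + ν + 1)) +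
          ((∑ ν ∈ Finset.range (q + 1), K.ξ (i + ν + 1)) -
          (∑ ν ∈ Finset.range (q + 1), K.ξ (i - 1 + ν + 1))) *
          ((x - K.ξ i) / (K.ξ (i + q + 1) - K.ξ i))) * bspline K.ξ q i x =
        (∑ ν ∈ Finset.range q, K.ξ (i + ν + 1)) * bspline K.ξ q i x +
          x * bspline K.ξ q i x := by
      intro i _
      rcases i with _ | i
      · rw [K.bspline_first (by omega)]; simp
      rcases eq_or_ne (K.ξ (i + 1)) (K.ξ (i + 1 + q + 1)) with h | h
      · rw [bspline_eq_zero_of_knots_eq K.mono h]; simp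
      · rw [Nat.add_sub_cancel, Finset.sum_range_succ' (fun ν => K.ξ (i + ν + 1)),
          Finset.sum_range_succ (fun ν => K.ξ (i + 1 + ν + 1))]
        have e : ∀ ν, i + (ν + 1) + 1 = i + 1 + ν + 1 := fun ν => by omega
        simp only [e, add_zero]
        have h' : K.ξ (i + 1 + q + 1) - K.ξ (i + 1) ≠ 0 := sub_ne_zero.2 h.symm
        field_simp
        ring
    rw [Finset.sum_congr rfl h1, Finset.sum_add_distrib, ih (by omega), ← Finset.mul_sum,
      K.sum_bspline (by omega) hx]
    push_cast; ring

end OpenKnots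

/-! ### Integral kernels of the univariate projections -/

theorem sum_Ico_mul_sub {k n : ℕ} (hkn : k < n) (c b : ℕ → ℝ) (hk : b k = 0) (hn : b n = 0) :
    ∑ i ∈ Finset.Ico k n, c i * (b (i + 1) - b i) =
      ∑ i ∈ Finset.Ico (k + 1) n, (c (i - 1) - c i) * b i := by
  obtain ⟨m, rfl⟩ : ∃ m, n = k + 1 + m := ⟨n - (k + 1), by omega⟩
  have key : ∀ m, ∑ i ∈ Finset.Ico k (k + 1 + m), c i * (b (i + 1) - b i) =
      ∑ i ∈ Finset.Ico (k + 1) (k + 1 + m), (c (i - 1) - c i) * b i +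
        c (k + m) * b (k + 1 + m) - c k * b k := by
    intro m
    induction m with
    | zero => simp; ring
    | succ m ih =>
      rw [← add_assoc, Finset.sum_Ico_succ_top (by omega), ih,
        Finset.sum_Ico_succ_top (by omega), show k + 1 + m - 1 = k + m by omega,
        show k + (m + 1) = k + 1 + m by omega]
      ring
  rw [key, hk, hn]; ring

section Kernel

variable {p r : ℕ} (K : OpenKnots p r) (g : ℝ → ℝ)

/-- The integral kernel of the projection onto splines of degree `p - k`. -/
def uniKernel (k : ℕ) (x y : ℝ) : ℝ :=
  ∑ i ∈ Finset.Ico k K.n, bspline K.ξ (p - k) i x * dualKernel p K.ξ g k i y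

/-- The derivative of the integral kernel of degree `p - (k + 1)` in its second variable. -/
def uniKernelDy (k : ℕ) (x y : ℝ) : ℝ :=
  ∑ i ∈ Finset.Ico (k + 1) K.n, bspline K.ξ (p - (k + 1)) i x *
    (((p - k : ℕ) : ℝ) / (K.ξ (i + (p - k)) - K.ξ i) *
      (dualKernel p K.ξ g k (i - 1) y - dualKernel p K.ξ g k i y))

/-- The dual functionals. -/
def coeff (k i : ℕ) (u : ℝ → ℝ) : ℝ :=
  ∫ y in Ioo (0 : ℝ) 1, dualKernel p K.ξ g k i y * u y

variable {g}

theorem exists_bound_dualKernel (hg : IsTransition p g) {k i : ℕ} (hk : k ≤ r + 1) (hi : k ≤ i)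
    (hin : i < K.n) : ∃ C, 0 ≤ C ∧ ∀ t, |dualKernel p K.ξ g k i t| ≤ C := by
  obtain ⟨M, hM0, hM, hL⟩ := hg.exists_bound
  have hlt := K.lt
  have hkp : k ≤ p := by omega
  have hs : KnotsSeparated p K.ξ k (i - k) i := K.separated hk hin
  set H := K.ξ (i + p + 1) - K.ξ (i - k)
  have hH : K.ξ (i - k) < K.ξ (i + p + 1) :=
    (K.mono (by omega : i - k ≤ i)).trans_lt (hs 0 (Nat.zero_le _) i (by omega) le_rfl)
  set R : ℝ := 1 + ∑ q ∈ Finset.range (k + 1) ×ˢ Finset.range (i + 1),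
    |H / (K.ξ (q.2 + (p + 1 - q.1)) - K.ξ q.2)| with hRdef
  have hR : 1 ≤ R := by
    have : 0 ≤ ∑ q ∈ Finset.range (k + 1) ×ˢ Finset.range (i + 1),
      |H / (K.ξ (q.2 + (p + 1 - q.1)) - K.ξ q.2)| := Finset.sum_nonneg fun _ _ => abs_nonneg _
    linarith
  have hsep : ∀ k' ≤ k, ∀ i', i - k + k' ≤ i' → i' ≤ i →
      H ≤ R * (K.ξ (i' + (p + 1 - k')) - K.ξ i') := by
    intro k' hk' i' h1 h2
    have h3 := hs k' hk' i' h1 h2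
    have h4 : |H / (K.ξ (i' + (p + 1 - k')) - K.ξ i')| ≤ R := by
      have := Finset.single_le_sum (s := Finset.range (k + 1) ×ˢ Finset.range (i + 1))
        (f := fun q => |H / (K.ξ (q.2 + (p + 1 - q.1)) - K.ξ q.2)|)
        (fun _ _ => abs_nonneg _) (a := (k', i'))
        (by rw [Finset.mem_product, Finset.mem_range, Finset.mem_range]; constructor <;> simp <;> omega)
      simp only at this
      linarith
    have h5 := (le_abs_self _).trans h4
    rwa [div_le_iff₀ (by linarith)] at h5
  have hb := fun t ht => abs_dualKernel_le (t := t) hg hM0 hM hL K.mono hR hkp hi hH hsep ht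
  set a := K.ξ (i - k)
  set b := K.ξ (i + p + 1)
  have hC0 : 0 ≤ kernelConst p M R k / H :=
    div_nonneg (kernelConst_nonneg p hM0 hR k) (by linarith [sub_pos.2 hH])
  refine ⟨kernelConst p M R k / H + |dualKernel p K.ξ g k i a| + |dualKernel p K.ξ g k i b|,
    by positivity, fun t => ?_⟩
  have h1 := abs_nonneg (dualKernel p K.ξ g k i a)
  have h2 := abs_nonneg (dualKernel p K.ξ g k i b)
  rcases lt_trichotomy t a with h | h | h
  · rw [dualKernel_eq_zero_left hg K.mono hi hs h, abs_zero]; positivity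
  · rw [h]; linarith
  rcases lt_trichotomy t b with h' | h' | h'
  · linarith [hb t ⟨h, h'⟩]
  · rw [h']; linarith
  · rw [dualKernel_eq_zero_right hg K.mono hkp hi hs h', abs_zero]; positivity

theorem measurable_uniKernel {k : ℕ} (hk : k ≤ p) :
    Measurable fun q : ℝ × ℝ => uniKernel K g k q.1 q.2 := by
  unfold uniKernel
  refine Finset.measurable_sum _ fun i _ => ?_
  exact ((measurable_bspline K.ξ _ i).comp measurable_fst).mul
    ((measurable_dualKernel hk i).comp measurable_snd)

theorem measurable_uniKernelDy {k : ℕ} (hk : k ≤ p) :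
    Measurable fun q : ℝ × ℝ => uniKernelDy K g k q.1 q.2 := by
  unfold uniKernelDy
  refine Finset.measurable_sum _ fun i _ => ?_
  exact ((measurable_bspline K.ξ _ i).comp measurable_fst).mul (measurable_const.mul
    (((measurable_dualKernel hk (i - 1)).comp measurable_snd).sub
    ((measurable_dualKernel hk i).comp measurable_snd)))

theorem exists_bound_uniKernel (hg : IsTransition p g) {k : ℕ} (hk : k ≤ r + 1) :
    ∃ C, 0 ≤ C ∧ ∀ x y, |uniKernel K g k x y| ≤ C := by
  have h : ∀ i, ∃ C, i ∈ Finset.Ico k K.n → 0 ≤ C ∧ ∀ t, |dualKernel p K.ξ g k i t| ≤ C := by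
    intro i
    by_cases hi : i ∈ Finset.Ico k K.n
    · obtain ⟨C, hC⟩ := exists_bound_dualKernel K hg hk (Finset.mem_Ico.1 hi).1
        (Finset.mem_Ico.1 hi).2
      exact ⟨C, fun _ => hC⟩
    · exact ⟨0, fun h => absurd h hi⟩
  choose C hC using h
  refine ⟨∑ i ∈ Finset.Ico k K.n, C i, Finset.sum_nonneg fun i hi => (hC i hi).1, fun x y => ?_⟩
  refine (Finset.abs_sum_le_sum_abs _ _).trans (Finset.sum_le_sum fun i hi => ?_)
  rw [abs_mul]
  exact (mul_le_of_le_one_left (abs_nonneg _) (abs_bspline_le_one K.mono _ _ _)).trans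
    ((hC i hi).2 y)

theorem exists_bound_uniKernelDy (hg : IsTransition p g) {k : ℕ} (hk : k ≤ r + 1) :
    ∃ C, 0 ≤ C ∧ ∀ x y, |uniKernelDy K g k x y| ≤ C := by
  have h : ∀ i, ∃ C, i ∈ Finset.Ico k K.n → 0 ≤ C ∧ ∀ t, |dualKernel p K.ξ g k i t| ≤ C := by
    intro i
    by_cases hi : i ∈ Finset.Ico k K.n
    · obtain ⟨C, hC⟩ := exists_bound_dualKernel K hg hk (Finset.mem_Ico.1 hi).1
        (Finset.mem_Ico.1 hi).2
      exact ⟨C, fun _ => hC⟩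
    · exact ⟨0, fun h => absurd h hi⟩
  choose C hC using h
  refine ⟨∑ i ∈ Finset.Ico (k + 1) K.n, |((p - k : ℕ) : ℝ) / (K.ξ (i + (p - k)) - K.ξ i)| *
    (C (i - 1) + C i), Finset.sum_nonneg fun i hi => ?_, fun x y => ?_⟩
  · rw [Finset.mem_Ico] at hi
    have h1 := (hC i (by rw [Finset.mem_Ico]; omega)).1
    have h2 := (hC (i - 1) (by rw [Finset.mem_Ico]; omega)).1
    positivity
  · refine (Finset.abs_sum_le_sum_abs _ _).trans (Finset.sum_le_sum fun i hi => ?_)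
    rw [Finset.mem_Ico] at hi
    rw [abs_mul, abs_mul]
    refine (mul_le_of_le_one_left (by positivity) (abs_bspline_le_one K.mono _ _ _)).trans
      (mul_le_mul_of_nonneg_left ((abs_sub _ _).trans (add_le_add ?_ ?_)) (abs_nonneg _))
    · exact (hC (i - 1) (by rw [Finset.mem_Ico]; omega)).2 y
    · exact (hC i (by rw [Finset.mem_Ico]; omega)).2 y

theorem integrableOn_dualKernel_mul (hg : IsTransition p g) {k i : ℕ} (hk : k ≤ r + 1)
    (hi : k ≤ i) (hin : i < K.n) {u : ℝ → ℝ} (hu : IntegrableOn u (Ioo 0 1)) :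
    IntegrableOn (fun y => dualKernel p K.ξ g k i y * u y) (Ioo 0 1) := by
  obtain ⟨C, _, hC⟩ := exists_bound_dualKernel K hg hk hi hin
  have hlt := K.lt
  exact Integrable.bdd_mul hu (measurable_dualKernel (by omega) i).aestronglyMeasurable (c := C)
    (Eventually.of_forall fun t => hC t)

theorem integral_uniKernel_mul (hg : IsTransition p g) {k : ℕ} (hk : k ≤ r + 1) {u : ℝ → ℝ}
    (hu : IntegrableOn u (Ioo 0 1)) (x : ℝ) :
    ∫ y in Ioo (0 : ℝ) 1, uniKernel K g k x y * u y =
      ∑ i ∈ Finset.Ico k K.n, coeff K g k i u * bspline K.ξ (p - k) i x := by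
  simp only [uniKernel, Finset.sum_mul]
  rw [integral_finsetSum]
  · refine Finset.sum_congr rfl fun i _ => ?_
    simp only [mul_assoc]
    rw [integral_const_mul, mul_comm]
    rfl
  · intro i hi
    rw [Finset.mem_Ico] at hi
    simp only [mul_assoc]
    exact (integrableOn_dualKernel_mul K hg hk hi.1 hi.2 hu).const_mul _

/-- The kernel reproduces splines. -/
theorem integral_uniKernel_mul_bspline (hg : IsTransition p g) {k : ℕ} (hk : k ≤ r + 1)
    {j : ℕ} (hj : k ≤ j) (hjn : j < K.n) (x : ℝ) :
    ∫ y in Ioo (0 : ℝ) 1, uniKernel K g k x y * bspline K.ξ (p - k) j y =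
      bspline K.ξ (p - k) j x := by
  have hlt := K.lt
  have hB : IntegrableOn (bspline K.ξ (p - k) j) (Ioo 0 1) := by
    simpa using integrableOn_bspline_mul K.mono (p - k) j (F := fun _ => 1) (s := Ioo 0 1)
      (integrableOn_const (by simp))
  rw [integral_uniKernel_mul K hg hk hB, Finset.sum_eq_single j]
  · rw [coeff]
    simp only [mul_comm (dualKernel p K.ξ g k j _)]
    rw [integral_bspline_mul_dualKernel hg K.mono K.mem_Icc (by omega) hj (K.separated hk hjn),
      if_pos rfl, one_mul]
  · intro i hi hij
    rw [Finset.mem_Ico] at hi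
    rw [coeff]
    simp only [mul_comm (dualKernel p K.ξ g k i _)]
    rw [integral_bspline_mul_dualKernel hg K.mono K.mem_Icc (by omega) hi.1
      (K.separated hk hi.2), if_neg hij.symm, zero_mul]
  · intro h; exact absurd (Finset.mem_Ico.2 ⟨hj, hjn⟩) h

end Kernel

end

section

section Representation

variable {p r : ℕ} (K : OpenKnots p r) {g : ℝ → ℝ}

/-! ### The univariate projections as integral operators -/

theorem coeff_zero (hg : IsTransition p g) {i : ℕ} (hin : i < K.n) (u : ℝ → ℝ) :
    dualFunctional p K.ξ g i u = coeff K g 0 i u := by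
  have hs : KnotsSeparated p K.ξ 0 (i - 0) i := K.separated (Nat.zero_le _) hin
  have hle : K.ξ i ≤ K.ξ (i + p + 1) := K.mono (by omega)
  rw [dualFunctional, coeff, ← setIntegral_Ioo_eq_intervalIntegral _ hle]
  have e : ∀ y, u y * iteratedDeriv (p + 1) (dualPotential p K.ξ g i) y =
      dualKernel p K.ξ g 0 i y * u y := fun y => mul_comm _ _
  simp only [e]
  refine (setIntegral_eq_of_subset_of_ae_sdiff_eq_zero measurableSet_Ioo.nullMeasurableSet
    (Ioo_subset_Ioo (K.mem_Icc i).1 (K.mem_Icc _).2) ?_).symm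
  have hne : ∀ c : ℝ, ∀ᵐ y : ℝ, y ≠ c := fun c => by simp [ae_iff]
  filter_upwards [hne (K.ξ i), hne (K.ξ (i + p + 1))] with y h1 h2 h3
  rcases lt_or_gt_of_ne h1 with h | h
  · rw [dualKernel_eq_zero_left hg K.mono (Nat.zero_le i) hs h, zero_mul]
  · rcases lt_or_gt_of_ne h2 with h' | h'
    · exact absurd ⟨h, h'⟩ h3.2
    · rw [dualKernel_eq_zero_right hg K.mono (Nat.zero_le p) (Nat.zero_le i) hs h', zero_mul]

theorem intervalIntegrable_of_integrableOn_Ioo {u : ℝ → ℝ} (hu : IntegrableOn u (Ioo 0 1)) :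
    IntervalIntegrable u volume 0 1 :=
  (intervalIntegrable_iff_integrableOn_Ioo_of_le zero_le_one).2 hu

theorem AC_prim {u : ℝ → ℝ} (hu : IntegrableOn u (Ioo 0 1)) : AC (prim u) :=
  (intervalIntegrable_of_integrableOn_Ioo hu).absolutelyContinuousOnInterval_intervalIntegral
    (c := 0) (by simp)

theorem ae_deriv_prim {u : ℝ → ℝ} (hu : IntegrableOn u (Ioo 0 1)) :
    ∀ᵐ t ∂(volume.restrict (Ioo (0 : ℝ) 1)), deriv (prim u) t = u t := by
  rw [ae_restrict_iff' measurableSet_Ioo]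
  filter_upwards [(intervalIntegrable_of_integrableOn_Ioo hu).ae_hasDerivAt_integral] with t h ht
  exact (h (by rw [uIcc_of_le zero_le_one]; exact Ioo_subset_Icc_self ht) 0 (by simp)).deriv

theorem AC.integral_mul_deriv_of_zero {F G : ℝ → ℝ} (hF : AC F) (hG : AC G) (h0 : F 0 = 0)
    (h1 : F 1 = 0) :
    ∫ t in Ioo (0 : ℝ) 1, F t * deriv G t = -∫ t in Ioo (0 : ℝ) 1, deriv F t * G t := by
  rw [setIntegral_Ioo_eq_intervalIntegral _ zero_le_one,
    setIntegral_Ioo_eq_intervalIntegral _ zero_le_one,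
    AbsolutelyContinuousOnInterval.integral_mul_deriv_eq_deriv_mul hF hG, h0, h1]
  ring

theorem dualKernel_succ_zero (hg : IsTransition p g) {k i : ℕ} (hk : k ≤ r)
    (hi : k + 1 ≤ i) (hin : i < K.n) : dualKernel p K.ξ g (k + 1) i 0 = 0 := by
  have hlt := K.lt
  exact dualKernel_succ_eq_zero_left hg K.mono hi (K.separated (by omega) hin) (by omega)
    (K.mem_Icc _).1

theorem dualKernel_succ_one (hg : IsTransition p g) {k i : ℕ} (hk : k ≤ r)
    (hi : k + 1 ≤ i) (hin : i < K.n) : dualKernel p K.ξ g (k + 1) i 1 = 0 := by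
  have hlt := K.lt
  exact dualKernel_succ_eq_zero_right hg K.mono hi (K.separated (by omega) hin) (by omega)
    (K.mem_Icc _).2

theorem coeff_succ (hg : IsTransition p g) {k i : ℕ} (hk : k ≤ r) (hi : k + 1 ≤ i)
    (hin : i < K.n) {u : ℝ → ℝ} (hu : IntegrableOn u (Ioo 0 1)) :
    coeff K g (k + 1) i u = ((p - k : ℕ) : ℝ) / (K.ξ (i + (p - k)) - K.ξ i) *
      (coeff K g k i (prim u) - coeff K g k (i - 1) (prim u)) := by
  have hlt := K.lt
  have hA := AC_prim hu
  have hI := integrableOn_Ioo_of_continuousOn hA.continuousOn_Icc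
  have h1 : coeff K g (k + 1) i u =
      ∫ t in Ioo (0 : ℝ) 1, dualKernel p K.ξ g (k + 1) i t * deriv (prim u) t := by
    refine integral_congr_ae ?_
    filter_upwards [ae_deriv_prim hu] with t ht
    rw [ht]
  rw [h1, (AC_dualKernel_succ hg (by omega) i).integral_mul_deriv_of_zero hA
    (dualKernel_succ_zero K hg hk hi hin) (dualKernel_succ_one K hg hk hi hin), coeff, coeff,
    ← integral_sub, ← integral_const_mul, ← integral_neg]
  · refine integral_congr_ae ?_
    filter_upwards [ae_deriv_dualKernel_succ (ξ := K.ξ) hg (by omega : k < p) i] with t ht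
    rw [ht]; ring
  · exact integrableOn_dualKernel_mul K hg (by omega) (by omega) hin hI
  · exact integrableOn_dualKernel_mul K hg (by omega) (by omega) (by omega) hI

theorem isOpen_nonKnots : IsOpen {x : ℝ | ∀ j, K.ξ j ≠ x} := by
  have h : {x : ℝ | ∀ j, K.ξ j ≠ x} = (K.ξ '' (Finset.range (K.n + 1) : Set ℕ))ᶜ := by
    ext x
    simp only [mem_ofPred_eq, mem_compl_iff, mem_image, not_exists, not_and, Finset.coe_range,
      mem_Iio]
    constructor
    · exact fun h j _ => h j
    · intro h j hj
      rcases lt_or_ge j (K.n + 1) with h' | h'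
      · exact h j h' hj
      · refine h K.n (by omega) ?_
        rw [← hj, K.eq_one _ le_rfl, K.eq_one _ (by omega)]
  rw [h]
  exact ((Finset.finite_toSet _).image _).isClosed.isOpen_compl

theorem ae_nonKnots : ∀ᵐ x : ℝ, ∀ j, K.ξ j ≠ x := by
  rw [ae_all_iff]
  intro j
  have : ∀ c : ℝ, ∀ᵐ y : ℝ, c ≠ y := fun c => by simp [ae_iff]
  exact this _

theorem hasDerivAt_sum_bspline {k : ℕ} (hk : k < p) (c : ℕ → ℝ) {x : ℝ} (hx : ∀ j, K.ξ j ≠ x) :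
    HasDerivAt (fun x => ∑ i ∈ Finset.Ico k K.n, c i * bspline K.ξ (p - k) i x)
      (∑ i ∈ Finset.Ico (k + 1) K.n, ((p - k : ℕ) : ℝ) / (K.ξ (i + (p - k)) - K.ξ i) *
        (c i - c (i - 1)) * bspline K.ξ (p - (k + 1)) i x) x := by
  have h1 := HasDerivAt.fun_sum (u := Finset.Ico k K.n) (x := x)
    (A := fun i x => c i * bspline K.ξ (p - k) i x)
    fun i _ => (hasDerivAt_bspline K.mono hx (p - k) i).const_mul (c i)
  refine h1.congr_deriv ?_
  set b : ℕ → ℝ := fun i => -((p - k : ℕ) : ℝ) * (bspline K.ξ (p - (k + 1)) i x /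
    (K.ξ (i + (p - k)) - K.ξ i)) with hb
  have hn := K.p_lt_n
  have h2 := sum_Ico_mul_sub (by omega : k < K.n) c b
    (by simp [hb, K.bspline_first (q := p - (k + 1)) (i := k) (by omega)])
    (by simp [hb, K.bspline_last (q := p - (k + 1)) (i := K.n) le_rfl])
  refine Eq.symm (Eq.trans ?_ (h2.symm.trans ?_))
  · refine Finset.sum_congr rfl fun i _ => ?_
    simp only [hb]; ring
  · refine Finset.sum_congr rfl fun i _ => ?_
    simp only [hb]
    rw [show p - k - 1 = p - (k + 1) by omega, show i + 1 + (p - k) = i + (p - k) + 1 by omega]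
    ring

theorem uniProj_eq_sum (hg : IsTransition p g) (hr : 1 ≤ r) (k : Fin 3) {u : ℝ → ℝ}
    (hu : IntegrableOn u (Ioo 0 1)) {x : ℝ} (hx : ∀ j, K.ξ j ≠ x) :
    uniProj K g k u x =
      ∑ i ∈ Finset.Ico (k : ℕ) K.n, coeff K g k i u * bspline K.ξ (p - (k : ℕ)) i x := by
  have hlt := K.lt
  have h0 : ∀ v : ℝ → ℝ, splineProj K g v = fun x =>
      ∑ i ∈ Finset.Ico 0 K.n, coeff K g 0 i v * bspline K.ξ (p - 0) i x := by
    intro v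
    ext x
    rw [splineProj, Finset.range_eq_Ico]
    refine Finset.sum_congr rfl fun i hi => ?_
    rw [coeff_zero K hg (Finset.mem_Ico.1 hi).2, Nat.sub_zero]
  have h1 : ∀ v : ℝ → ℝ, IntegrableOn v (Ioo 0 1) → ∀ x, (∀ j, K.ξ j ≠ x) →
      splineProjC1 K g v x =
        ∑ i ∈ Finset.Ico 1 K.n, coeff K g 1 i v * bspline K.ξ (p - 1) i x := by
    intro v hv x hx
    rw [splineProjC1, h0, (hasDerivAt_sum_bspline K (by omega : 0 < p) _ hx).deriv]
    refine Finset.sum_congr rfl fun i hi => ?_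
    rw [Finset.mem_Ico] at hi
    rw [coeff_succ K hg (Nat.zero_le r) hi.1 hi.2 hv]
  fin_cases k
  · exact congrFun (h0 u) x
  · exact h1 u hu x hx
  · change deriv (splineProjC1 K g (prim u)) x = _
    have hev : splineProjC1 K g (prim u) =ᶠ[𝓝 x] fun x =>
        ∑ i ∈ Finset.Ico 1 K.n, coeff K g 1 i (prim u) * bspline K.ξ (p - 1) i x := by
      filter_upwards [(isOpen_nonKnots K).mem_nhds hx] with y hy
      exact h1 _ (integrableOn_Ioo_of_continuousOn (AC_prim hu).continuousOn_Icc) y hy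
    rw [hev.deriv_eq, (hasDerivAt_sum_bspline K (by omega : 1 < p) _ hx).deriv]
    refine Finset.sum_congr rfl fun i hi => ?_
    rw [Finset.mem_Ico] at hi
    change _ = coeff K g (1 + 1) i u * _
    rw [coeff_succ K hg hr hi.1 hi.2 hu]

theorem uniProj_eq_integral (hg : IsTransition p g) (hr : 1 ≤ r) (k : Fin 3) {u : ℝ → ℝ}
    (hu : IntegrableOn u (Ioo 0 1)) {x : ℝ} (hx : ∀ j, K.ξ j ≠ x) :
    uniProj K g k u x = ∫ y in Ioo (0 : ℝ) 1, uniKernel K g k x y * u y := by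
  rw [uniProj_eq_sum K hg hr k hu hx, integral_uniKernel_mul K hg (by omega) hu]

/-! ### Derivatives of the kernels -/

theorem AC_sum {ι : Type*} (s : Finset ι) {F : ι → ℝ → ℝ} (h : ∀ i ∈ s, AC (F i)) :
    AC (fun t => ∑ i ∈ s, F i t) := by
  classical
  induction s using Finset.induction_on with
  | empty => simpa using AC.linear 0 0
  | insert a s ha ih =>
    simp only [Finset.sum_insert ha]
    exact AbsolutelyContinuousOnInterval.fun_add (h a (Finset.mem_insert_self a s))
      (ih fun i hi => h i (Finset.mem_insert_of_mem hi))

theorem AC_uniKernel_succ (hg : IsTransition p g) {k : ℕ} (hk : k ≤ r) (x : ℝ) :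
    AC (uniKernel K g (k + 1) x) := by
  have hlt := K.lt
  exact AC_sum _ fun i _ => AbsolutelyContinuousOnInterval.const_mul _
    (AC_dualKernel_succ hg (by omega) i)

theorem uniKernel_succ_zero (hg : IsTransition p g) {k : ℕ} (hk : k ≤ r) (x : ℝ) :
    uniKernel K g (k + 1) x 0 = 0 :=
  Finset.sum_eq_zero fun i hi => by
    rw [Finset.mem_Ico] at hi
    rw [dualKernel_succ_zero K hg hk hi.1 hi.2, mul_zero]

theorem uniKernel_succ_one (hg : IsTransition p g) {k : ℕ} (hk : k ≤ r) (x : ℝ) :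
    uniKernel K g (k + 1) x 1 = 0 :=
  Finset.sum_eq_zero fun i hi => by
    rw [Finset.mem_Ico] at hi
    rw [dualKernel_succ_one K hg hk hi.1 hi.2, mul_zero]

theorem ae_deriv_uniKernel_succ (hg : IsTransition p g) {k : ℕ} (hk : k ≤ r) (x : ℝ) :
    ∀ᵐ y ∂(volume.restrict (Ioo (0 : ℝ) 1)),
      deriv (uniKernel K g (k + 1) x) y = uniKernelDy K g k x y := by
  have hlt := K.lt
  have h1 : ∀ᵐ y ∂(volume.restrict (Ioo (0 : ℝ) 1)), ∀ i,
      DifferentiableAt ℝ (dualKernel p K.ξ g (k + 1) i) y :=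
    ae_all_iff.2 fun i => (AC_dualKernel_succ hg (by omega) i).ae_differentiableAt_Ioo
  have h2 := ae_all_iff.2 fun i => ae_deriv_dualKernel_succ (ξ := K.ξ) hg (by omega : k < p) i
  filter_upwards [h1, h2] with y h1 h2
  have := (HasDerivAt.fun_sum (u := Finset.Ico (k + 1) K.n)
    fun i _ => (h1 i).hasDerivAt.const_mul (bspline K.ξ (p - (k + 1)) i x)).deriv
  refine Eq.trans this ?_
  simp only [h2]
  rfl

theorem knotMean_interior {k i : ℕ} (hk : k ≤ r) (hi : k + 1 ≤ i)
    (hin : i < K.n) (H : ℝ → ℝ) : knotMean K.ξ (p - k) i H =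
      ((p - k : ℕ) : ℝ) / (K.ξ (i + (p - k)) - K.ξ i) *
        ∫ t in Ioo (0 : ℝ) 1, bspline K.ξ (p - (k + 1)) i t * H t := by
  have h := K.separated (k := k + 1) (by omega) hin (a := 0) (k + 1) le_rfl i (by omega) le_rfl
  rw [show p + 1 - (k + 1) = p - k by omega] at h
  rw [knotMean_of_lt h, show p - k - 1 = p - (k + 1) by omega]

/-- The weak derivative of a spline against functions vanishing at the end points. -/
theorem integral_sum_bspline_mul_deriv {k : ℕ} (hk : k ≤ r) (c : ℕ → ℝ) {H : ℝ → ℝ} (hH : AC H)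
    (h0 : H 0 = 0) (h1 : H 1 = 0) :
    ∫ t in Ioo (0 : ℝ) 1, (∑ i ∈ Finset.Ico k K.n, c i * bspline K.ξ (p - k) i t) * deriv H t =
      -∫ t in Ioo (0 : ℝ) 1, (∑ i ∈ Finset.Ico (k + 1) K.n,
        ((p - k : ℕ) : ℝ) / (K.ξ (i + (p - k)) - K.ξ i) * (c i - c (i - 1)) *
          bspline K.ξ (p - (k + 1)) i t) * H t := by
  have hlt := K.lt
  have hn := K.p_lt_n
  have hI := integrableOn_Ioo_of_continuousOn hH.continuousOn_Icc
  simp only [Finset.sum_mul, mul_assoc]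
  rw [integral_finsetSum, integral_finsetSum]
  · simp only [integral_const_mul]
    simp only [integral_bspline_mul_deriv K.mono K.mem_Icc _ _ hH]
    rw [sum_Ico_mul_sub (by omega) c (fun i => knotMean K.ξ (p - k) i H), ← Finset.sum_neg_distrib]
    · refine Finset.sum_congr rfl fun i hi => ?_
      rw [Finset.mem_Ico] at hi
      rw [knotMean_interior K hk hi.1 hi.2]
      ring
    · rw [knotMean_of_eq, K.eq_zero _ (by omega), h0]
      rw [K.eq_zero _ (by omega), K.eq_zero _ (by omega)]
    · rw [knotMean_of_eq, K.eq_one _ le_rfl, h1]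
      rw [K.eq_one _ le_rfl, K.eq_one _ (by omega)]
  · intro i _
    exact ((integrableOn_bspline_mul K.mono _ i hI).const_mul _).const_mul _
  · intro i _
    exact (integrableOn_bspline_mul K.mono _ i hH.integrableOn_deriv).const_mul _

theorem integral_uniKernel_mul_deriv {k : ℕ} (hk : k ≤ r) {H : ℝ → ℝ} (hH : AC H)
    (h0 : H 0 = 0) (h1 : H 1 = 0) (y : ℝ) :
    ∫ x in Ioo (0 : ℝ) 1, uniKernel K g k x y * deriv H x =
      ∫ x in Ioo (0 : ℝ) 1, uniKernelDy K g k x y * H x := by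
  have h := integral_sum_bspline_mul_deriv K hk (fun i => dualKernel p K.ξ g k i y) hH h0 h1
  simp only [uniKernel, mul_comm (bspline K.ξ (p - k) _ _)]
  rw [h, ← integral_neg]
  congr 1
  ext x
  rw [← neg_mul, ← Finset.sum_neg_distrib]
  congr 1
  refine Finset.sum_congr rfl fun i _ => ?_
  ring

end Representation

end

section

/-! ### Schur bounds for the kernels on locally quasi-uniform meshes -/

section QuasiUniform

variable {p r : ℕ} {K : OpenKnots p r} {θ : ℝ}

theorem LocallyQuasiUniform.abs (h : LocallyQuasiUniform θ K) : LocallyQuasiUniform |θ| K := by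
  intro i j hi hj hij
  obtain ⟨h1, h2⟩ := h i j hi hj hij
  constructor
  · exact h1.trans (mul_le_mul_of_nonneg_right (le_abs_self θ) (by linarith))
  · exact h2.trans (mul_le_mul_of_nonneg_right (le_abs_self θ) (by linarith))

theorem LocallyQuasiUniform.extend_right (h : LocallyQuasiUniform θ K) (hθ : 0 ≤ θ) {a b : ℕ}
    (hab : K.ξ a < K.ξ b) : K.ξ (b + 1) - K.ξ a ≤ (1 + θ) * (K.ξ b - K.ξ a) := by
  classical
  rcases (K.mono (Nat.le_succ b)).eq_or_lt with hb | hb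
  · rw [Nat.succ_eq_add_one] at hb
    rw [← hb]; nlinarith
  · have hex : ∃ m, K.ξ m = K.ξ b := ⟨b, rfl⟩
    have hm := Nat.find_spec hex
    set m := Nat.find hex with hmdef
    have ham : a < m := by
      by_contra hc
      have := K.mono (not_lt.1 hc)
      linarith
    have hmb : m ≤ b := Nat.find_min' hex rfl
    have hlt : K.ξ (m - 1) < K.ξ b := lt_of_le_of_ne (K.mono (by omega))
      (Nat.find_min hex (by omega))
    have e : m - 1 + 1 = m := by omega
    have := (h (m - 1) b (by rw [e, hm]; exact hlt) hb (by rw [e, hm])).2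
    rw [e, hm] at this
    have h3 : K.ξ a ≤ K.ξ (m - 1) := K.mono (by omega)
    nlinarith

theorem LocallyQuasiUniform.extend_left (h : LocallyQuasiUniform θ K) (hθ : 0 ≤ θ) {a b : ℕ}
    (hab : K.ξ (a + 1) < K.ξ b) : K.ξ b - K.ξ a ≤ (1 + θ) * (K.ξ b - K.ξ (a + 1)) := by
  classical
  rcases (K.mono (Nat.le_succ a)).eq_or_lt with hb | hb
  · rw [Nat.succ_eq_add_one] at hb
    rw [← hb] at hab ⊢; nlinarith
  · have hex : ∃ m, K.ξ (a + 1) < K.ξ m := ⟨b, hab⟩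
    have hm := Nat.find_spec hex
    set m := Nat.find hex with hmdef
    have ham : a + 1 < m := by
      by_contra hc
      have := K.mono (not_lt.1 hc)
      linarith
    have hmb : m ≤ b := Nat.find_min' hex hab
    have heq : K.ξ (m - 1) = K.ξ (a + 1) := le_antisymm
      (not_lt.1 (Nat.find_min hex (by omega))) (K.mono (by omega))
    have e : m - 1 + 1 = m := by omega
    have := (h a (m - 1) hb (by rw [e, heq]; exact hm) heq.symm).1
    rw [e, heq] at this
    have h3 : K.ξ m ≤ K.ξ b := K.mono hmb
    nlinarith

theorem LocallyQuasiUniform.extend (h : LocallyQuasiUniform θ K) (hθ : 0 ≤ θ) {a b : ℕ}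
    (hab : K.ξ a < K.ξ b) (m₁ m₂ : ℕ) (hm : m₁ ≤ a) :
    K.ξ (b + m₂) - K.ξ (a - m₁) ≤ (1 + θ) ^ (m₁ + m₂) * (K.ξ b - K.ξ a) := by
  induction m₂ with
  | zero =>
    induction m₁ with
    | zero => simp
    | succ m ih =>
      have h1 := ih (by omega)
      have e : a - (m + 1) + 1 = a - m := by omega
      have h2 : K.ξ (a - m) < K.ξ b := (K.mono (by omega : a - m ≤ a)).trans_lt hab
      have h3 := h.extend_left hθ (a := a - (m + 1)) (b := b) (by rw [e]; exact h2)
      rw [e] at h3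
      simp only [add_zero] at h1 ⊢
      calc _ ≤ _ := h3
        _ ≤ (1 + θ) * ((1 + θ) ^ m * (K.ξ b - K.ξ a)) :=
          mul_le_mul_of_nonneg_left h1 (by linarith)
        _ = _ := by ring
  | succ m ih =>
    have h2 : K.ξ (a - m₁) < K.ξ (b + m) :=
      ((K.mono (by omega : a - m₁ ≤ a)).trans_lt hab).trans_le (K.mono (by omega))
    calc _ ≤ _ := h.extend_right hθ h2
      _ ≤ (1 + θ) * ((1 + θ) ^ (m₁ + m) * (K.ξ b - K.ξ a)) :=
        mul_le_mul_of_nonneg_left ih (by linarith)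
      _ = _ := by ring

/-- A bound for `Σ|κᵢ|·(length of the support of Bᵢ)` and for the norms of the dual functionals. -/
theorem exists_schur_bound (p : ℕ) {g : ℝ → ℝ} (hg : IsTransition p g) (θ : ℝ) :
    ∃ C : ℝ, 0 ≤ C ∧ ∀ (r : ℕ), 1 ≤ r → ∀ K : OpenKnots p r, LocallyQuasiUniform θ K →
      ∀ k : ℕ, k ≤ 2 →
        (∀ x, ∫ y in Ioo (0 : ℝ) 1, |uniKernel K g k x y| ≤ C) ∧
        (∀ᵐ y, ∫ x in Ioo (0 : ℝ) 1, |uniKernel K g k x y| ≤ C) := by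
  obtain ⟨M, hM0, hM, hL⟩ := hg.exists_bound
  set R : ℝ := (1 + |θ|) ^ 4 with hRdef
  have hR : 1 ≤ R := one_le_pow₀ (by linarith [abs_nonneg θ])
  set c : ℝ := ∑ k ∈ Finset.range 3, kernelConst p M R k with hcdef
  have hc0 : 0 ≤ c := Finset.sum_nonneg fun k _ => kernelConst_nonneg p hM0 hR k
  refine ⟨(p + 3) * c, by positivity, fun r hr K hK k hk => ?_⟩
  have hkc : kernelConst p M R k ≤ c :=
    Finset.single_le_sum (fun k _ => kernelConst_nonneg p hM0 hR k)
      (Finset.mem_range.2 (by omega))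
  have hlt := K.lt
  have hkp : k ≤ p := by omega
  have hcle : c ≤ (p + 3) * c := by nlinarith [(Nat.cast_nonneg p : (0 : ℝ) ≤ p)]
  have hs : ∀ i ∈ Finset.Ico k K.n, KnotsSeparated p K.ξ k (i - k) i := fun i hi =>
    K.separated (by omega) (Finset.mem_Ico.1 hi).2
  have hH : ∀ i ∈ Finset.Ico k K.n, K.ξ (i - k) < K.ξ (i + p + 1) := fun i hi =>
    (K.mono (by omega : i - k ≤ i)).trans_lt (hs i hi 0 (Nat.zero_le _) i (by omega) le_rfl)
  have hb : ∀ i ∈ Finset.Ico k K.n, ∀ t ∈ Ioo (K.ξ (i - k)) (K.ξ (i + p + 1)),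
      |dualKernel p K.ξ g k i t| ≤ c / (K.ξ (i + p + 1) - K.ξ (i - k)) := by
    intro i hi t ht
    have hi' := Finset.mem_Ico.1 hi
    refine (abs_dualKernel_le hg hM0 hM hL K.mono hR hkp hi'.1 (hH i hi) ?_ ht).trans
      (div_le_div_of_nonneg_right hkc (by linarith [hH i hi]))
    intro k' hk' i' h1 h2
    have h3 := hs i hi k' hk' i' h1 h2
    have h4 := hK.abs.extend (abs_nonneg θ) h3 (i' - (i - k)) (i - i' + k') (by omega)
    rw [show i' + (p + 1 - k') + (i - i' + k') = i + p + 1 by omega,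
      show i' - (i' - (i - k)) = i - k by omega] at h4
    refine h4.trans (mul_le_mul_of_nonneg_right ?_ (by linarith))
    exact pow_le_pow_right₀ (by linarith [abs_nonneg θ]) (by omega)
  have hzero : ∀ i ∈ Finset.Ico k K.n, ∀ t, (∀ j, K.ξ j ≠ t) →
      t ∉ Ioo (K.ξ (i - k)) (K.ξ (i + p + 1)) → dualKernel p K.ξ g k i t = 0 := by
    intro i hi t ht hn
    have hi' := Finset.mem_Ico.1 hi
    rcases lt_or_gt_of_ne (ht (i - k)) with h | h
    · rcases lt_or_gt_of_ne (ht (i + p + 1)) with h' | h'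
      · exact dualKernel_eq_zero_right hg K.mono hkp hi'.1 (hs i hi) h'
      · exact absurd ⟨h, h'⟩ hn
    · exact dualKernel_eq_zero_left hg K.mono hi'.1 (hs i hi) h
  have hBk : ∀ i ∈ Finset.Ico k K.n, IntegrableOn (dualKernel p K.ξ g k i) (Ioo 0 1) := by
    intro i hi
    have := integrableOn_dualKernel_mul K hg (k := k) (by omega) (Finset.mem_Ico.1 hi).1
      (Finset.mem_Ico.1 hi).2 (u := fun _ => 1) (integrableOn_const (by simp))
    simpa using this
  constructor
  · intro x
    have hint : ∀ i ∈ Finset.Ico k K.n,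
        ∫ y in Ioo (0 : ℝ) 1, |dualKernel p K.ξ g k i y| ≤ c := by
      intro i hi
      set a := K.ξ (i - k)
      set b := K.ξ (i + p + 1)
      have hab : a < b := hH i hi
      have h1 : ∫ y in Ioo (0 : ℝ) 1, |dualKernel p K.ξ g k i y| ≤
          ∫ y in Ioo (0 : ℝ) 1, (Ioo a b).indicator (fun _ => c / (b - a)) y := by
        refine integral_mono_ae (hBk i hi).abs ?_ ?_
        · exact (integrableOn_const (by simp)).indicator measurableSet_Ioo
        · filter_upwards [ae_restrict_of_ae (ae_nonKnots K)] with t ht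
          by_cases hm : t ∈ Ioo a b
          · rw [indicator_of_mem hm]; exact hb i hi t hm
          · rw [indicator_of_notMem hm, hzero i hi t ht hm, abs_zero]
      refine h1.trans ?_
      rw [setIntegral_indicator measurableSet_Ioo, setIntegral_const, smul_eq_mul]
      have h2 : volume.real (Ioo 0 1 ∩ Ioo a b) ≤ b - a := by
        refine (measureReal_mono inter_subset_right (by simp)).trans ?_
        rw [Real.volume_real_Ioo_of_le hab.le]
      have hba : 0 < b - a := by linarith
      calc _ ≤ (b - a) * (c / (b - a)) := mul_le_mul_of_nonneg_right h2 (by positivity)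
        _ = c := by field_simp
    have h1 : ∫ y in Ioo (0 : ℝ) 1, |uniKernel K g k x y| ≤
        ∫ y in Ioo (0 : ℝ) 1, ∑ i ∈ Finset.Ico k K.n,
          bspline K.ξ (p - k) i x * |dualKernel p K.ξ g k i y| := by
      refine integral_mono_of_nonneg (Eventually.of_forall fun _ => abs_nonneg _) ?_
        (Eventually.of_forall fun y => ?_)
      · exact integrable_finsetSum _ fun i hi => (hBk i hi).abs.const_mul _
      · refine (Finset.abs_sum_le_sum_abs _ _).trans (le_of_eq ?_)
        refine Finset.sum_congr rfl fun i _ => ?_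
        rw [abs_mul, abs_of_nonneg (bspline_nonneg K.mono _ _ _)]
    refine h1.trans ?_
    rw [integral_finsetSum _ fun i hi => (hBk i hi).abs.const_mul _]
    simp only [integral_const_mul]
    calc _ ≤ ∑ i ∈ Finset.Ico k K.n, bspline K.ξ (p - k) i x * c :=
          Finset.sum_le_sum fun i hi =>
            mul_le_mul_of_nonneg_left (hint i hi) (bspline_nonneg K.mono _ _ _)
      _ = (∑ i ∈ Finset.Ico k K.n, bspline K.ξ (p - k) i x) * c := by rw [Finset.sum_mul]
      _ ≤ 1 * c := by
          refine mul_le_mul_of_nonneg_right ?_ hc0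
          refine le_trans (Finset.sum_le_sum_of_subset_of_nonneg ?_ fun i _ _ =>
            bspline_nonneg K.mono _ _ _) (sum_bspline_le_one K.mono (p - k) K.n x)
          rw [Finset.range_eq_Ico]
          exact Finset.Ico_subset_Ico_left (Nat.zero_le k)
      _ ≤ _ := by linarith
  · filter_upwards [ae_nonKnots K] with y hy
    classical
    have hBx : ∀ i, IntegrableOn (fun x => bspline K.ξ (p - k) i x) (Ioo 0 1) := fun i => by
      simpa using integrableOn_bspline_mul K.mono (p - k) i (F := fun _ => 1) (s := Ioo 0 1)
        (integrableOn_const (by simp))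
    have hterm : ∀ i ∈ Finset.Ico k K.n,
        (∫ x in Ioo (0 : ℝ) 1, bspline K.ξ (p - k) i x) * |dualKernel p K.ξ g k i y| ≤
        if y ∈ Ioo (K.ξ (i - k)) (K.ξ (i + p + 1)) then c else 0 := by
      intro i hi
      split_ifs with hm
      · have h1 := integral_bspline K.mono K.mem_Icc (p - k) i
        have h0 : 0 ≤ ∫ x in Ioo (0 : ℝ) 1, bspline K.ξ (p - k) i x :=
          integral_nonneg fun x => bspline_nonneg K.mono _ _ _
        have h2 : K.ξ (i + (p - k) + 1) ≤ K.ξ (i + p + 1) := K.mono (by omega)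
        have h3 : K.ξ (i - k) ≤ K.ξ i := K.mono (by omega)
        have h4 := hH i hi
        have h5 : ∫ x in Ioo (0 : ℝ) 1, bspline K.ξ (p - k) i x ≤
            K.ξ (i + p + 1) - K.ξ (i - k) := by
          have : 0 ≤ ((p - k : ℕ) : ℝ) * ∫ x in Ioo (0 : ℝ) 1, bspline K.ξ (p - k) i x := by
            positivity
          linarith
        have h6 : 0 < K.ξ (i + p + 1) - K.ξ (i - k) := by linarith
        calc _ ≤ (K.ξ (i + p + 1) - K.ξ (i - k)) * (c / (K.ξ (i + p + 1) - K.ξ (i - k))) :=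
              mul_le_mul h5 (hb i hi y hm) (abs_nonneg _) h6.le
          _ = c := by field_simp
      · rw [hzero i hi y hy hm]; simp
    have h1 : ∫ x in Ioo (0 : ℝ) 1, |uniKernel K g k x y| ≤
        ∫ x in Ioo (0 : ℝ) 1, ∑ i ∈ Finset.Ico k K.n,
          bspline K.ξ (p - k) i x * |dualKernel p K.ξ g k i y| := by
      refine integral_mono_of_nonneg (Eventually.of_forall fun _ => abs_nonneg _) ?_
        (Eventually.of_forall fun x => ?_)
      · exact integrable_finsetSum _ fun i _ => (hBx i).mul_const _
      · refine (Finset.abs_sum_le_sum_abs _ _).trans (le_of_eq ?_)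
        refine Finset.sum_congr rfl fun i _ => ?_
        rw [abs_mul, abs_of_nonneg (bspline_nonneg K.mono _ _ _)]
    refine h1.trans ?_
    rw [integral_finsetSum _ fun i _ => (hBx i).mul_const _]
    simp only [integral_mul_const]
    refine (Finset.sum_le_sum hterm).trans ?_
    rw [← Finset.sum_filter, Finset.sum_const, nsmul_eq_mul]
    refine mul_le_mul_of_nonneg_right ?_ hc0
    have hcard : ((Finset.Ico k K.n).filter
        (fun i => y ∈ Ioo (K.ξ (i - k)) (K.ξ (i + p + 1)))).card ≤ p + 3 := by
      set s := (Finset.Ico k K.n).filter (fun i => y ∈ Ioo (K.ξ (i - k)) (K.ξ (i + p + 1)))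
        with hsdef
      rcases s.eq_empty_or_nonempty with he | hne
      · rw [he]; simp
      · have hmin := Finset.min'_mem s hne
        set m := s.min' hne
        have hsub : s ⊆ Finset.Ico m (m + (p + 3)) := by
          intro i hi
          have hmi : m ≤ i := Finset.min'_le s i hi
          rw [Finset.mem_Ico]
          refine ⟨hmi, ?_⟩
          by_contra hcon
          have h2 := (Finset.mem_filter.1 hi).2.1
          have h3 := (Finset.mem_filter.1 hmin).2.2
          have h4 : K.ξ (m + p + 1) ≤ K.ξ (i - k) := K.mono (by omega)
          linarith
        refine (Finset.card_le_card hsub).trans ?_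
        rw [Nat.card_Ico]; omega
    exact_mod_cast hcard

end QuasiUniform

end

section

open scoped Convolution ContDiff

/-! ### Approximation by smooth functions with compact support in the unit interval -/

/-- Smooth functions supported in a compact subinterval of the open unit interval. -/
structure IsTestOne (δ : ℝ) (ψ : ℝ → ℝ) : Prop where
  pos : 0 < δ
  le : δ ≤ 1 / 4
  smooth : ContDiff ℝ ∞ ψ
  supp : tsupport ψ ⊆ Icc δ (1 - δ)

theorem IsTestOne.eq_zero {δ : ℝ} {ψ : ℝ → ℝ} (h : IsTestOne δ ψ) {x : ℝ}
    (hx : x ∉ Icc δ (1 - δ)) : ψ x = 0 :=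
  image_eq_zero_of_notMem_tsupport fun hx' => hx (h.supp hx')

theorem exists_isTestOne_tendsto {c : ℝ → ℝ} (hc : Measurable c) {M : ℝ} (hM : ∀ x, |c x| ≤ M) :
    ∃ (δ : ℕ → ℝ) (ψ : ℕ → ℝ → ℝ), (∀ n, IsTestOne (δ n) (ψ n)) ∧ (∀ n x, |ψ n x| ≤ M) ∧
      ∀ᵐ x, x ∈ Ioo (0 : ℝ) 1 → Tendsto (fun n => ψ n x) atTop (𝓝 (c x)) := by
  have hM0 : 0 ≤ M := (abs_nonneg _).trans (hM 0)
  have hloc : LocallyIntegrable c := by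
    intro x
    refine ⟨Metric.ball x 1, Metric.ball_mem_nhds x one_pos, ?_⟩
    exact Measure.integrableOn_of_bounded (M := M) measure_ball_lt_top.ne
      hc.aestronglyMeasurable (Eventually.of_forall fun t => hM t)
  set δ : ℕ → ℝ := fun n => 1 / ((n : ℝ) + 8) with hδ
  have hδ0 : ∀ n, 0 < δ n := fun n => by simp only [hδ]; positivity
  have hδ1 : ∀ n, δ n ≤ 1 / 8 := fun n => by
    simp only [hδ]
    exact one_div_le_one_div_of_le (by norm_num) (by linarith [(Nat.cast_nonneg n : (0 : ℝ) ≤ n)])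
  have hδlim : Tendsto δ atTop (𝓝 0) := by
    have := (tendsto_one_div_add_atTop_nhds_zero_nat (𝕜 := ℝ)).comp (tendsto_add_atTop_nat 7)
    refine this.congr fun n => ?_
    simp only [hδ, Function.comp]; push_cast; ring_nf
  let φ : ℕ → ContDiffBump (0 : ℝ) := fun n =>
    ⟨δ n / 2, δ n, half_pos (hδ0 n), half_lt_self (hδ0 n)⟩
  let χ : ℕ → ContDiffBump (1 / 2 : ℝ) := fun n =>
    ⟨1 / 2 - 2 * δ n, 1 / 2 - δ n, by linarith [hδ1 n], by linarith [hδ0 n]⟩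
  set m : ℕ → ℝ → ℝ := fun n => (φ n).normed volume ⋆[ContinuousLinearMap.lsmul ℝ ℝ, volume] c
    with hm
  have hmsmooth : ∀ n, ContDiff ℝ ∞ (m n) := fun n =>
    (φ n).hasCompactSupport_normed.contDiff_convolution_left _ (φ n).contDiff_normed hloc
  have hmbound : ∀ n x, |m n x| ≤ M := by
    intro n x
    rw [← Real.norm_eq_abs, hm]
    simp only [convolution_def, ContinuousLinearMap.lsmul_apply, smul_eq_mul]
    have h1 : Integrable (fun t => (φ n).normed volume t * M) :=
      (φ n).integrable_normed.mul_const M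
    refine (norm_integral_le_of_norm_le h1 (Eventually.of_forall fun t => ?_)).trans ?_
    · rw [norm_mul, Real.norm_eq_abs, Real.norm_eq_abs, abs_of_nonneg ((φ n).nonneg_normed t)]
      exact mul_le_mul_of_nonneg_left (hM _) ((φ n).nonneg_normed t)
    · rw [integral_mul_const, (φ n).integral_normed, one_mul]
  refine ⟨δ, fun n x => χ n x * m n x, fun n => ⟨hδ0 n, (hδ1 n).trans (by norm_num),
    ((χ n).contDiff.mul (hmsmooth n)), ?_⟩, fun n x => ?_, ?_⟩
  · refine (tsupport_mul_subset_left).trans ?_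
    rw [(χ n).tsupport_eq, Real.closedBall_eq_Icc]
    exact Icc_subset_Icc (by simp only [χ]; linarith) (by simp only [χ]; linarith)
  · rw [abs_mul, abs_of_nonneg (χ n).nonneg]
    exact (mul_le_of_le_one_left (abs_nonneg _) (χ n).le_one).trans (hmbound n x)
  · have hae := ContDiffBump.ae_convolution_tendsto_right_of_locallyIntegrable (φ := φ) (K := 2)
      (l := atTop) (μ := volume) (g := c) (by exact hδlim)
      (Eventually.of_forall fun n => by simp only [φ]; linarith) hloc
    filter_upwards [hae] with x hx hx01
    have h1 : ∀ᶠ n in atTop, χ n x = 1 := by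
      have hpos : 0 < min x (1 - x) / 2 := by
        have := lt_min hx01.1 (sub_pos.2 hx01.2)
        linarith
      filter_upwards [hδlim.eventually (gt_mem_nhds hpos)] with n hn
      refine (χ n).one_of_mem_closedBall ?_
      rw [Real.closedBall_eq_Icc]
      simp only [χ]
      constructor
      · linarith [min_le_left x (1 - x)]
      · linarith [min_le_right x (1 - x)]
    refine hx.congr' ?_
    filter_upwards [h1] with n hn
    rw [hn, one_mul]

/-- The primitive of a test function with mean zero is a test function. -/
theorem isTestOne_prim {δ : ℝ} {β : ℝ → ℝ} (h : IsTestOne δ β)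
    (h0 : ∫ t in (0 : ℝ)..1, β t = 0) : IsTestOne δ (prim β) := by
  have hcont : Continuous β := h.smooth.continuous
  have hderiv : ∀ x, HasDerivAt (prim β) (β x) x := fun x =>
    intervalIntegral.integral_hasDerivAt_right (hcont.intervalIntegrable _ _)
      (hcont.stronglyMeasurableAtFilter volume _) hcont.continuousAt
  have hd : deriv (prim β) = β := funext fun x => (hderiv x).deriv
  refine ⟨h.pos, h.le, ?_, ?_⟩
  · rw [contDiff_infty_iff_deriv, hd]
    exact ⟨fun x => (hderiv x).differentiableAt, h.smooth⟩
  · refine closure_minimal (fun x hx => ?_) isClosed_Icc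
    by_contra hx'
    refine hx ?_
    have hz : ∀ t, t < δ ∨ 1 - δ < t → β t = 0 := fun t ht => h.eq_zero fun ht' => by
      rcases ht with ht | ht
      · linarith [ht'.1]
      · linarith [ht'.2]
    rw [mem_Icc, not_and_or, not_le, not_le] at hx'
    have hpos := h.pos
    rcases hx' with hx' | hx'
    · rw [prim, intervalIntegral.integral_congr (g := fun _ => 0), intervalIntegral.integral_zero]
      intro t ht
      refine hz t (Or.inl ?_)
      exact lt_of_le_of_lt ht.2 (max_lt hpos hx')
    · have e := intervalIntegral.integral_add_adjacent_intervals
        (hcont.intervalIntegrable (μ := volume) 0 1) (hcont.intervalIntegrable (μ := volume) 1 x)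
      rw [prim, ← e, h0, zero_add, intervalIntegral.integral_congr (g := fun _ => 0),
        intervalIntegral.integral_zero]
      intro t ht
      refine hz t (Or.inr (lt_of_lt_of_le (lt_min (by linarith) hx') ht.1))

theorem exists_isTestOne_tendsto_of_AC {τ α : ℝ → ℝ} (hτ : AC τ) (h0 : τ 0 = 0) (h1 : τ 1 = 0)
    (hα : Measurable α) {M : ℝ} (hM : ∀ x, |α x| ≤ M)
    (hd : ∀ᵐ t ∂(volume.restrict (Ioo (0 : ℝ) 1)), deriv τ t = α t) :
    ∃ (δ : ℕ → ℝ) (ψ : ℕ → ℝ → ℝ) (B : ℝ), (∀ n, IsTestOne (δ n) (ψ n)) ∧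
      (∀ n, ∀ x ∈ Ioo (0 : ℝ) 1, |ψ n x| ≤ B) ∧ (∀ n x, |deriv (ψ n) x| ≤ B) ∧
      (∀ᵐ x, x ∈ Ioo (0 : ℝ) 1 → Tendsto (fun n => ψ n x) atTop (𝓝 (τ x))) ∧
      ∀ᵐ x, x ∈ Ioo (0 : ℝ) 1 → Tendsto (fun n => deriv (ψ n) x) atTop (𝓝 (α x)) := by
  obtain ⟨δ, a, ha, hab, hat⟩ := exists_isTestOne_tendsto hα hM
  have hM0 : 0 ≤ M := (abs_nonneg _).trans (hM 0)
  let η₀ : ContDiffBump (1 / 2 : ℝ) := ⟨1 / 8, 1 / 4, by norm_num, by norm_num⟩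
  set η : ℝ → ℝ := η₀.normed volume with hη
  have hηs : ContDiff ℝ ∞ η := η₀.contDiff_normed
  have hηsupp : tsupport η ⊆ Icc (1 / 4) (1 - 1 / 4) := by
    rw [hη, η₀.tsupport_normed_eq, Real.closedBall_eq_Icc]
    exact Icc_subset_Icc (by simp only [η₀]; norm_num) (by simp only [η₀]; norm_num)
  have hη1 : ∫ t in (0 : ℝ)..1, η t = 1 := by
    rw [intervalIntegral.integral_of_le zero_le_one, setIntegral_eq_integral_of_forall_compl_eq_zero,
      η₀.integral_normed]
    intro x hx
    refine image_eq_zero_of_notMem_tsupport fun hx' => hx ?_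
    have := hηsupp hx'
    constructor <;> linarith [this.1, this.2]
  obtain ⟨Bη, hBη⟩ := η₀.hasCompactSupport_normed.exists_bound_of_continuous
    (hηs.continuous : Continuous (η₀.normed volume))
  have hBη0 : 0 ≤ Bη := (norm_nonneg _).trans (hBη 0)
  set I : ℕ → ℝ := fun n => ∫ t in (0 : ℝ)..1, a n t with hI
  have hIb : ∀ n, |I n| ≤ M := fun n => by
    have := intervalIntegral.norm_integral_le_of_norm_le_const (a := 0) (b := 1) (C := M)
      (f := a n) fun x _ => hab n x
    simpa using this
  set β : ℕ → ℝ → ℝ := fun n t => a n t - I n * η t with hβ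
  have hβtest : ∀ n, IsTestOne (δ n) (β n) := fun n =>
    ⟨(ha n).pos, (ha n).le, (ha n).smooth.sub (contDiff_const.mul hηs), by
      refine closure_minimal (fun x hx => ?_) isClosed_Icc
      by_contra hx'
      refine hx ?_
      have e1 := (ha n).eq_zero hx'
      have e2 : η x = 0 := image_eq_zero_of_notMem_tsupport fun h => hx' (by
        have := hηsupp h
        have := (ha n).le
        constructor <;> linarith [this, (hηsupp h).1, (hηsupp h).2])
      simp only [hβ, e1, e2, mul_zero, sub_zero]⟩
  have hii : ∀ n (x y : ℝ), IntervalIntegrable (a n) volume x y := fun n x y =>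
    (ha n).smooth.continuous.intervalIntegrable _ _
  have hiη : ∀ x y : ℝ, IntervalIntegrable η volume x y := fun x y =>
    hηs.continuous.intervalIntegrable _ _
  have hβ0 : ∀ n, ∫ t in (0 : ℝ)..1, β n t = 0 := fun n => by
    simp only [hβ]
    rw [intervalIntegral.integral_sub (hii n _ _) ((hiη _ _).const_mul _),
      intervalIntegral.integral_const_mul, hη1, mul_one, sub_self]
  have hβb : ∀ n x, |β n x| ≤ M + M * Bη := fun n x => by
    refine (abs_sub _ _).trans (add_le_add (hab n x) ?_)
    rw [abs_mul]
    exact mul_le_mul (hIb n) (hBη x) (abs_nonneg _) hM0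
  have hderiv : ∀ n, deriv (prim (β n)) = β n := fun n => funext fun x =>
    (intervalIntegral.integral_hasDerivAt_right ((hβtest n).smooth.continuous.intervalIntegrable _ _)
      ((hβtest n).smooth.continuous.stronglyMeasurableAtFilter volume _)
      (hβtest n).smooth.continuous.continuousAt).deriv
  -- convergence of the primitives of the approximations
  have hlim : ∀ x ∈ Icc (0 : ℝ) 1,
      Tendsto (fun n => ∫ t in (0 : ℝ)..x, a n t) atTop (𝓝 (τ x)) := by
    intro x hx
    have e : τ x = ∫ t in (0 : ℝ)..x, α t := by
      have e1 := hτ.setIntegral_deriv le_rfl hx.1 hx.2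
      rw [h0, sub_zero] at e1
      rw [← e1, ← setIntegral_Ioo_eq_intervalIntegral _ hx.1]
      refine setIntegral_congr_ae measurableSet_Ioo ?_
      rw [ae_restrict_iff' measurableSet_Ioo] at hd
      filter_upwards [hd] with t ht ht'
      exact ht ⟨ht'.1, ht'.2.trans_le hx.2⟩
    rw [e]
    refine intervalIntegral.tendsto_integral_filter_of_dominated_convergence (fun _ => M)
      (Eventually.of_forall fun n => (ha n).smooth.continuous.aestronglyMeasurable)
      (Eventually.of_forall fun n => Eventually.of_forall fun t _ => hab n t)
      intervalIntegrable_const ?_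
    have hne : ∀ᵐ t : ℝ, t ≠ 1 := by simp [ae_iff]
    filter_upwards [hat, hne] with t ht ht1 ht'
    rw [uIoc_of_le hx.1] at ht'
    exact ht ⟨ht'.1, lt_of_le_of_ne (ht'.2.trans hx.2) ht1⟩
  have hIlim : Tendsto I atTop (𝓝 0) := by
    have := hlim 1 ⟨zero_le_one, le_rfl⟩
    rwa [h1] at this
  refine ⟨δ, fun n => prim (β n), M + M * Bη, fun n => isTestOne_prim (hβtest n) (hβ0 n), ?_, ?_,
    Eventually.of_forall fun x hx => ?_, ?_⟩
  · intro n x hx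
    have := intervalIntegral.norm_integral_le_of_norm_le_const (a := 0) (b := x)
      (C := M + M * Bη) (f := β n) fun t _ => hβb n t
    rw [Real.norm_eq_abs, sub_zero, abs_of_pos hx.1] at this
    exact this.trans (mul_le_of_le_one_right (by positivity) hx.2.le)
  · intro n x
    rw [hderiv]; exact hβb n x
  · have e : ∀ n, prim (β n) x = (∫ t in (0 : ℝ)..x, a n t) - I n * ∫ t in (0 : ℝ)..x, η t := by
      intro n
      simp only [prim, hβ]
      rw [intervalIntegral.integral_sub (hii n _ _) ((hiη _ _).const_mul _),
        intervalIntegral.integral_const_mul]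
    simp only [e]
    have := (hlim x (Ioo_subset_Icc_self hx)).sub (hIlim.mul_const (∫ t in (0 : ℝ)..x, η t))
    simpa using this
  · filter_upwards [hat] with x hx hx01
    simp only [hderiv]
    have := (hx hx01).sub (hIlim.mul_const (η x))
    simpa using this

/-! ### Weak divergence of vector fields -/

/-- `w` is the weak divergence of the vector field `s` on `D`. -/
def IsWeakDivRow (D : Set E) (s : E → Fin 3 → ℝ) (w : E → ℝ) : Prop :=
  ∀ ψ : E → ℝ, IsTest D ψ → ∫ x in D, ∑ l, s x l * pd l ψ x = -∫ x in D, w x * ψ x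

theorem contDiff_tensor {t : Fin 3 → ℝ → ℝ} {n : WithTop ℕ∞} (h : ∀ l, ContDiff ℝ n (t l)) :
    ContDiff ℝ n (fun x : E => ∏ l, t l (x l)) :=
  contDiff_prod fun l _ => (h l).comp (contDiff_apply ℝ ℝ l)

theorem pd_tensor {t : Fin 3 → ℝ → ℝ} (h : ∀ l, Differentiable ℝ (t l)) (l : Fin 3) (x : E) :
    pd l (fun x : E => ∏ m, t m (x m)) x =
      deriv (t l) (x l) * ∏ m ∈ Finset.univ.erase l, t m (x m) := by
  have h1 : ∀ m ∈ (Finset.univ : Finset (Fin 3)), HasFDerivAt (fun x : E => t m (x m))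
      ((deriv (t m) (x m)) • (ContinuousLinearMap.proj m : E →L[ℝ] ℝ)) x := by
    intro m _
    exact ((h m (x m)).hasDerivAt).comp_hasFDerivAt x
      (ContinuousLinearMap.proj (R := ℝ) (φ := fun _ : Fin 3 => ℝ) m).hasFDerivAt
  have h2 := HasFDerivAt.finsetProd h1
  rw [pd, h2.fderiv, sum_apply, Finset.sum_eq_single l]
  · simp [mul_comm]
  · intro m _ hm
    simp [hm]
  · simp

theorem isTest_tensor {t : Fin 3 → ℝ → ℝ} {δ : Fin 3 → ℝ} (h : ∀ l, IsTestOne (δ l) (t l)) :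
    IsTest cube (fun x => ∏ l, t l (x l)) := by
  have hsub : tsupport (fun x : E => ∏ l, t l (x l)) ⊆
      Set.pi univ fun l => Icc (δ l) (1 - δ l) := by
    refine closure_minimal (fun x hx => ?_) (isClosed_set_pi fun l _ => isClosed_Icc)
    intro l _
    by_contra hl
    exact hx (Finset.prod_eq_zero (Finset.mem_univ l) ((h l).eq_zero hl))
  refine ⟨contDiff_tensor fun l => (h l).smooth, ?_, hsub.trans ?_⟩
  · exact (isCompact_univ_pi fun l => isCompact_Icc).of_isClosed_subset (isClosed_tsupport _) hsub
  · intro x hx l _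
    have := hx l (mem_univ l)
    have h2 := (h l).pos
    constructor <;> linarith [this.1, this.2]

theorem measurableSet_cube : MeasurableSet cube :=
  MeasurableSet.univ_pi fun _ => measurableSet_Ioo

theorem ae_cube_eval {P : Fin 3 → ℝ → Prop} (h : ∀ l, ∀ᵐ t, t ∈ Ioo (0 : ℝ) 1 → P l t) :
    ∀ᵐ x ∂(volume.restrict cube), ∀ l, P l (x l) := by
  refine (ae_restrict_iff' measurableSet_cube).2 ?_
  have : ∀ᵐ x : E, ∀ l, x l ∈ Ioo (0 : ℝ) 1 → P l (x l) := ae_all_iff.2 fun l =>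
    (Measure.quasiMeasurePreserving_eval (μ := fun _ : Fin 3 => (volume : Measure ℝ)) l).ae (h l)
  filter_upwards [this] with x hx hxc l
  exact hx l (hxc l (mem_univ l))

/-- The weak divergence may be tested with tensor products of functions that are merely bounded in
the directions in which the vector field vanishes, and absolutely continuous in the others. -/
theorem IsWeakDivRow.tensor {s : E → Fin 3 → ℝ} {w : E → ℝ} (hsw : IsWeakDivRow cube s w)
    (hs : ∀ l, IntegrableOn (fun x => s x l) cube) (hw : IntegrableOn w cube)
    {τ α : Fin 3 → ℝ → ℝ} {M : ℝ} (hτ : ∀ l, Measurable (τ l)) (hτM : ∀ l x, |τ l x| ≤ M)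
    (hα : ∀ l, Measurable (α l)) (hαM : ∀ l x, |α l x| ≤ M)
    (h : ∀ l, (∀ x, s x l = 0) ∨ (AC (τ l) ∧ τ l 0 = 0 ∧ τ l 1 = 0 ∧
      ∀ᵐ t ∂(volume.restrict (Ioo (0 : ℝ) 1)), deriv (τ l) t = α l t)) :
    ∫ x in cube, ∑ l, s x l * (α l (x l) * ∏ m ∈ Finset.univ.erase l, τ m (x m)) =
      -∫ x in cube, w x * ∏ m, τ m (x m) := by
  have happ : ∀ l, ∃ (δ : ℕ → ℝ) (ψ : ℕ → ℝ → ℝ) (B : ℝ), (∀ n, IsTestOne (δ n) (ψ n)) ∧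
      (∀ n, ∀ x ∈ Ioo (0 : ℝ) 1, |ψ n x| ≤ B) ∧
      (∀ᵐ x, x ∈ Ioo (0 : ℝ) 1 → Tendsto (fun n => ψ n x) atTop (𝓝 (τ l x))) ∧
      ((∀ x, s x l = 0) ∨ ((∀ n x, |deriv (ψ n) x| ≤ B) ∧
      ∀ᵐ x, x ∈ Ioo (0 : ℝ) 1 → Tendsto (fun n => deriv (ψ n) x) atTop (𝓝 (α l x)))) := by
    intro l
    rcases h l with h | ⟨h1, h2, h3, h4⟩
    · obtain ⟨δ, ψ, h1, h2, h3⟩ := exists_isTestOne_tendsto (hτ l) (hτM l)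
      exact ⟨δ, ψ, M, h1, fun n x _ => h2 n x, h3, Or.inl h⟩
    · obtain ⟨δ, ψ, B, h1, h2, h3, h4, h5⟩ :=
        exists_isTestOne_tendsto_of_AC h1 h2 h3 (hα l) (hαM l) h4
      exact ⟨δ, ψ, B, h1, h2, h4, Or.inr ⟨h3, h5⟩⟩
  choose δ ψ B hψ hB hlim hd using happ
  have hcm := measurableSet_cube
  have hB0 : ∀ l, 0 ≤ B l := fun l => (abs_nonneg _).trans (hB l 0 (1 / 2) (by norm_num))
  have hcube : ∀ᵐ x ∂(volume.restrict cube), ∀ l, x l ∈ Ioo (0 : ℝ) 1 :=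
    (ae_restrict_iff' hcm).2 (Eventually.of_forall fun x hx l => hx l (mem_univ l))
  have hlim' := ae_cube_eval hlim
  have hdiff : ∀ n l, Differentiable ℝ (ψ l n) := fun n l =>
    (hψ l n).smooth.differentiable (by simp)
  have hcψ : ∀ n l, Measurable (ψ l n) := fun n l => (hψ l n).smooth.continuous.measurable
  have key := fun n => hsw _ (isTest_tensor (t := fun l => ψ l n) (δ := fun l => δ l n)
    fun l => hψ l n)
  simp only [pd_tensor (hdiff _)] at key
  have hmeasprod : ∀ n (S : Finset (Fin 3)), Measurable fun x : E => ∏ m ∈ S, ψ m n (x m) :=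
    fun n S => Finset.measurable_prod _ fun m _ => (hcψ n m).comp (measurable_pi_apply m)
  have hprodB : ∀ n (S : Finset (Fin 3)), ∀ x : E, (∀ l, x l ∈ Ioo (0 : ℝ) 1) →
      |∏ m ∈ S, ψ m n (x m)| ≤ ∏ m ∈ S, B m := by
    intro n S x hx
    rw [Finset.abs_prod]
    exact Finset.prod_le_prod (fun _ _ => abs_nonneg _) fun m _ => hB m n _ (hx m)
  have lim1 : Tendsto (fun n => ∫ x in cube, ∑ l, s x l *
      (deriv (ψ l n) (x l) * ∏ m ∈ Finset.univ.erase l, ψ m n (x m))) atTop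
      (𝓝 (∫ x in cube, ∑ l, s x l * (α l (x l) * ∏ m ∈ Finset.univ.erase l, τ m (x m)))) := by
    refine tendsto_integral_of_dominated_convergence
      (fun x => ∑ l, |s x l| * (B l * ∏ m ∈ Finset.univ.erase l, B m)) ?_ ?_ ?_ ?_
    · intro n
      refine Finset.aestronglyMeasurable_fun_sum _ fun l _ => ?_
      refine (hs l).aestronglyMeasurable.mul ?_
      exact (((measurable_deriv _).comp (measurable_pi_apply l)).mul
        (hmeasprod n _)).aestronglyMeasurable
    · exact integrable_finsetSum _ fun l _ => (hs l).abs.mul_const _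
    · intro n
      filter_upwards [hcube] with x hx
      refine (norm_sum_le _ _).trans (Finset.sum_le_sum fun l _ => ?_)
      rw [norm_mul, norm_mul, Real.norm_eq_abs, Real.norm_eq_abs, Real.norm_eq_abs]
      rcases hd l with h0 | ⟨h1, -⟩
      · simp [h0 x]
      · refine mul_le_mul_of_nonneg_left ?_ (abs_nonneg _)
        exact mul_le_mul (h1 n _) (hprodB n _ x hx) (abs_nonneg _) (hB0 l)
    · have hd' : ∀ᵐ x ∂(volume.restrict cube), ∀ l, (∀ x, s x l = 0) ∨
          Tendsto (fun n => deriv (ψ l n) (x l)) atTop (𝓝 (α l (x l))) := by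
        refine ae_cube_eval (P := fun l t => (∀ x, s x l = 0) ∨
          Tendsto (fun n => deriv (ψ l n) t) atTop (𝓝 (α l t))) fun l => ?_
        rcases hd l with h0 | ⟨-, h1⟩
        · exact Eventually.of_forall fun t _ => Or.inl h0
        · filter_upwards [h1] with t ht ht'
          exact Or.inr (ht ht')
      filter_upwards [hlim', hd'] with x h1 h2
      refine tendsto_finsetSum _ fun l _ => ?_
      rcases h2 l with h0 | h3
      · simp [h0 x]
      · exact (h3.mul (tendsto_finsetProd _ fun m _ => h1 m)).const_mul _
  have lim2 : Tendsto (fun n => -∫ x in cube, w x * ∏ m, ψ m n (x m)) atTop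
      (𝓝 (-∫ x in cube, w x * ∏ m, τ m (x m))) := by
    refine (tendsto_integral_of_dominated_convergence (fun x => |w x| * ∏ m, B m) ?_ ?_ ?_ ?_).neg
    · intro n
      exact hw.aestronglyMeasurable.mul (hmeasprod n _).aestronglyMeasurable
    · exact hw.abs.mul_const _
    · intro n
      filter_upwards [hcube] with x hx
      rw [norm_mul, Real.norm_eq_abs, Real.norm_eq_abs]
      exact mul_le_mul_of_nonneg_left (hprodB n _ x hx) (abs_nonneg _)
    · filter_upwards [hlim'] with x h1
      exact (tendsto_finsetProd _ fun m _ => h1 m).const_mul _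
  exact tendsto_nhds_unique lim1 (lim2.congr fun n => (key n).symm)

end

section

/-! ### Integration over the unit cube -/

/-- Lebesgue measure on the open unit interval. -/
abbrev unitMeasure : Measure ℝ := volume.restrict (Ioo (0 : ℝ) 1)

theorem restrict_cube : (volume : Measure E).restrict cube = Measure.pi fun _ => unitMeasure :=
  Measure.restrict_pi_pi (μ := fun _ : Fin 3 => (volume : Measure ℝ)) fun _ => Ioo (0 : ℝ) 1

instance : IsProbabilityMeasure unitMeasure := ⟨by simp⟩

instance isProbabilityMeasure_cube : IsProbabilityMeasure ((volume : Measure E).restrict cube) := by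
  rw [restrict_cube]; infer_instance

theorem measurePreserving_vec : MeasurePreserving (fun q : ℝ × ℝ × ℝ => (![q.1, q.2.1, q.2.2] : E))
    (unitMeasure.prod (unitMeasure.prod unitMeasure)) (volume.restrict cube) := by
  have h1 := (measurePreserving_piFinSuccAbove (fun _ : Fin 3 => unitMeasure) 0).symm
  have h2 := (measurePreserving_finTwoArrow unitMeasure).symm
  have h3 := h1.comp ((MeasurePreserving.id unitMeasure).prod h2)
  rw [restrict_cube]
  have e : (fun q : ℝ × ℝ × ℝ => (![q.1, q.2.1, q.2.2] : E)) =
      (MeasurableEquiv.piFinSuccAbove (fun _ : Fin 3 => ℝ) 0).symm ∘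
        Prod.map id MeasurableEquiv.finTwoArrow.symm := by
    funext q i
    fin_cases i <;> rfl
  rw [e]
  exact h3

theorem integrable_vec {f : E → ℝ} (hf : IntegrableOn f cube) :
    Integrable (fun q : ℝ × ℝ × ℝ => f ![q.1, q.2.1, q.2.2])
      (unitMeasure.prod (unitMeasure.prod unitMeasure)) :=
  measurePreserving_vec.integrable_comp_of_integrable hf

theorem measurableEmbedding_vec :
    MeasurableEmbedding (fun q : ℝ × ℝ × ℝ => (![q.1, q.2.1, q.2.2] : E)) := by
  let e : E ≃ᵐ ℝ × ℝ × ℝ := (MeasurableEquiv.piFinSuccAbove (fun _ : Fin 3 => ℝ) 0).trans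
    ((MeasurableEquiv.refl ℝ).prodCongr MeasurableEquiv.finTwoArrow)
  convert e.symm.measurableEmbedding using 1
  funext q i
  fin_cases i <;> rfl

theorem integral_vec (f : E → ℝ) :
    ∫ x in cube, f x = ∫ q : ℝ × ℝ × ℝ, f ![q.1, q.2.1, q.2.2]
      ∂(unitMeasure.prod (unitMeasure.prod unitMeasure)) :=
  (measurePreserving_vec.integral_comp measurableEmbedding_vec f).symm

/-- A tensor product of kernel operators is the operator with the product kernel. -/
theorem tensorOp_eq_integral {P : Fin 3 → (ℝ → ℝ) → ℝ → ℝ} {κ : Fin 3 → ℝ → ℝ} {x : E}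
    (hκ : ∀ l, Measurable (κ l)) {M : ℝ} (hM : ∀ l y, |κ l y| ≤ M)
    (hP : ∀ l u, IntegrableOn u (Ioo 0 1) → P l u (x l) = ∫ y in Ioo (0 : ℝ) 1, κ l y * u y)
    {v : E → ℝ} (hv : IntegrableOn v cube) :
    tensorOp P v x = ∫ y in cube, (∏ l, κ l (y l)) * v y := by
  have hcongr : ∀ l u u', u =ᵐ[unitMeasure] u' → Integrable u' unitMeasure →
      P l u (x l) = ∫ y, κ l y * u' y ∂unitMeasure := by
    intro l u u' h hu'
    rw [hP l u (hu'.congr h.symm)]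
    refine integral_congr_ae ?_
    filter_upwards [h] with y hy
    rw [hy]
  have hb : ∀ l, ∀ᵐ y ∂unitMeasure, ‖κ l y‖ ≤ M := fun l => Eventually.of_forall (hM l)
  have h0 := integrable_vec hv
  set f : ℝ × ℝ × ℝ → ℝ := fun q => v ![q.1, q.2.1, q.2.2] with hf
  have h2 : Integrable (fun q : ℝ × ℝ × ℝ => κ 2 q.2.2 * f q)
      (unitMeasure.prod (unitMeasure.prod unitMeasure)) :=
    h0.bdd_mul (c := M) ((hκ 2).comp (measurable_snd.comp measurable_snd)).aestronglyMeasurable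
      (Eventually.of_forall fun q => hM 2 _)
  have h1 : Integrable (fun q : ℝ × ℝ × ℝ => κ 1 q.2.1 * (κ 2 q.2.2 * f q))
      (unitMeasure.prod (unitMeasure.prod unitMeasure)) :=
    h2.bdd_mul (c := M) ((hκ 1).comp (measurable_fst.comp measurable_snd)).aestronglyMeasurable
      (Eventually.of_forall fun q => hM 1 _)
  have h00 : Integrable (fun q : ℝ × ℝ × ℝ => κ 0 q.1 * (κ 1 q.2.1 * (κ 2 q.2.2 * f q)))
      (unitMeasure.prod (unitMeasure.prod unitMeasure)) :=
    h1.bdd_mul (c := M) ((hκ 0).comp measurable_fst).aestronglyMeasurable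
      (Eventually.of_forall fun q => hM 0 _)
  have step : (fun a => P 1 (fun b => P 2 (fun c => v ![a, b, c]) (x 2)) (x 1)) =ᵐ[unitMeasure]
      fun a => ∫ q : ℝ × ℝ, κ 1 q.1 * (κ 2 q.2 * f (a, q)) ∂(unitMeasure.prod unitMeasure) := by
    filter_upwards [h0.prod_right_ae, h1.prod_right_ae, h2.prod_right_ae] with a ha0 ha1 ha2
    rw [integral_prod _ ha1]
    simp only [integral_const_mul]
    refine hcongr 1 _ _ ?_ ha2.integral_prod_left
    filter_upwards [ha0.prod_right_ae] with b hb
    exact hP 2 _ hb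
  rw [tensorOp, hcongr 0 _ _ step h1.integral_prod_left, integral_vec]
  simp only [← integral_const_mul]
  rw [← integral_prod _ h00]
  refine integral_congr_ae (Eventually.of_forall fun q => ?_)
  simp only [hf, Fin.prod_univ_three]
  simp only [Matrix.cons_val]
  ring

/-! ### The tensor product projections as integral operators -/

variable {p r : Fin 3 → ℕ} (K : ∀ l, OpenKnots (p l) (r l)) (g : Fin 3 → ℝ → ℝ)

/-- The product of the univariate kernels. -/
def cubeKernel (k : Fin 3 → Fin 3) (x y : E) : ℝ :=
  ∏ l, uniKernel (K l) (g l) (k l) (x l) (y l)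

/-- The integral operator with the product kernel. -/
def kerProj (k : Fin 3 → Fin 3) (v : E → ℝ) (x : E) : ℝ :=
  ∫ y in cube, cubeKernel K g k x y * v y

variable {K g}

theorem drop_le {r : Fin 3 → ℕ} (hr : ∀ l, 1 ≤ r l) (k : Fin 3 → Fin 3) (l : Fin 3) :
    (k l : ℕ) ≤ r l + 1 := by
  have := hr l
  omega

theorem exists_bound_uniKernel_all (hg : ∀ l, IsTransition (p l) (g l)) {k : Fin 3 → ℕ}
    (hk : ∀ l, k l ≤ r l + 1) : ∃ M, 0 ≤ M ∧ ∀ l x y, |uniKernel (K l) (g l) (k l) x y| ≤ M := by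
  choose C h0 hC using fun l => exists_bound_uniKernel (K l) (hg l) (hk l)
  exact ⟨∑ l, C l, Finset.sum_nonneg fun l _ => h0 l, fun l x y => (hC l x y).trans
    (Finset.single_le_sum (fun i _ => h0 i) (Finset.mem_univ l))⟩

theorem measurable_uniKernel_drop (hr : ∀ l, 1 ≤ r l) (k : Fin 3 → Fin 3) (l : Fin 3) :
    Measurable fun q : ℝ × ℝ => uniKernel (K l) (g l) (k l) q.1 q.2 :=
  measurable_uniKernel (K l) (by have := (K l).lt; have := drop_le hr k l; omega)

theorem measurable_cubeKernel (hr : ∀ l, 1 ≤ r l) (k : Fin 3 → Fin 3) :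
    Measurable fun q : E × E => cubeKernel K g k q.1 q.2 := by
  refine Finset.measurable_prod _ fun l _ => ?_
  have h : Measurable fun q : E × E => (q.1 l, q.2 l) :=
    ((measurable_pi_apply l).comp measurable_fst).prodMk
      ((measurable_pi_apply l).comp measurable_snd)
  exact (measurable_uniKernel_drop hr k l).comp h

theorem exists_bound_cubeKernel (hg : ∀ l, IsTransition (p l) (g l)) (hr : ∀ l, 1 ≤ r l)
    (k : Fin 3 → Fin 3) : ∃ M, 0 ≤ M ∧ ∀ x y, |cubeKernel K g k x y| ≤ M := by
  obtain ⟨M, h0, hM⟩ := exists_bound_uniKernel_all (K := K) hg (drop_le hr k)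
  refine ⟨M ^ 3, by positivity, fun x y => ?_⟩
  rw [cubeKernel, Finset.abs_prod]
  refine (Finset.prod_le_prod (fun _ _ => abs_nonneg _) fun l _ => hM l _ _).trans ?_
  simp

theorem integrableOn_cubeKernel_mul (hg : ∀ l, IsTransition (p l) (g l)) (hr : ∀ l, 1 ≤ r l)
    (k : Fin 3 → Fin 3) {v : E → ℝ} (hv : IntegrableOn v cube) (x : E) :
    IntegrableOn (fun y => cubeKernel K g k x y * v y) cube := by
  obtain ⟨M, _, hM⟩ := exists_bound_cubeKernel (K := K) hg hr k
  exact Integrable.bdd_mul hv (c := M)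
    ((measurable_cubeKernel hr k).comp measurable_prodMk_left).aestronglyMeasurable
    (Eventually.of_forall fun y => hM x y)

theorem tensorProj_ae_eq_kerProj (hg : ∀ l, IsTransition (p l) (g l)) (hr : ∀ l, 1 ≤ r l)
    (k : Fin 3 → Fin 3) {v : E → ℝ} (hv : IntegrableOn v cube) :
    tensorProj K g k v =ᵐ[volume.restrict cube] kerProj K g k v := by
  obtain ⟨M, _, hM⟩ := exists_bound_uniKernel_all (K := K) hg (drop_le hr k)
  have h := ae_cube_eval (P := fun l t => ∀ j, (K l).ξ j ≠ t) fun l =>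
    (ae_nonKnots (K l)).mono fun t ht _ => ht
  filter_upwards [h] with x hx
  exact tensorOp_eq_integral (κ := fun l y => uniKernel (K l) (g l) (k l) (x l) y)
    (fun l => (measurable_uniKernel_drop hr k l).comp measurable_prodMk_left)
    (fun l y => hM l _ y)
    (fun l u hu => uniProj_eq_integral (K l) (hg l) (hr l) (k l) hu (hx l)) hv

theorem kerProj_congr (k : Fin 3 → Fin 3) {v v' : E → ℝ} (h : v =ᵐ[volume.restrict cube] v') :
    kerProj K g k v = kerProj K g k v' := by
  funext x
  refine integral_congr_ae ?_
  filter_upwards [h] with y hy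
  rw [hy]

theorem kerProj_add (hg : ∀ l, IsTransition (p l) (g l)) (hr : ∀ l, 1 ≤ r l)
    (k : Fin 3 → Fin 3) {v v' : E → ℝ} (hv : IntegrableOn v cube) (hv' : IntegrableOn v' cube) :
    kerProj K g k (fun x => v x + v' x) = fun x => kerProj K g k v x + kerProj K g k v' x := by
  funext x
  simp only [kerProj, mul_add]
  exact integral_add (integrableOn_cubeKernel_mul hg hr k hv x)
    (integrableOn_cubeKernel_mul hg hr k hv' x)

theorem kerProj_smul (k : Fin 3 → Fin 3) (c : ℝ) (v : E → ℝ) :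
    kerProj K g k (fun x => c * v x) = fun x => c * kerProj K g k v x := by
  funext x
  simp only [kerProj, mul_left_comm _ c]
  exact integral_const_mul _ _

theorem kerProj_mem (hg : ∀ l, IsTransition (p l) (g l)) (hr : ∀ l, 1 ≤ r l)
    (k : Fin 3 → Fin 3) {v : E → ℝ} (hv : IntegrableOn v cube) :
    kerProj K g k v ∈ tensorSpace K k := by
  have hkl := fun l => drop_le hr k l
  have e : kerProj K g k v = ∑ j ∈ Fintype.piFinset fun l => Finset.Ico (k l : ℕ) (K l).n,
      (∫ y in cube, (∏ l, dualKernel (p l) (K l).ξ (g l) (k l) (j l) (y l)) * v y) •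
        fun x : E => ∏ l, bspline (K l).ξ (p l - k l) (j l) (x l) := by
    funext x
    rw [Finset.sum_apply]
    simp only [kerProj, cubeKernel, uniKernel, Finset.prod_univ_sum, Finset.sum_mul]
    rw [integral_finsetSum]
    · refine Finset.sum_congr rfl fun j _ => ?_
      simp only [Finset.prod_mul_distrib, Pi.smul_apply, smul_eq_mul, mul_assoc]
      rw [integral_const_mul, mul_comm]
    · intro j hj
      rw [Fintype.mem_piFinset] at hj
      choose C h0 hC using fun l => exists_bound_dualKernel (K l) (hg l) (hkl l)
        (Finset.mem_Ico.1 (hj l)).1 (Finset.mem_Ico.1 (hj l)).2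
      simp only [Finset.prod_mul_distrib, mul_assoc]
      refine Integrable.const_mul ?_ _
      refine Integrable.bdd_mul hv (c := ∏ l, C l) ?_ (Eventually.of_forall fun y => ?_)
      · refine (Finset.measurable_prod _ fun l _ => ?_).aestronglyMeasurable
        exact (measurable_dualKernel (by have := (K l).lt; have := hkl l; omega) (j l)).comp
          (measurable_pi_apply l)
      · rw [Real.norm_eq_abs, Finset.abs_prod]
        exact Finset.prod_le_prod (fun _ _ => abs_nonneg _) fun l _ => hC l _
  rw [e]
  refine Submodule.sum_mem _ fun j hj => Submodule.smul_mem _ _ (Submodule.subset_span ⟨j, ?_, rfl⟩)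
  intro l
  exact Finset.mem_Ico.1 (Fintype.mem_piFinset.1 hj l)

theorem measurable_tensor_bspline (q j : Fin 3 → ℕ) :
    Measurable fun x : E => ∏ l, bspline (K l).ξ (q l) (j l) (x l) :=
  Finset.measurable_prod _ fun l _ => (measurable_bspline _ _ _).comp (measurable_pi_apply l)

theorem tensorSpace_measurable_bounded {k : Fin 3 → Fin 3} {s : E → ℝ}
    (hs : s ∈ tensorSpace K k) : Measurable s ∧ ∃ M, ∀ x, |s x| ≤ M := by
  induction hs using Submodule.span_induction with
  | mem s h =>
    obtain ⟨j, -, rfl⟩ := h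
    refine ⟨measurable_tensor_bspline _ j, 1, fun x => ?_⟩
    rw [Finset.abs_prod]
    exact Finset.prod_le_one (fun _ _ => abs_nonneg _) fun l _ =>
      abs_bspline_le_one (K l).mono _ _ _
  | zero => exact ⟨measurable_const, 0, fun x => by simp⟩
  | add s t _ _ h1 h2 =>
    obtain ⟨m1, M1, h1⟩ := h1
    obtain ⟨m2, M2, h2⟩ := h2
    exact ⟨m1.add m2, M1 + M2, fun x => (abs_add_le _ _).trans (add_le_add (h1 x) (h2 x))⟩
  | smul c s _ h =>
    obtain ⟨m, M, h⟩ := h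
    refine ⟨m.const_smul c, |c| * M, fun x => ?_⟩
    rw [Pi.smul_apply, smul_eq_mul, abs_mul]
    exact mul_le_mul_of_nonneg_left (h x) (abs_nonneg c)

theorem tensorSpace_memLp {k : Fin 3 → Fin 3} {s : E → ℝ} (hs : s ∈ tensorSpace K k) :
    MemLp s 2 (volume.restrict cube) := by
  obtain ⟨hm, M, hM⟩ := tensorSpace_measurable_bounded hs
  exact MemLp.of_bound hm.aestronglyMeasurable M (Eventually.of_forall hM)

theorem integrableOn_of_memLp {v : E → ℝ} (hv : MemLp v 2 (volume.restrict cube)) :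
    IntegrableOn v cube :=
  hv.integrable (by norm_num)

theorem kerProj_eq_self (hg : ∀ l, IsTransition (p l) (g l)) (hr : ∀ l, 1 ≤ r l)
    (k : Fin 3 → Fin 3) {s : E → ℝ} (hs : s ∈ tensorSpace K k) : kerProj K g k s = s := by
  induction hs using Submodule.span_induction with
  | mem s h =>
    obtain ⟨j, hj, rfl⟩ := h
    funext x
    simp only [kerProj, cubeKernel, ← Finset.prod_mul_distrib]
    rw [restrict_cube, integral_fintype_prod_eq_prod (f := fun l t =>
      uniKernel (K l) (g l) (k l) (x l) t * bspline (K l).ξ (p l - k l) (j l) t)]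
    refine Finset.prod_congr rfl fun l _ => ?_
    exact integral_uniKernel_mul_bspline (K l) (hg l) (drop_le hr k l) (hj l).1 (hj l).2 _
  | zero => funext x; simp [kerProj]
  | add s t hs ht h1 h2 =>
    have := kerProj_add (K := K) hg hr k (integrableOn_of_memLp (tensorSpace_memLp hs))
      (integrableOn_of_memLp (tensorSpace_memLp ht))
    rw [h1, h2] at this
    exact this
  | smul c s _ h =>
    have := kerProj_smul (K := K) (g := g) k c s
    rw [h] at this
    exact this

end

section

/-! ### Schur's test -/

theorem schur_test {α : Type*} [MeasurableSpace α] {μ : Measure α} [IsFiniteMeasure μ]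
    {κ : α → α → ℝ} (hκ : Measurable fun q : α × α => κ q.1 q.2) {M : ℝ}
    (hM : ∀ x y, |κ x y| ≤ M) {C : ℝ} (hC : 0 < C) (h1 : ∀ x, ∫ y, |κ x y| ∂μ ≤ C)
    (h2 : ∀ᵐ y ∂μ, ∫ x, |κ x y| ∂μ ≤ C) {v : α → ℝ} (hv : MemLp v 2 μ) :
    ∫ x, (∫ y, κ x y * v y ∂μ) ^ 2 ∂μ ≤ C ^ 2 * ∫ y, v y ^ 2 ∂μ := by
  have hv1 : Integrable v μ := hv.integrable (by norm_num)
  have hv2 : Integrable (fun y => v y ^ 2) μ := hv.integrable_sq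
  have hκx : ∀ x, Measurable fun y => |κ x y| := fun x =>
    (hκ.comp measurable_prodMk_left).norm
  have hi0 : ∀ x, Integrable (fun y => |κ x y|) μ := fun x =>
    Integrable.of_bound (hκx x).aestronglyMeasurable M
      (Eventually.of_forall fun y => by rw [Real.norm_eq_abs, abs_abs]; exact hM x y)
  have hi1 : ∀ x, Integrable (fun y => |κ x y| * |v y|) μ := fun x =>
    hv1.abs.bdd_mul (c := M) (hκx x).aestronglyMeasurable
      (Eventually.of_forall fun y => by rw [Real.norm_eq_abs, abs_abs]; exact hM x y)
  have hi2 : ∀ x, Integrable (fun y => |κ x y| * v y ^ 2) μ := fun x =>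
    hv2.bdd_mul (c := M) (hκx x).aestronglyMeasurable
      (Eventually.of_forall fun y => by rw [Real.norm_eq_abs, abs_abs]; exact hM x y)
  have hpt : ∀ x, (∫ y, κ x y * v y ∂μ) ^ 2 ≤ C * ∫ y, |κ x y| * v y ^ 2 ∂μ := by
    intro x
    set b := ∫ y, |κ x y| * |v y| ∂μ
    have hb : |∫ y, κ x y * v y ∂μ| ≤ b := by
      refine (abs_integral_le_integral_abs).trans_eq ?_
      simp only [abs_mul, b]
    have hb0 : 0 ≤ b := (abs_nonneg _).trans hb
    have hnn : 0 ≤ ∫ y, |κ x y| * (|v y| - b / C) ^ 2 ∂μ :=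
      integral_nonneg fun y => by positivity
    have e : ∫ y, |κ x y| * (|v y| - b / C) ^ 2 ∂μ = (∫ y, |κ x y| * v y ^ 2 ∂μ) -
        2 * (b / C) * b + (b / C) ^ 2 * ∫ y, |κ x y| ∂μ := by
      rw [← integral_const_mul, ← integral_const_mul, ← integral_sub (hi2 x)
        ((hi1 x).const_mul _), ← integral_add
        (f := fun y => |κ x y| * v y ^ 2 - 2 * (b / C) * (|κ x y| * |v y|))
        ((hi2 x).sub ((hi1 x).const_mul _)) ((hi0 x).const_mul _)]
      refine integral_congr_ae (Eventually.of_forall fun y => ?_)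
      simp only [← sq_abs (v y)]
      ring
    rw [e] at hnn
    have h3 : (b / C) ^ 2 * ∫ y, |κ x y| ∂μ ≤ (b / C) ^ 2 * C :=
      mul_le_mul_of_nonneg_left (h1 x) (sq_nonneg _)
    have h4 : (b / C) ^ 2 * C = b ^ 2 / C := by field_simp
    have h5 : 2 * (b / C) * b = 2 * (b ^ 2 / C) := by ring
    have h6 : b ^ 2 / C ≤ ∫ y, |κ x y| * v y ^ 2 ∂μ := by linarith
    rw [div_le_iff₀ hC] at h6
    calc (∫ y, κ x y * v y ∂μ) ^ 2 = |∫ y, κ x y * v y ∂μ| ^ 2 := (sq_abs _).symm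
      _ ≤ b ^ 2 := pow_le_pow_left₀ (abs_nonneg _) hb 2
      _ ≤ _ := by linarith
  have hprod : Integrable (fun q : α × α => |κ q.1 q.2| * v q.2 ^ 2) (μ.prod μ) :=
    (hv2.comp_snd μ).bdd_mul (c := M) hκ.norm.aestronglyMeasurable
      (Eventually.of_forall fun q => by
        simpa only [Real.norm_eq_abs, abs_abs] using hM q.1 q.2)
  have hint : Integrable (fun x => ∫ y, |κ x y| * v y ^ 2 ∂μ) μ := hprod.integral_prod_left
  calc ∫ x, (∫ y, κ x y * v y ∂μ) ^ 2 ∂μ ≤ ∫ x, C * ∫ y, |κ x y| * v y ^ 2 ∂μ ∂μ := by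
        refine integral_mono_of_nonneg (Eventually.of_forall fun x => sq_nonneg _)
          (hint.const_mul C) (Eventually.of_forall hpt)
    _ = C * ∫ y, ∫ x, |κ x y| * v y ^ 2 ∂μ ∂μ := by
        rw [integral_const_mul, integral_integral_swap hprod]
    _ ≤ C * ∫ y, C * v y ^ 2 ∂μ := by
        refine mul_le_mul_of_nonneg_left ?_ hC.le
        refine integral_mono_of_nonneg (Eventually.of_forall fun y => integral_nonneg fun x => by
          positivity) (hv2.const_mul C) ?_
        filter_upwards [h2] with y hy
        rw [integral_mul_const]
        exact mul_le_mul_of_nonneg_right hy (sq_nonneg _)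
    _ = C ^ 2 * ∫ y, v y ^ 2 ∂μ := by rw [integral_const_mul]; ring

variable {p r : Fin 3 → ℕ} {K : ∀ l, OpenKnots (p l) (r l)} {g : Fin 3 → ℝ → ℝ}

theorem kerProj_memLp (hg : ∀ l, IsTransition (p l) (g l)) (hr : ∀ l, 1 ≤ r l)
    (k : Fin 3 → Fin 3) {v : E → ℝ} (hv : IntegrableOn v cube) :
    MemLp (kerProj K g k v) 2 (volume.restrict cube) :=
  tensorSpace_memLp (kerProj_mem hg hr k hv)

theorem exists_l2_bound_kerProj (hg : ∀ l, IsTransition (p l) (g l)) (θ : ℝ) :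
    ∃ C, 0 ≤ C ∧ ∀ (r : Fin 3 → ℕ) (_ : ∀ l, 1 ≤ r l) (K : ∀ l, OpenKnots (p l) (r l)),
      (∀ l, LocallyQuasiUniform θ (K l)) → ∀ (k : Fin 3 → Fin 3) (v : E → ℝ),
      MemLp v 2 (volume.restrict cube) →
        ∫ x in cube, kerProj K g k v x ^ 2 ≤ C ^ 2 * ∫ x in cube, v x ^ 2 := by
  choose c hc0 hc using fun l => exists_schur_bound (p l) (hg l) θ
  set C : ℝ := ∏ l, (c l + 1) with hCdef
  have hC : 0 < C := Finset.prod_pos fun l _ => by linarith [hc0 l]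
  refine ⟨C, hC.le, fun r hr K hK k v hv => ?_⟩
  obtain ⟨M, -, hM⟩ := exists_bound_cubeKernel (K := K) hg hr k
  have hk : ∀ l, (k l : ℕ) ≤ 2 := fun l => by omega
  refine schur_test (κ := cubeKernel K g k) (measurable_cubeKernel hr k) hM hC ?_ ?_ hv
  · intro x
    simp only [cubeKernel, Finset.abs_prod]
    rw [restrict_cube, integral_fintype_prod_eq_prod (f := fun l t =>
      |uniKernel (K l) (g l) (k l) (x l) t|)]
    exact Finset.prod_le_prod (fun l _ => integral_nonneg fun _ => abs_nonneg _) fun l _ =>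
      ((hc l (r l) (hr l) (K l) (hK l) _ (hk l)).1 (x l)).trans (by linarith)
  · have := ae_cube_eval (P := fun l t => ∫ s in Ioo (0 : ℝ) 1,
      |uniKernel (K l) (g l) (k l) s t| ≤ c l) fun l =>
        ((hc l (r l) (hr l) (K l) (hK l) _ (hk l)).2).mono fun t ht _ => ht
    filter_upwards [this] with y hy
    simp only [cubeKernel, Finset.abs_prod]
    rw [restrict_cube, integral_fintype_prod_eq_prod (f := fun l t =>
      |uniKernel (K l) (g l) (k l) t (y l)|)]
    exact Finset.prod_le_prod (fun l _ => integral_nonneg fun _ => abs_nonneg _) fun l _ =>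
      (hy l).trans (by linarith)

/-! ### Integration by parts in one coordinate direction -/

theorem IsTest.eq_zero {D : Set E} {ψ : E → ℝ} (h : IsTest D ψ) {x : E} (hx : x ∉ D) : ψ x = 0 :=
  image_eq_zero_of_notMem_tsupport fun hx' => hx (h.supp hx')

theorem IsTest.contDiff_pd {D : Set E} {ψ : E → ℝ} (h : IsTest D ψ) (l : Fin 3) :
    ContDiff ℝ (⊤ : ℕ∞) (pd l ψ) :=
  (h.smooth.fderiv_right (m := (⊤ : ℕ∞)) (by simp)).clm_apply contDiff_const

theorem IsTest.pd {D : Set E} {ψ : E → ℝ} (h : IsTest D ψ) (l : Fin 3) : IsTest D (pd l ψ) := by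
  have hsub : tsupport (HessianSpline.pd l ψ) ⊆ tsupport ψ :=
    closure_minimal (fun x hx => by
      refine support_fderiv_subset ℝ (?_ : fderiv ℝ ψ x ≠ 0)
      intro h0
      exact hx (by simp [HessianSpline.pd, h0])) (isClosed_tsupport ψ)
  exact ⟨h.contDiff_pd l, h.compact.of_isClosed_subset (isClosed_tsupport _) hsub,
    hsub.trans h.supp⟩

theorem IsTest.exists_bound {D : Set E} {ψ : E → ℝ} (h : IsTest D ψ) : ∃ M, ∀ x, |ψ x| ≤ M :=
  h.compact.exists_bound_of_continuous h.smooth.continuous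

theorem IsTest.measurable {D : Set E} {ψ : E → ℝ} (h : IsTest D ψ) : Measurable ψ :=
  h.smooth.continuous.measurable

theorem IsTest.integrable_mul {D : Set E} {ψ : E → ℝ} (h : IsTest D ψ) {f : E → ℝ} {μ : Measure E}
    (hf : Integrable f μ) : Integrable (fun x => f x * ψ x) μ := by
  obtain ⟨M, hM⟩ := h.exists_bound
  exact hf.mul_bdd (c := M) h.measurable.aestronglyMeasurable (Eventually.of_forall hM)

theorem integral_insertNth (l : Fin 3) {F : E → ℝ} (hF : IntegrableOn F cube) :
    ∫ x in cube, F x = ∫ z, (∫ t in Ioo (0 : ℝ) 1, F (l.insertNth t z))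
      ∂(Measure.pi fun _ : Fin 2 => unitMeasure) := by
  have h1 := (measurePreserving_piFinSuccAbove (fun _ : Fin 3 => unitMeasure) l).symm
  have hF' := hF
  rw [IntegrableOn, restrict_cube] at hF'
  have h2 := h1.integrable_comp_of_integrable hF'
  rw [restrict_cube, ← h1.integral_comp (MeasurableEquiv.measurableEmbedding _), integral_prod_symm]
  · rfl
  · exact h2

/-- If `f'` is the weak derivative of `f` on the unit interval and `h` does not depend on `x l`,
then `f' (x l) * h x` is the weak derivative of `f (x l) * h x` in direction `l`. -/
theorem integral_cube_mul_pd {l : Fin 3} {f f' : ℝ → ℝ} {h ψ : E → ℝ} {M : ℝ}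
    (hf : Measurable f) (hfM : ∀ t, |f t| ≤ M) (hf' : Measurable f') (hfM' : ∀ t, |f' t| ≤ M)
    (hh : Measurable h) (hhM : ∀ x, |h x| ≤ M)
    (hind : ∀ t t' z, h (l.insertNth t z) = h (l.insertNth t' z))
    (hw : ∀ H, AC H → H 0 = 0 → H 1 = 0 →
      ∫ t in Ioo (0 : ℝ) 1, f t * deriv H t = -∫ t in Ioo (0 : ℝ) 1, f' t * H t)
    (hψ : IsTest cube ψ) :
    ∫ x in cube, f (x l) * h x * pd l ψ x = -∫ x in cube, f' (x l) * h x * ψ x := by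
  have hint : ∀ (F : ℝ → ℝ) (χ : E → ℝ), Measurable F → (∀ t, |F t| ≤ M) → IsTest cube χ →
      IntegrableOn (fun x => F (x l) * h x * χ x) cube := by
    intro F χ hF hFM hχ
    refine hχ.integrable_mul (Integrable.of_bound ?_ (M * M) (Eventually.of_forall fun x => ?_))
    · exact ((hF.comp (measurable_pi_apply l)).mul hh).aestronglyMeasurable
    · rw [Real.norm_eq_abs, abs_mul]
      exact mul_le_mul (hFM _) (hhM _) (abs_nonneg _) ((abs_nonneg _).trans (hFM 0))
  rw [integral_insertNth l (hint f _ hf hfM (hψ.pd l)), integral_insertNth l (hint f' _ hf' hfM' hψ),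
    ← integral_neg]
  refine integral_congr_ae (Eventually.of_forall fun z => ?_)
  simp only [Fin.insertNth_apply_same]
  set H : ℝ → ℝ := fun t => ψ (l.insertNth t z) with hH
  have hins : ∀ t, HasDerivAt (fun t => (l.insertNth t z : E)) (Pi.single l 1) t := by
    intro t
    rw [hasDerivAt_pi]
    intro m
    refine Fin.succAboveCases l ?_ (fun m => ?_) m
    · simpa using hasDerivAt_id' t
    · simpa using hasDerivAt_const t (z m)
  have hder : ∀ t, HasDerivAt H (pd l ψ (l.insertNth t z)) t := fun t =>
    ((hψ.smooth.differentiable (by simp)).differentiableAt.hasFDerivAt).comp_hasDerivAt t (hins t)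
  have hd : deriv H = fun t => pd l ψ (l.insertNth t z) := funext fun t => (hder t).deriv
  have hHc : ContDiff ℝ 1 H := by
    rw [contDiff_one_iff_deriv, hd]
    refine ⟨fun t => (hder t).differentiableAt, (hψ.contDiff_pd l).continuous.comp ?_⟩
    exact continuous_iff_continuousAt.2 fun t => (hins t).continuousAt
  have hz : ∀ t, t ∉ Ioo (0 : ℝ) 1 → H t = 0 := fun t ht => hψ.eq_zero fun hx => ht (by
    simpa using hx l (mem_univ l))
  have key := hw H (AC.of_contDiff hHc) (hz 0 (by simp)) (hz 1 (by simp))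
  have e1 : ∀ t, f t * h (l.insertNth t z) * pd l ψ (l.insertNth t z) =
      h (l.insertNth 0 z) * (f t * deriv H t) := fun t => by
    rw [hind t 0 z, hd]; ring
  have e2 : ∀ t, f' t * h (l.insertNth t z) * ψ (l.insertNth t z) =
      h (l.insertNth 0 z) * (f' t * H t) := fun t => by
    rw [hind t 0 z]; ring
  simp only [e1, e2]
  rw [integral_const_mul, integral_const_mul, key, mul_neg]

theorem prod_erase_insertNth (l : Fin 3) (f : Fin 3 → ℝ → ℝ) (t t' : ℝ) (z : Fin 2 → ℝ) :
    ∏ m ∈ Finset.univ.erase l, f m ((l.insertNth t z : E) m) =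
      ∏ m ∈ Finset.univ.erase l, f m ((l.insertNth t' z : E) m) := by
  refine Finset.prod_congr rfl fun m hm => ?_
  obtain ⟨j, rfl⟩ := Fin.exists_succAbove_eq (Finset.ne_of_mem_erase hm)
  simp

end

section

/-! ### The projections commute with weak derivatives -/

theorem integral_kernel_swap {α : Type*} [MeasurableSpace α] {μ : Measure α} [IsFiniteMeasure μ]
    {κ : α → α → ℝ} (hκ : Measurable fun q : α × α => κ q.1 q.2) {M : ℝ}
    (hM : ∀ x y, |κ x y| ≤ M) {s χ : α → ℝ} (hs : Integrable s μ) (hχ : Integrable χ μ) :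
    Integrable (fun x => (∫ y, κ x y * s y ∂μ) * χ x) μ ∧
    ∫ x, (∫ y, κ x y * s y ∂μ) * χ x ∂μ = ∫ y, s y * ∫ x, κ x y * χ x ∂μ ∂μ := by
  have h : Integrable (fun q : α × α => κ q.1 q.2 * (χ q.1 * s q.2)) (μ.prod μ) :=
    (hχ.mul_prod hs).bdd_mul (c := M) hκ.aestronglyMeasurable
      (Eventually.of_forall fun q => hM q.1 q.2)
  have e : ∀ x, (∫ y, κ x y * s y ∂μ) * χ x = ∫ y, κ x y * (χ x * s y) ∂μ := fun x => by
    rw [← integral_mul_const]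
    exact integral_congr_ae (Eventually.of_forall fun y => by simp only; ring)
  simp only [e]
  refine ⟨h.integral_prod_left, ?_⟩
  rw [integral_integral_swap h]
  refine integral_congr_ae (Eventually.of_forall fun y => ?_)
  simp only [← integral_const_mul]
  exact integral_congr_ae (Eventually.of_forall fun x => by simp only; ring)

theorem integrableOn_of_bound {f : E → ℝ} (hf : Measurable f) {M : ℝ} (hM : ∀ x, |f x| ≤ M) :
    IntegrableOn f cube :=
  Integrable.of_bound hf.aestronglyMeasurable M (Eventually.of_forall hM)

theorem IsTest.integrableOn {D : Set E} {ψ : E → ℝ} (h : IsTest D ψ) : IntegrableOn ψ cube := by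
  obtain ⟨M, hM⟩ := h.exists_bound
  exact integrableOn_of_bound h.measurable hM

variable {p r : Fin 3 → ℕ} {K : ∀ l, OpenKnots (p l) (r l)} {g : Fin 3 → ℝ → ℝ}

theorem IsWeakDivRow.kerProj (hg : ∀ l, IsTransition (p l) (g l)) (hr : ∀ l, 1 ≤ r l)
    {s : E → Fin 3 → ℝ} {w : E → ℝ} (hsw : IsWeakDivRow cube s w)
    (hs : ∀ l, IntegrableOn (fun x => s x l) cube) (hw : IntegrableOn w cube)
    {k : Fin 3 → Fin 3} {m : Fin 3 → Fin 3 → Fin 3}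
    (h : ∀ l, (∀ x, s x l = 0) ∨ ((k l : ℕ) = (m l l : ℕ) + 1 ∧ ∀ j, j ≠ l → m l j = k j)) :
    IsWeakDivRow cube (fun x l => kerProj K g (m l) (fun y => s y l) x) (kerProj K g k w) := by
  intro ψ hψ
  have hkr := fun l => drop_le hr k l
  have hk1 : ∀ l, (k l : ℕ) - 1 ≤ r l := fun l => by have := hkr l; omega
  have hkp : ∀ l, (k l : ℕ) - 1 ≤ p l := fun l => by have := hk1 l; have := (K l).lt; omega
  obtain ⟨M₁, hM₁0, hM₁⟩ := exists_bound_uniKernel_all (K := K) hg hkr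
  choose C hC0 hC using fun l =>
    exists_bound_uniKernelDy (K l) (hg l) (k := (k l : ℕ) - 1) (by have := hk1 l; omega)
  set M : ℝ := M₁ + ∑ l, C l with hMdef
  have hsum0 : 0 ≤ ∑ l, C l := Finset.sum_nonneg fun l _ => hC0 l
  have hτM : ∀ l x y, |uniKernel (K l) (g l) (k l) x y| ≤ M := fun l x y =>
    (hM₁ l x y).trans (by linarith)
  have hαM : ∀ l x y, |uniKernelDy (K l) (g l) ((k l : ℕ) - 1) x y| ≤ M := fun l x y =>
    (hC l x y).trans ((Finset.single_le_sum (fun i _ => hC0 i) (Finset.mem_univ l)).trans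
      (by linarith))
  have hM0 : 0 ≤ M := by linarith
  -- the kernels after integration by parts
  set κ : Fin 3 → E → E → ℝ := fun l x y => uniKernelDy (K l) (g l) ((k l : ℕ) - 1) (x l) (y l) *
    ∏ j ∈ Finset.univ.erase l, uniKernel (K j) (g j) (k j) (x j) (y j) with hκ
  have hpair : ∀ l, Measurable fun q : E × E => (q.1 l, q.2 l) := fun l =>
    ((measurable_pi_apply l).comp measurable_fst).prodMk
      ((measurable_pi_apply l).comp measurable_snd)
  have hκm : ∀ l, Measurable fun q : E × E => κ l q.1 q.2 := fun l =>
    ((measurable_uniKernelDy (K l) (hkp l)).comp (hpair l)).mul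
      (Finset.measurable_prod _ fun j _ => (measurable_uniKernel_drop hr k j).comp (hpair j))
  have hprodM : ∀ (l : Fin 3) (x y : E), |∏ j ∈ Finset.univ.erase l,
      uniKernel (K j) (g j) (k j) (x j) (y j)| ≤ M ^ 2 := by
    intro l x y
    rw [Finset.abs_prod]
    refine (Finset.prod_le_prod (fun _ _ => abs_nonneg _) fun j _ => hτM j _ _).trans ?_
    simp
  have hκM : ∀ l x y, |κ l x y| ≤ M * M ^ 2 := fun l x y => by
    rw [hκ, abs_mul]
    exact mul_le_mul (hαM l _ _) (hprodM l x y) (abs_nonneg _) hM0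
  have step : ∀ l, ∫ x in cube, HessianSpline.kerProj K g (m l) (fun y => s y l) x * pd l ψ x =
      ∫ x in cube, (∫ y in cube, κ l x y * s y l) * ψ x := by
    intro l
    rcases h l with h0 | ⟨h1, h2⟩
    · simp [HessianSpline.kerProj, h0]
    obtain ⟨B, -, hB⟩ := exists_bound_cubeKernel (K := K) hg hr (m l)
    simp only [HessianSpline.kerProj]
    rw [(integral_kernel_swap (μ := volume.restrict cube) (measurable_cubeKernel hr (m l)) hB (hs l)
        (hψ.pd l).integrableOn).2,
      (integral_kernel_swap (μ := volume.restrict cube) (hκm l) (hκM l) (hs l) hψ.integrableOn).2]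
    refine integral_congr_ae (Eventually.of_forall fun y => ?_)
    have hml : (k l : ℕ) - 1 = (m l l : ℕ) := by omega
    have hmr : (m l l : ℕ) ≤ r l := by have := hk1 l; omega
    have e1 : ∀ x, cubeKernel K g (m l) x y = uniKernel (K l) (g l) (m l l) (x l) (y l) *
        ∏ j ∈ Finset.univ.erase l, uniKernel (K j) (g j) (k j) (x j) (y j) := by
      intro x
      rw [cubeKernel, ← Finset.mul_prod_erase _ _ (Finset.mem_univ l)]
      congr 1
      refine Finset.prod_congr rfl fun j hj => ?_
      rw [h2 j (Finset.ne_of_mem_erase hj)]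
    obtain ⟨B', hB'0, hB'⟩ := exists_bound_uniKernel_all (K := K) hg (drop_le hr (m l))
    have hle : M ≤ M + M ^ 2 + B' := by nlinarith
    have key := integral_cube_mul_pd (l := l)
      (f := fun t => uniKernel (K l) (g l) (m l l) t (y l))
      (f' := fun t => -uniKernelDy (K l) (g l) ((k l : ℕ) - 1) t (y l))
      (h := fun x => ∏ j ∈ Finset.univ.erase l, uniKernel (K j) (g j) (k j) (x j) (y j))
      (M := M + M ^ 2 + B')
      ((measurable_uniKernel_drop hr (m l) l).comp measurable_prodMk_right)
      (fun t => (hB' l _ _).trans (by nlinarith))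
      ((measurable_uniKernelDy (K l) (hkp l)).comp measurable_prodMk_right).neg
      (fun t => by rw [abs_neg]; exact (hαM l _ _).trans hle)
      (Finset.measurable_prod _ fun j _ => ((measurable_uniKernel_drop hr k j).comp
        measurable_prodMk_right).comp (measurable_pi_apply j))
      (fun x => (hprodM l x y).trans (by nlinarith))
      (fun t t' z => prod_erase_insertNth l (fun j u => uniKernel (K j) (g j) (k j) u (y j)) t t' z)
      (fun H hH h0 h1 => by
        rw [integral_uniKernel_mul_deriv (K l) hmr hH h0 h1, hml, ← integral_neg]
        simp only [neg_mul, neg_neg]) hψ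
    simp only [e1]
    rw [key, ← integral_neg]
    simp only [neg_mul, neg_neg, hκ]
  have tens : ∀ x, ∑ l, ∫ y in cube, κ l x y * s y l =
      -∫ y in cube, cubeKernel K g k x y * w y := by
    intro x
    have := hsw.tensor hs hw (τ := fun l t => uniKernel (K l) (g l) (k l) (x l) t)
      (α := fun l t => uniKernelDy (K l) (g l) ((k l : ℕ) - 1) (x l) t) (M := M)
      (fun l => (measurable_uniKernel_drop hr k l).comp measurable_prodMk_left)
      (fun l t => hτM l _ _)
      (fun l => (measurable_uniKernelDy (K l) (hkp l)).comp measurable_prodMk_left)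
      (fun l t => hαM l _ _) (fun l => (h l).imp_right fun h1 => by
        obtain ⟨i, hi⟩ : ∃ i, (k l : ℕ) = i + 1 := ⟨_, h1.1⟩
        have hir : i ≤ r l := by have := hk1 l; omega
        simp only [hi, Nat.add_sub_cancel]
        exact ⟨AC_uniKernel_succ (K l) (hg l) hir _, uniKernel_succ_zero (K l) (hg l) hir _,
          uniKernel_succ_one (K l) (hg l) hir _, ae_deriv_uniKernel_succ (K l) (hg l) hir _⟩)
    simp only [cubeKernel, mul_comm _ (w _)]
    rw [← this, integral_finsetSum]
    · simp only [hκ, mul_comm _ (s _ _)]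
    · intro l _
      simp only [mul_comm (s _ l)]
      exact Integrable.bdd_mul (hs l) (c := M * M ^ 2)
        ((hκm l).comp measurable_prodMk_left).aestronglyMeasurable
        (Eventually.of_forall fun y => hκM l x y)
  have hint1 : ∀ l, IntegrableOn (fun x => HessianSpline.kerProj K g (m l) (fun y => s y l) x *
      pd l ψ x) cube := fun l =>
    (hψ.pd l).integrable_mul (integrableOn_of_memLp (kerProj_memLp hg hr (m l) (hs l)))
  rw [integral_finsetSum _ fun l _ => hint1 l]
  simp only [step]
  rw [← integral_finsetSum _ fun l _ =>
    (integral_kernel_swap (μ := volume.restrict cube) (hκm l) (hκM l) (hs l) hψ.integrableOn).1]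
  simp only [← Finset.sum_mul, tens]
  simp only [neg_mul, integral_neg, HessianSpline.kerProj]

/-! ### Weak derivatives of tensor product splines -/

theorem sum_ite_single {n : ℕ} (l : Fin n) (a : ℝ) (f : Fin n → ℝ) :
    ∑ i, (Pi.single l a : Fin n → ℝ) i * f i = a * f l := by
  rw [Finset.sum_eq_single l]
  · simp
  · intro j _ hj; simp [hj]
  · simp

theorem exists_weakDeriv_of_mem_tensorSpace (hr : ∀ l, 1 ≤ r l) {k : Fin 3 → Fin 3} {s : E → ℝ}
    (hs : s ∈ tensorSpace K k) {l : Fin 3} (hl : (k l : ℕ) < 2) :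
    ∃ s' : E → ℝ, s' ∈ tensorSpace K (Function.update k l (k l + 1)) ∧
      IsWeakDivRow cube (fun x => Pi.single l (s x)) s' := by
  have hkr : (k l : ℕ) ≤ r l := by have := hr l; omega
  have hsucc : ((k l + 1 : Fin 3) : ℕ) = k l + 1 := by
    rw [Fin.val_add_one_of_lt]
    rw [Fin.lt_def]
    simpa using hl
  induction hs using Submodule.span_induction with
  | mem s h =>
    obtain ⟨j, hj, rfl⟩ := h
    set c : ℕ → ℝ := fun i => if i = j l then 1 else 0 with hc
    set d : ℕ → ℝ := fun i => ((p l - k l : ℕ) : ℝ) / ((K l).ξ (i + (p l - k l)) - (K l).ξ i) *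
      (c i - c (i - 1)) with hd
    set f' : ℝ → ℝ := fun t => ∑ i ∈ Finset.Ico ((k l : ℕ) + 1) (K l).n,
      d i * bspline (K l).ξ (p l - (k l + 1)) i t with hf'
    set h : E → ℝ := fun x => ∏ i ∈ Finset.univ.erase l,
      bspline (K i).ξ (p i - k i) (j i) (x i) with hh
    refine ⟨fun x => f' (x l) * h x, ?_, ?_⟩
    · have e : (fun x => f' (x l) * h x) = ∑ i ∈ Finset.Ico ((k l : ℕ) + 1) (K l).n,
          d i • fun x : E => ∏ i', bspline (K i').ξ
            (p i' - (Function.update k l (k l + 1) i' : ℕ)) (Function.update j l i i') (x i') := by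
        funext x
        rw [Finset.sum_apply]
        simp only [hf', Finset.sum_mul, Pi.smul_apply, smul_eq_mul]
        refine Finset.sum_congr rfl fun i _ => ?_
        rw [← Finset.mul_prod_erase _ _ (Finset.mem_univ l), Function.update_self,
          Function.update_self, hsucc, mul_assoc]
        congr 2
        refine Finset.prod_congr rfl fun i' hi' => ?_
        rw [Function.update_of_ne (Finset.ne_of_mem_erase hi'),
          Function.update_of_ne (Finset.ne_of_mem_erase hi')]
      rw [e]
      refine Submodule.sum_mem _ fun i hi => Submodule.smul_mem _ _
        (Submodule.subset_span ⟨Function.update j l i, fun i' => ?_, rfl⟩)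
      by_cases hi' : i' = l
      · subst hi'
        rw [Function.update_self, Function.update_self, hsucc]
        exact Finset.mem_Ico.1 hi
      · rw [Function.update_of_ne hi', Function.update_of_ne hi']
        exact hj i'
    · intro ψ hψ
      simp only [sum_ite_single]
      have hfM' : ∀ t, |f' t| ≤ ∑ i ∈ Finset.Ico ((k l : ℕ) + 1) (K l).n, |d i| := by
        intro t
        refine (Finset.abs_sum_le_sum_abs _ _).trans (Finset.sum_le_sum fun i _ => ?_)
        rw [abs_mul]
        exact mul_le_of_le_one_right (abs_nonneg _) (abs_bspline_le_one (K l).mono _ _ _)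
      have hd0 : 0 ≤ ∑ i ∈ Finset.Ico ((k l : ℕ) + 1) (K l).n, |d i| :=
        Finset.sum_nonneg fun _ _ => abs_nonneg _
      have key := integral_cube_mul_pd (l := l)
        (f := bspline (K l).ξ (p l - k l) (j l)) (f' := f') (h := h)
        (M := 1 + ∑ i ∈ Finset.Ico ((k l : ℕ) + 1) (K l).n, |d i|)
        (measurable_bspline _ _ _)
        (fun t => (abs_bspline_le_one (K l).mono _ _ _).trans (by linarith))
        (Finset.measurable_sum _ fun i _ => (measurable_bspline _ _ _).const_mul _)
        (fun t => (hfM' t).trans (by linarith))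
        (Finset.measurable_prod _ fun i _ => (measurable_bspline _ _ _).comp
          (measurable_pi_apply i))
        (fun x => by
          rw [hh, Finset.abs_prod]
          exact (Finset.prod_le_one (fun _ _ => abs_nonneg _) fun i _ =>
            abs_bspline_le_one (K i).mono _ _ _).trans (by linarith))
        (fun t t' z => prod_erase_insertNth l
          (fun i => bspline (K i).ξ (p i - k i) (j i)) t t' z)
        (fun H hH h0 h1 => by
          have := integral_sum_bspline_mul_deriv (K l) hkr c hH h0 h1
          rw [← this]
          refine integral_congr_ae (Eventually.of_forall fun t => ?_)
          simp only [hc, ite_mul, one_mul, zero_mul]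
          rw [Finset.sum_ite_eq' , if_pos (Finset.mem_Ico.2 (hj l))]) hψ
      rw [← key]
      refine integral_congr_ae (Eventually.of_forall fun x => ?_)
      simp only [hh]
      rw [← Finset.mul_prod_erase _ _ (Finset.mem_univ l)]
  | zero =>
    refine ⟨0, Submodule.zero_mem _, fun ψ _ => ?_⟩
    simp
  | add s t hs ht h1 h2 =>
    obtain ⟨s', hs', hs''⟩ := h1
    obtain ⟨t', ht', ht''⟩ := h2
    refine ⟨s' + t', Submodule.add_mem _ hs' ht', fun ψ hψ => ?_⟩
    have e1 := hs'' ψ hψ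
    have e2 := ht'' ψ hψ
    simp only [sum_ite_single] at e1 e2 ⊢
    simp only [Pi.add_apply, add_mul]
    rw [integral_add ((hψ.pd l).integrable_mul (integrableOn_of_memLp (tensorSpace_memLp hs)))
      ((hψ.pd l).integrable_mul (integrableOn_of_memLp (tensorSpace_memLp ht))), e1, e2,
      integral_add (hψ.integrable_mul (integrableOn_of_memLp (tensorSpace_memLp hs')))
      (hψ.integrable_mul (integrableOn_of_memLp (tensorSpace_memLp ht')))]
    ring
  | smul c s _ h =>
    obtain ⟨s', hs', hs''⟩ := h
    refine ⟨c • s', Submodule.smul_mem _ c hs', fun ψ hψ => ?_⟩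
    have e1 := hs'' ψ hψ
    simp only [sum_ite_single] at e1 ⊢
    simp only [Pi.smul_apply, smul_eq_mul, mul_assoc]
    rw [integral_const_mul, e1, integral_const_mul]
    ring

end

section

/-! ### Square-integrable fields -/

theorem memL2_scalar_iff {D : Set E} {f : E → ℝ} :
    MemL2 D f ↔ MemLp f 2 (volume.restrict D) :=
  ⟨fun h => h (), fun h _ => h⟩

theorem memL2_vec_iff {D : Set E} {f : E → Fin 3 → ℝ} :
    MemL2 D f ↔ ∀ i, MemLp (fun x => f x i) 2 (volume.restrict D) := Iff.rfl

theorem memL2_mat_iff {D : Set E} {f : E → Mat} :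
    MemL2 D f ↔ ∀ i j, MemLp (fun x => f x i j) 2 (volume.restrict D) :=
  ⟨fun h i j => h (i, j), fun h ij => h ij.1 ij.2⟩

theorem MemL2.congr {W ι : Type} [HasComponents W ι] {D : Set E} {f f' : E → W} (hf : MemL2 D f)
    (h : f =ᵐ[volume.restrict D] f') : MemL2 D f' := fun i =>
  (hf i).ae_eq (h.mono fun x hx => by simp only [hx])

theorem l2NormSq_congr {W ι : Type} [HasComponents W ι] [Fintype ι] {D : Set E} {f f' : E → W}
    (h : f =ᵐ[volume.restrict D] f') : l2NormSq D f = l2NormSq D f' :=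
  Finset.sum_congr rfl fun i _ => integral_congr_ae (h.mono fun x hx => by simp only [hx])

theorem l2NormSq_nonneg {W ι : Type} [HasComponents W ι] [Fintype ι] (D : Set E) (f : E → W) :
    0 ≤ l2NormSq D f :=
  Finset.sum_nonneg fun _ _ => integral_nonneg fun _ => sq_nonneg _

/-! ### Calculus of weak divergences -/

section Calculus

variable {D : Set E} {s s' : E → Fin 3 → ℝ} {w w' : E → ℝ}

theorem IsWeakDivRow.congr (h : IsWeakDivRow D s w) (hs : s =ᵐ[volume.restrict D] s')
    (hw : w =ᵐ[volume.restrict D] w') : IsWeakDivRow D s' w' := by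
  intro ψ hψ
  have e1 : ∫ x in D, ∑ l, s x l * HessianSpline.pd l ψ x =
      ∫ x in D, ∑ l, s' x l * HessianSpline.pd l ψ x :=
    integral_congr_ae (hs.mono fun x hx => by simp only [hx])
  have e2 : ∫ x in D, w x * ψ x = ∫ x in D, w' x * ψ x :=
    integral_congr_ae (hw.mono fun x hx => by simp only [hx])
  rw [← e1, ← e2]
  exact h ψ hψ

theorem IsTest.integrable_sum_mul_pd {ψ : E → ℝ} (hψ : IsTest D ψ)
    (hs : ∀ l, IntegrableOn (fun x => s x l) D) :
    IntegrableOn (fun x => ∑ l, s x l * HessianSpline.pd l ψ x) D :=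
  integrable_finsetSum _ fun l _ => (hψ.pd l).integrable_mul (hs l)

theorem IsWeakDivRow.sum {ι : Type*} (t : Finset ι) (c : ι → ℝ) {s : ι → E → Fin 3 → ℝ}
    {w : ι → E → ℝ} (h : ∀ i ∈ t, IsWeakDivRow D (s i) (w i))
    (hs : ∀ i ∈ t, ∀ l, IntegrableOn (fun x => s i x l) D)
    (hw : ∀ i ∈ t, IntegrableOn (w i) D) :
    IsWeakDivRow D (fun x l => ∑ i ∈ t, c i * s i x l) (fun x => ∑ i ∈ t, c i * w i x) := by
  intro ψ hψ
  have e1 : ∀ x, ∑ l, (∑ i ∈ t, c i * s i x l) * HessianSpline.pd l ψ x =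
      ∑ i ∈ t, c i * ∑ l, s i x l * HessianSpline.pd l ψ x := by
    intro x
    simp only [Finset.sum_mul, Finset.mul_sum, mul_assoc]
    exact Finset.sum_comm
  have e2 : ∀ x, (∑ i ∈ t, c i * w i x) * ψ x = ∑ i ∈ t, c i * (w i x * ψ x) := fun x => by
    simp only [Finset.sum_mul, mul_assoc]
  simp only [e1, e2]
  rw [integral_finsetSum _ fun i hi => (hψ.integrable_sum_mul_pd (hs i hi)).const_mul (c i),
    integral_finsetSum _ fun i hi => (hψ.integrable_mul (hw i hi)).const_mul (c i),
    ← Finset.sum_neg_distrib]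
  refine Finset.sum_congr rfl fun i hi => ?_
  rw [integral_const_mul, integral_const_mul, h i hi ψ hψ, mul_neg]

theorem isWeakGrad_iff {φ : E → ℝ} {G : E → Fin 3 → ℝ} :
    IsWeakGrad D φ G ↔ ∀ i, IsWeakDivRow D (fun x => Pi.single i (φ x)) (fun x => G x i) := by
  simp only [IsWeakGrad, IsWeakDivRow, sum_ite_single]

theorem isWeakDiv_iff {T : E → Mat} {v : E → Fin 3 → ℝ} :
    IsWeakDiv D T v ↔ ∀ i, IsWeakDivRow D (fun x => T x i) (fun x => v x i) := Iff.rfl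

/-- The vector field whose divergence is the `j`-th component of the curl of `s`. -/
def curlField (s : Fin 3 → ℝ) (j : Fin 3) : Fin 3 → ℝ :=
  Pi.single (j + 1) (s (j + 2)) - Pi.single (j + 2) (s (j + 1))

theorem sum_curlField (s f : Fin 3 → ℝ) (j : Fin 3) :
    ∑ l, curlField s j l * f l = s (j + 2) * f (j + 1) - s (j + 1) * f (j + 2) := by
  simp only [curlField, Pi.sub_apply, sub_mul, Finset.sum_sub_distrib, sum_ite_single]

theorem isWeakCurl_iff {S C : E → Mat} : IsWeakCurl D S C ↔
    ∀ i j, IsWeakDivRow D (fun x => curlField (S x i) j) (fun x => C x i j) := by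
  simp only [IsWeakCurl, IsWeakDivRow, sum_curlField]

theorem IsWeakGrad.isWeakHess_iff {φ : E → ℝ} {G : E → Fin 3 → ℝ} (hG : IsWeakGrad D φ G)
    {H : E → Mat} : IsWeakHess D φ H ↔
      ∀ i j, IsWeakDivRow D (fun x => Pi.single j (G x i)) (fun x => H x i j) := by
  simp only [IsWeakHess, IsWeakDivRow, sum_ite_single]
  refine forall_congr' fun i => forall_congr' fun j => forall_congr' fun ψ =>
    forall_congr' fun hψ => ?_
  rw [hG i _ (hψ.pd j), neg_eq_iff_eq_neg]

theorem ae_eq_zero_of_forall_isTest (hD : IsOpen D) {f : E → ℝ} (hf : IntegrableOn f D)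
    (h : ∀ ψ, IsTest D ψ → ∫ x in D, f x * ψ x = 0) : f =ᵐ[volume.restrict D] 0 := by
  have := hD.ae_eq_zero_of_integral_contDiff_smul_eq_zero hf.locallyIntegrableOn
    fun ψ h1 h2 h3 => by
      have hψ : IsTest D ψ := ⟨h1, h2, h3⟩
      rw [← h ψ hψ, setIntegral_eq_integral_of_forall_compl_eq_zero]
      · simp only [smul_eq_mul, mul_comm]
      · intro x hx
        rw [hψ.eq_zero hx, mul_zero]
  exact (ae_restrict_iff' hD.measurableSet).2 this

theorem IsWeakDivRow.ae_unique (hD : IsOpen D) (h : IsWeakDivRow D s w) (h' : IsWeakDivRow D s w')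
    (hw : IntegrableOn w D) (hw' : IntegrableOn w' D) : w =ᵐ[volume.restrict D] w' := by
  have : (fun x => w x - w' x) =ᵐ[volume.restrict D] 0 := by
    refine ae_eq_zero_of_forall_isTest hD (hw.sub hw') fun ψ hψ => ?_
    simp only [sub_mul]
    rw [integral_sub (hψ.integrable_mul hw) (hψ.integrable_mul hw')]
    have := (h ψ hψ).symm.trans (h' ψ hψ)
    linarith
  exact this.mono fun x hx => sub_eq_zero.1 hx

theorem IsTest.pd_comm {ψ : E → ℝ} (hψ : IsTest D ψ) (i j : Fin 3) :
    HessianSpline.pd i (HessianSpline.pd j ψ) = HessianSpline.pd j (HessianSpline.pd i ψ) := by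
  funext x
  have hd : DifferentiableAt ℝ (fderiv ℝ ψ) x :=
    (hψ.smooth.fderiv_right (m := (⊤ : ℕ∞)) (by simp)).differentiable (by simp) x
  have h2 : ∀ a b : Fin 3, HessianSpline.pd a (HessianSpline.pd b ψ) x =
      fderiv ℝ (fderiv ℝ ψ) x (Pi.single a 1) (Pi.single b 1) := by
    intro a b
    have : HessianSpline.pd b ψ = fun y => fderiv ℝ ψ y (Pi.single b 1) := rfl
    rw [HessianSpline.pd, this, fderiv_clm_apply hd (differentiableAt_const _)]
    simp
  rw [h2, h2]
  exact ((contDiff_infty.1 hψ.smooth 2).contDiffAt.isSymmSndFDerivAt (by simp)) _ _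

end Calculus

/-! ### The Hessian complex -/

section Complex

variable {D : Set E} [IsFiniteMeasure ((volume : Measure E).restrict D)]

theorem _root_.MeasureTheory.MemLp.integrableOn_two {f : E → ℝ}
    (h : MemLp f 2 (volume.restrict D)) : IntegrableOn f D :=
  h.integrable (by norm_num)

theorem IsH2.isHcurlS (hD : IsOpen D) {φ : E → ℝ} {G : E → Fin 3 → ℝ} {H : E → Mat}
    (h : IsH2 D φ G H) : IsHcurlS D H 0 := by
  have hH : ∀ i j, IntegrableOn (fun x => H x i j) D := fun i j =>
    (memL2_mat_iff.1 h.hess_memL2 i j).integrableOn_two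
  refine ⟨h.hess_memL2, ?_, memL2_mat_iff.2 fun i j => MemLp.zero, ?_⟩
  · have : ∀ i j, (fun x => H x i j - H x j i) =ᵐ[volume.restrict D] 0 := fun i j => by
      refine ae_eq_zero_of_forall_isTest hD ((hH i j).sub (hH j i)) fun ψ hψ => ?_
      simp only [sub_mul]
      rw [integral_sub (hψ.integrable_mul (hH i j)) (hψ.integrable_mul (hH j i)),
        ← h.hess i j ψ hψ, ← h.hess j i ψ hψ, hψ.pd_comm, sub_self]
    have h2 := ae_all_iff.2 fun i => ae_all_iff.2 fun j => this i j
    filter_upwards [h2] with x hx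
    ext i j
    exact (sub_eq_zero.1 (hx i j)).symm
  · intro i j ψ hψ
    rw [integral_sub ((hψ.pd _).integrable_mul (hH _ _)) ((hψ.pd _).integrable_mul (hH _ _)),
      ← h.hess i _ _ (hψ.pd _), ← h.hess i _ _ (hψ.pd _), hψ.pd_comm (j + 2) (j + 1)]
    simp

theorem IsHcurlS.isHdivT (hD : IsOpen D) {S C : E → Mat} (h : IsHcurlS D S C) :
    IsHdivT D C 0 := by
  have hS : ∀ i j, IntegrableOn (fun x => S x i j) D := fun i j =>
    (memL2_mat_iff.1 h.memL2 i j).integrableOn_two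
  have hC : ∀ i j, IntegrableOn (fun x => C x i j) D := fun i j =>
    (memL2_mat_iff.1 h.curl_memL2 i j).integrableOn_two
  refine ⟨h.curl_memL2, ?_, memL2_vec_iff.2 fun i => MemLp.zero, ?_⟩
  · refine ae_eq_zero_of_forall_isTest hD (integrable_finsetSum _ fun i _ => hC i i)
      fun ψ hψ => ?_
    have e : ∀ i, ∫ x in D, C x i i * ψ x =
        (∫ x in D, S x i (i + 1) * pd (i + 2) ψ x) - ∫ x in D, S x i (i + 2) * pd (i + 1) ψ x := by
      intro i
      have := h.curl i i ψ hψ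
      rw [integral_sub ((hψ.pd _).integrable_mul (hS _ _)) ((hψ.pd _).integrable_mul (hS _ _))]
        at this
      linarith
    have hsym : ∀ i j l, ∫ x in D, S x i j * pd l ψ x = ∫ x in D, S x j i * pd l ψ x := by
      intro i j l
      refine integral_congr_ae (h.symm.mono fun x hx => ?_)
      have := congrFun (congrFun hx i) j
      simp only [Matrix.transpose_apply] at this
      simp only [this]
    simp only [Matrix.trace, Matrix.diag, Finset.sum_mul]
    rw [integral_finsetSum _ fun i _ => hψ.integrable_mul (hC i i), Fin.sum_univ_three, e, e, e]
    simp only [Fin.reduceAdd]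
    rw [hsym 0 1, hsym 0 2, hsym 1 2]
    ring
  · intro i ψ hψ
    have e : ∀ j, ∫ x in D, C x i j * pd j ψ x = (∫ x in D, S x i (j + 1) * pd (j + 2) (pd j ψ) x) -
        ∫ x in D, S x i (j + 2) * pd (j + 1) (pd j ψ) x := by
      intro j
      have := h.curl i j _ (hψ.pd j)
      rw [integral_sub (((hψ.pd _).pd _).integrable_mul (hS _ _))
        (((hψ.pd _).pd _).integrable_mul (hS _ _))] at this
      linarith
    rw [integral_finsetSum _ fun j _ => (hψ.pd j).integrable_mul (hC i j), Fin.sum_univ_three,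
      e, e, e]
    simp only [Fin.reduceAdd]
    rw [hψ.pd_comm 1 0, hψ.pd_comm 2 0, hψ.pd_comm 2 1]
    simp

end Complex

end

section

/-! ### Field-valued kernel operators on the cube -/

/-- The components are linear coordinates. -/
class LinearComponents (W : Type) (ι : outParam Type) [HasComponents W ι] [AddCommGroup W]
    [Module ℝ W] where
  equiv : W ≃ₗ[ℝ] (ι → ℝ)
  comp_eq : ∀ w i, HasComponents.comp w i = equiv w i

instance : LinearComponents ℝ Unit where
  equiv := (LinearEquiv.funUnique Unit ℝ ℝ).symm
  comp_eq _ _ := rfl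

instance : LinearComponents (Fin 3 → ℝ) (Fin 3) where
  equiv := LinearEquiv.refl ℝ _
  comp_eq _ _ := rfl

instance : LinearComponents Mat (Fin 3 × Fin 3) where
  equiv := (LinearEquiv.curry ℝ ℝ (Fin 3) (Fin 3)).symm
  comp_eq _ _ := rfl

section Components

variable {W ι : Type} [HasComponents W ι] [AddCommGroup W] [Module ℝ W] [LinearComponents W ι]

theorem comp_add (w w' : W) (i : ι) :
    HasComponents.comp (w + w') i = HasComponents.comp w i + HasComponents.comp w' i := by
  simp [LinearComponents.comp_eq]

theorem comp_smul (c : ℝ) (w : W) (i : ι) :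
    HasComponents.comp (c • w) i = c * HasComponents.comp w i := by
  simp [LinearComponents.comp_eq]

theorem comp_ext {w w' : W} (h : ∀ i : ι, HasComponents.comp w i = HasComponents.comp w' i) :
    w = w' := by
  simp only [LinearComponents.comp_eq] at h
  exact LinearComponents.equiv.injective (funext h)

theorem ae_eq_of_comp [Finite ι] {μ : Measure E} {f f' : E → W}
    (h : ∀ i : ι, (fun x => HasComponents.comp (f x) i) =ᵐ[μ]
      fun x => HasComponents.comp (f' x) i) : f =ᵐ[μ] f' := by
  have := ae_all_iff.2 h
  filter_upwards [this] with x hx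
  exact comp_ext hx

end Components

variable {p r : Fin 3 → ℕ} (K : ∀ l, OpenKnots (p l) (r l)) (g : Fin 3 → ℝ → ℝ)

/-- `P` acts on the `i`-th component as the projection with degree reductions `d i`. -/
def IsKernelOp {W ι : Type} [HasComponents W ι] (d : ι → Fin 3 → Fin 3)
    (P : (E → W) → (E → W)) : Prop :=
  ∀ f, MemL2 cube f → ∀ i, (fun x => HasComponents.comp (P f x) i) =ᵐ[volume.restrict cube]
    kerProj K g (d i) fun x => HasComponents.comp (f x) i

variable {K g}

section KernelOp

variable {W ι : Type} [HasComponents W ι] {d : ι → Fin 3 → Fin 3} {P : (E → W) → (E → W)}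

theorem IsKernelOp.memL2 (hP : IsKernelOp K g d P) (hg : ∀ l, IsTransition (p l) (g l))
    (hr : ∀ l, 1 ≤ r l) {f : E → W} (hf : MemL2 cube f) : MemL2 cube (P f) := fun i =>
  (kerProj_memLp hg hr (d i) (hf i).integrableOn_two).ae_eq (hP f hf i).symm

variable [AddCommGroup W] [Module ℝ W] [LinearComponents W ι] [Fintype ι]

theorem IsKernelOp.isBoundedL2 (hP : IsKernelOp K g d P) (hg : ∀ l, IsTransition (p l) (g l))
    (hr : ∀ l, 1 ≤ r l) {C : ℝ} (hC : ∀ (k : Fin 3 → Fin 3) (v : E → ℝ),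
      MemLp v 2 (volume.restrict cube) →
        ∫ x in cube, kerProj K g k v x ^ 2 ≤ C ^ 2 * ∫ x in cube, v x ^ 2) :
    IsBoundedL2 cube C P where
  memL2 f hf := hP.memL2 hg hr hf
  congr f f' hf hf' h := ae_eq_of_comp fun i => by
    refine (hP f hf i).trans (EventuallyEq.trans ?_ (hP f' hf' i).symm)
    rw [kerProj_congr (v' := fun x => HasComponents.comp (f' x) i) (d i)
      (h.mono fun x hx => by simp only [hx])]
  add f f' hf hf' := ae_eq_of_comp fun i => by
    have hadd : MemL2 cube (f + f') := fun i => by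
      simp only [Pi.add_apply, comp_add]
      exact (hf i).add (hf' i)
    have e := hP (f + f') hadd i
    simp only [Pi.add_apply, comp_add] at e ⊢
    rw [kerProj_add hg hr (d i) (hf i).integrableOn_two (hf' i).integrableOn_two] at e
    filter_upwards [e, hP f hf i, hP f' hf' i] with x h1 h2 h3
    rw [h1, h2, h3]
  smul c f hf := ae_eq_of_comp fun i => by
    have hsm : MemL2 cube (c • f) := fun i => by
      simp only [Pi.smul_apply, comp_smul]
      exact (hf i).const_mul c
    have e := hP (c • f) hsm i
    simp only [Pi.smul_apply, comp_smul] at e ⊢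
    rw [kerProj_smul] at e
    filter_upwards [e, hP f hf i] with x h1 h2
    rw [h1, h2]
  bound f hf := by
    rw [l2NormSq, l2NormSq, Finset.mul_sum]
    refine Finset.sum_le_sum fun i _ => ?_
    rw [integral_congr_ae (g := fun x => kerProj K g (d i) (fun x => HasComponents.comp (f x) i) x ^ 2)
      ((hP f hf i).mono fun x hx => by simp only at hx ⊢; rw [hx])]
    exact hC (d i) _ (hf i)

end KernelOp

variable (hg : ∀ l, IsTransition (p l) (g l)) (hr : ∀ l, 1 ≤ r l)

include hg hr

theorem isKernelOp_hatPi1 : IsKernelOp K g (fun _ => drop1) (hatPi1 K g) := fun f hf _ =>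
  tensorProj_ae_eq_kerProj (v := f) hg hr drop1 (hf ()).integrableOn_two

theorem isKernelOp_hatPi2 : IsKernelOp K g (fun ij => drop2 ij.1 ij.2) (hatPi2 K g) :=
  fun _ hf ij => tensorProj_ae_eq_kerProj hg hr _ (hf ij).integrableOn_two

theorem isKernelOp_hatPi3 : IsKernelOp K g (fun ij => drop3 ij.1 ij.2) (hatPi3 K g) :=
  fun _ hf ij => tensorProj_ae_eq_kerProj hg hr _ (hf ij).integrableOn_two

theorem isKernelOp_hatPi4 : IsKernelOp K g drop4 (hatPi4 K g) :=
  fun _ hf i => tensorProj_ae_eq_kerProj hg hr _ (hf i).integrableOn_two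

theorem hatPi1_ae {φ : E → ℝ} (hφ : MemL2 cube φ) :
    hatPi1 K g φ =ᵐ[volume.restrict cube] kerProj K g drop1 φ :=
  isKernelOp_hatPi1 hg hr φ hφ ()

theorem hatPi2_ae {S : E → Mat} (hS : MemL2 cube S) : hatPi2 K g S =ᵐ[volume.restrict cube]
    fun x => Matrix.of fun i j => kerProj K g (drop2 i j) (fun y => S y i j) x :=
  ae_eq_of_comp fun ij => isKernelOp_hatPi2 hg hr S hS ij

theorem hatPi3_ae {T : E → Mat} (hT : MemL2 cube T) : hatPi3 K g T =ᵐ[volume.restrict cube]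
    fun x => Matrix.of fun i j => kerProj K g (drop3 i j) (fun y => T y i j) x :=
  ae_eq_of_comp fun ij => isKernelOp_hatPi3 hg hr T hT ij

theorem hatPi4_ae {v : E → Fin 3 → ℝ} (hv : MemL2 cube v) : hatPi4 K g v =ᵐ[volume.restrict cube]
    fun x i => kerProj K g (drop4 i) (fun y => v y i) x :=
  ae_eq_of_comp fun i => isKernelOp_hatPi4 hg hr v hv i

/-! ### The projections map into the spline spaces -/

theorem hatPi1_mem {φ : E → ℝ} (hφ : MemL2 cube φ) : hatPi1 K g φ ∈ hatV1 K :=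
  ⟨_, kerProj_mem hg hr _ (hφ ()).integrableOn_two, hatPi1_ae hg hr hφ⟩

theorem hatPi2_mem {S : E → Mat} (hS : MemL2 cube S)
    (hsym : ∀ᵐ x ∂(volume.restrict cube), (S x).transpose = S x) : hatPi2 K g S ∈ hatV2 K := by
  refine ⟨fun x => Matrix.of fun i j => kerProj K g (drop2 i j) (fun y => S y i j) x,
    fun i j => kerProj_mem hg hr _ (hS (i, j)).integrableOn_two, fun x => ?_, hatPi2_ae hg hr hS⟩
  ext i j
  have hd : ∀ i j, drop2 i j = drop2 j i := by decide
  simp only [Matrix.transpose_apply, Matrix.of_apply]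
  rw [hd j i, kerProj_congr (drop2 i j) (hsym.mono fun y hy => ?_)]
  exact congrFun (congrFun hy i) j

theorem hatPi3_mem {T : E → Mat} (hT : MemL2 cube T)
    (htr : ∀ᵐ x ∂(volume.restrict cube), (T x).trace = 0) : hatPi3 K g T ∈ hatV3 K := by
  refine ⟨fun x => Matrix.of fun i j => kerProj K g (drop3 i j) (fun y => T y i j) x,
    fun i j => kerProj_mem hg hr _ (hT (i, j)).integrableOn_two, fun x => ?_, hatPi3_ae hg hr hT⟩
  have hd : ∀ i, drop3 i i = drop3 0 0 := by decide
  simp only [Matrix.trace, Matrix.diag, Matrix.of_apply, hd, kerProj]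
  rw [← integral_finsetSum _ fun i _ => integrableOn_cubeKernel_mul hg hr _
    (memL2_mat_iff.1 hT i i).integrableOn_two x, ← integral_zero E ℝ (μ := volume.restrict cube)]
  refine integral_congr_ae (htr.mono fun y hy => ?_)
  simp only [← Finset.mul_sum]
  rw [Matrix.trace] at hy
  simp only [Matrix.diag] at hy
  rw [hy, mul_zero]

theorem hatPi4_mem {v : E → Fin 3 → ℝ} (hv : MemL2 cube v) : hatPi4 K g v ∈ hatV4 K :=
  ⟨_, fun i => kerProj_mem hg hr _ (hv i).integrableOn_two, hatPi4_ae hg hr hv⟩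

omit hg hr

theorem hatV1_memL2 {φ : E → ℝ} (hφ : φ ∈ hatV1 K) : MemL2 cube φ := by
  obtain ⟨s, hs, h⟩ := hφ
  exact MemL2.congr (fun _ => tensorSpace_memLp hs) h.symm

theorem hatV4_memL2 {v : E → Fin 3 → ℝ} (hv : v ∈ hatV4 K) : MemL2 cube v := by
  obtain ⟨s, hs, h⟩ := hv
  exact MemL2.congr (fun i => tensorSpace_memLp (hs i)) h.symm

include hg hr

theorem IsKernelOp.ae_eq_self {W ι : Type} [HasComponents W ι] [AddCommGroup W] [Module ℝ W]
    [LinearComponents W ι] [Finite ι] {d : ι → Fin 3 → Fin 3} {P : (E → W) → (E → W)}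
    (hP : IsKernelOp K g d P) {f s : E → W}
    (hs : ∀ i, (fun x => HasComponents.comp (s x) i) ∈ tensorSpace K (d i))
    (h : f =ᵐ[volume.restrict cube] s) : P f =ᵐ[volume.restrict cube] f := by
  have hf : MemL2 cube f := MemL2.congr (fun i => tensorSpace_memLp (hs i)) h.symm
  refine EventuallyEq.trans (ae_eq_of_comp fun i => ?_) h.symm
  refine (hP f hf i).trans ?_
  rw [kerProj_congr (v' := fun x => HasComponents.comp (s x) i) (d i)
    (h.mono fun x hx => by simp only [hx]), kerProj_eq_self hg hr _ (hs i)]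

theorem hatPi1_eq_self {φ : E → ℝ} (hφ : φ ∈ hatV1 K) :
    hatPi1 K g φ =ᵐ[volume.restrict cube] φ := by
  obtain ⟨s, hs, h⟩ := hφ
  exact (isKernelOp_hatPi1 hg hr).ae_eq_self hg hr (fun _ => hs) h

theorem hatPi2_eq_self {S : E → Mat} (hS : S ∈ hatV2 K) :
    hatPi2 K g S =ᵐ[volume.restrict cube] S := by
  obtain ⟨s, hs, -, h⟩ := hS
  exact (isKernelOp_hatPi2 hg hr).ae_eq_self hg hr (fun ij => hs ij.1 ij.2) h

theorem hatPi3_eq_self {T : E → Mat} (hT : T ∈ hatV3 K) :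
    hatPi3 K g T =ᵐ[volume.restrict cube] T := by
  obtain ⟨s, hs, -, h⟩ := hT
  exact (isKernelOp_hatPi3 hg hr).ae_eq_self hg hr (fun ij => hs ij.1 ij.2) h

theorem hatPi4_eq_self {v : E → Fin 3 → ℝ} (hv : v ∈ hatV4 K) :
    hatPi4 K g v =ᵐ[volume.restrict cube] v := by
  obtain ⟨s, hs, h⟩ := hv
  exact (isKernelOp_hatPi4 hg hr).ae_eq_self hg hr hs h

end

section

/-! ### Commuting projections on the cube -/

theorem isOpen_cube : IsOpen cube := isOpen_set_pi finite_univ fun _ _ => isOpen_Ioo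

theorem curlField_self (a : Fin 3 → ℝ) (j : Fin 3) : curlField a j j = 0 := by
  have h1 : j ≠ j + 1 := by revert j; decide
  have h2 : j ≠ j + 2 := (by decide : ∀ j : Fin 3, j ≠ j + 2) j
  simp [curlField, h1, h2]

theorem curlField_add_one (a : Fin 3 → ℝ) (j : Fin 3) : curlField a j (j + 1) = a (j + 2) := by
  have h1 : j + 1 ≠ j + 2 := by revert j; decide
  simp [curlField, h1]

theorem curlField_add_two (a : Fin 3 → ℝ) (j : Fin 3) : curlField a j (j + 2) = -a (j + 1) := by
  have h1 : j + 2 ≠ j + 1 := by revert j; decide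
  simp [curlField, h1]

section Congr

variable {D : Set E}

theorem IsH2.congr {φ φ' : E → ℝ} {G G' : E → Fin 3 → ℝ} {H H' : E → Mat} (h : IsH2 D φ G H)
    (hφ : φ =ᵐ[volume.restrict D] φ') (hG : G =ᵐ[volume.restrict D] G')
    (hH : H =ᵐ[volume.restrict D] H') : IsH2 D φ' G' H' := by
  have hgrad : IsWeakGrad D φ' G' := isWeakGrad_iff.2 fun i => (isWeakGrad_iff.1 h.grad i).congr
    (hφ.mono fun x hx => by simp only [hx]) (hG.mono fun x hx => by simp only [hx])
  exact ⟨h.memL2.congr hφ, h.grad_memL2.congr hG, h.hess_memL2.congr hH, hgrad,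
    hgrad.isWeakHess_iff.2 fun i j => (h.grad.isWeakHess_iff.1 h.hess i j).congr
      (hG.mono fun x hx => by simp only [hx]) (hH.mono fun x hx => by simp only [hx])⟩

theorem IsHcurlS.congr {S S' C C' : E → Mat} (h : IsHcurlS D S C)
    (hS : S =ᵐ[volume.restrict D] S') (hC : C =ᵐ[volume.restrict D] C') : IsHcurlS D S' C' := by
  refine ⟨h.memL2.congr hS, ?_, h.curl_memL2.congr hC, isWeakCurl_iff.2 fun i j =>
    (isWeakCurl_iff.1 h.curl i j).congr (hS.mono fun x hx => by simp only [hx])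
      (hC.mono fun x hx => by simp only [hx])⟩
  filter_upwards [h.symm, hS] with x h1 h2
  rw [← h2, h1]

theorem IsHdivT.congr {T T' : E → Mat} {v v' : E → Fin 3 → ℝ} (h : IsHdivT D T v)
    (hT : T =ᵐ[volume.restrict D] T') (hv : v =ᵐ[volume.restrict D] v') : IsHdivT D T' v' := by
  refine ⟨h.memL2.congr hT, ?_, h.div_memL2.congr hv, isWeakDiv_iff.2 fun i =>
    (isWeakDiv_iff.1 h.div i).congr (hT.mono fun x hx => by simp only [hx])
      (hv.mono fun x hx => by simp only [hx])⟩
  filter_upwards [h.trace, hT] with x h1 h2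
  rw [← h2, h1]

end Congr

variable {p r : Fin 3 → ℕ} {K : ∀ l, OpenKnots (p l) (r l)} {g : Fin 3 → ℝ → ℝ}

theorem kerProj_zero (k : Fin 3 → Fin 3) : kerProj K g k (fun _ => 0) = fun _ => 0 := by
  funext x; simp [kerProj]

theorem kerProj_neg (k : Fin 3 → Fin 3) (v : E → ℝ) :
    kerProj K g k (fun x => -v x) = fun x => -kerProj K g k v x := by
  funext x; simp [kerProj, integral_neg]

variable (hg : ∀ l, IsTransition (p l) (g l)) (hr : ∀ l, 1 ≤ r l)

include hg hr

theorem IsWeakDivRow.kerProj_single {i : Fin 3} {f w : E → ℝ}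
    (h : IsWeakDivRow cube (fun x => Pi.single i (f x)) w) (hf : IntegrableOn f cube)
    (hw : IntegrableOn w cube) {m k : Fin 3 → Fin 3} (hk : (k i : ℕ) = m i + 1)
    (hm : ∀ j, j ≠ i → m j = k j) :
    IsWeakDivRow cube (fun x => Pi.single i (HessianSpline.kerProj K g m f x))
      (HessianSpline.kerProj K g k w) := by
  have key := h.kerProj hg hr (K := K) (k := k) (m := fun _ => m) (fun l => by
    by_cases hl : l = i
    · subst hl; simpa using hf
    · simp [hl]) hw (fun l => by
    by_cases hl : l = i
    · subst hl; exact Or.inr ⟨hk, hm⟩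
    · exact Or.inl fun x => by simp [hl])
  refine key.congr (Eventually.of_forall fun x => ?_) EventuallyEq.rfl
  funext l
  by_cases hl : l = i
  · subst hl; simp
  · simp [hl, kerProj_zero]

/-- Degree reductions for the components of gradients. -/
def dropGrad (i : Fin 3) : Fin 3 → Fin 3 := Pi.single i 1

/-- The projection of gradients on the cube. -/
def gradProj {p r : Fin 3 → ℕ} (K : ∀ l, OpenKnots (p l) (r l)) (g : Fin 3 → ℝ → ℝ)
    (G : E → Fin 3 → ℝ) : E → Fin 3 → ℝ :=
  fun x i => kerProj K g (dropGrad i) (fun y => G y i) x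

omit hg hr in
theorem isKernelOp_gradProj : IsKernelOp K g dropGrad (gradProj K g) := fun _ _ _ =>
  EventuallyEq.rfl

theorem isH2_hatPi {φ : E → ℝ} {G : E → Fin 3 → ℝ} {H : E → Mat} (h : IsH2 cube φ G H) :
    IsH2 cube (hatPi1 K g φ) (gradProj K g G) (hatPi2 K g H) := by
  have hφ := (memL2_scalar_iff.1 h.memL2).integrableOn_two
  have hG := fun i => (memL2_vec_iff.1 h.grad_memL2 i).integrableOn_two
  have hH := fun i j => (memL2_mat_iff.1 h.hess_memL2 i j).integrableOn_two
  have e1 := hatPi1_ae (K := K) hg hr h.memL2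
  have e2 := hatPi2_ae (K := K) hg hr h.hess_memL2
  refine IsH2.congr (φ := kerProj K g drop1 φ) (H := fun x => Matrix.of fun i j =>
    kerProj K g (drop2 i j) (fun y => H y i j) x) (G := gradProj K g G) ?_ e1.symm
    EventuallyEq.rfl e2.symm
  have d1 : ∀ i, ((dropGrad i i : Fin 3) : ℕ) = drop1 i + 1 := by decide
  have d2 : ∀ i j, j ≠ i → drop1 j = dropGrad i j := by decide
  have d3 : ∀ i j, ((drop2 i j j : Fin 3) : ℕ) = dropGrad i j + 1 := by decide
  have d4 : ∀ i j j', j' ≠ j → dropGrad i j' = drop2 i j j' := by decide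
  have hgrad : IsWeakGrad cube (kerProj K g drop1 φ) (gradProj K g G) :=
    isWeakGrad_iff.2 fun i => (isWeakGrad_iff.1 h.grad i).kerProj_single hg hr hφ (hG i) (d1 i)
      (d2 i)
  refine ⟨MemL2.congr ((isKernelOp_hatPi1 hg hr).memL2 hg hr h.memL2) e1,
    isKernelOp_gradProj.memL2 hg hr h.grad_memL2,
    MemL2.congr ((isKernelOp_hatPi2 hg hr).memL2 hg hr h.hess_memL2) e2, hgrad,
    hgrad.isWeakHess_iff.2 fun i j => ?_⟩
  exact (h.grad.isWeakHess_iff.1 h.hess i j).kerProj_single hg hr (hG i) (hH i j) (d3 i j) (d4 i j)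

theorem isWeakDivRow_curlField_kerProj {s : E → Fin 3 → ℝ} {w : E → ℝ} {i j : Fin 3}
    (h : IsWeakDivRow cube (fun x => curlField (s x) j) w)
    (hs : ∀ l, IntegrableOn (fun x => s x l) cube) (hw : IntegrableOn w cube) :
    IsWeakDivRow cube (fun x => curlField (fun l => kerProj K g (drop2 i l) (fun y => s y l) x) j)
      (kerProj K g (drop3 i j) w) := by
  have h0 := fun a => curlField_self a j
  have h1 := fun a => curlField_add_one a j
  have h2 := fun a => curlField_add_two a j
  have hcases : ∀ l, l = j ∨ l = j + 1 ∨ l = j + 2 :=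
    (by decide : ∀ j l : Fin 3, l = j ∨ l = j + 1 ∨ l = j + 2) j
  have d1 : ∀ i j, ((drop3 i j (j + 1) : Fin 3) : ℕ) = drop2 i (j + 2) (j + 1) + 1 := by decide
  have d2 : ∀ i j j', j' ≠ j + 1 → drop2 i (j + 2) j' = drop3 i j j' := by decide
  have d3 : ∀ i j, ((drop3 i j (j + 2) : Fin 3) : ℕ) = drop2 i (j + 1) (j + 2) + 1 := by decide
  have d4 : ∀ i j j', j' ≠ j + 2 → drop2 i (j + 1) j' = drop3 i j j' := by decide
  set m : Fin 3 → Fin 3 → Fin 3 := fun l => if l = j + 1 then drop2 i (j + 2) else drop2 i (j + 1)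
    with hm
  have hne : j + 2 ≠ j + 1 := (by decide : ∀ j : Fin 3, j + 2 ≠ j + 1) j
  have key := h.kerProj hg hr (K := K) (k := drop3 i j) (m := m) (fun l => by
    rcases hcases l with rfl | rfl | rfl
    · simp only [h0]; exact integrableOn_zero
    · simp only [h1]; exact hs _
    · simp only [h2]; exact (hs _).neg) hw (fun l => by
    rcases hcases l with rfl | rfl | rfl
    · exact Or.inl fun x => h0 _
    · refine Or.inr ?_
      simp only [hm, if_true]
      exact ⟨d1 i j, d2 i j⟩
    · refine Or.inr ?_
      simp only [hm, if_neg hne]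
      exact ⟨d3 i j, d4 i j⟩)
  refine key.congr (Eventually.of_forall fun x => ?_) EventuallyEq.rfl
  funext l
  rcases hcases l with rfl | rfl | rfl
  · simp only [h0, kerProj_zero]
  · simp only [h1, hm, if_true]
  · simp only [h2, hm, if_neg hne, kerProj_neg]

theorem isHcurlS_hatPi {S C : E → Mat} (h : IsHcurlS cube S C) :
    IsHcurlS cube (hatPi2 K g S) (hatPi3 K g C) := by
  have hS := fun i j => (memL2_mat_iff.1 h.memL2 i j).integrableOn_two
  have hC := fun i j => (memL2_mat_iff.1 h.curl_memL2 i j).integrableOn_two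
  have e1 := hatPi2_ae (K := K) hg hr h.memL2
  have e2 := hatPi3_ae (K := K) hg hr h.curl_memL2
  refine ⟨(isKernelOp_hatPi2 hg hr).memL2 hg hr h.memL2, ?_,
    (isKernelOp_hatPi3 hg hr).memL2 hg hr h.curl_memL2, ?_⟩
  · obtain ⟨s, -, hs, h⟩ := hatPi2_mem (K := K) hg hr h.memL2 h.symm
    filter_upwards [h] with x hx
    rw [hx, hs]
  · refine isWeakCurl_iff.2 fun i j => ?_
    refine (isWeakDivRow_curlField_kerProj (K := K) (i := i) hg hr (isWeakCurl_iff.1 h.curl i j) (hS i)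
      (hC i j)).congr (e1.symm.mono fun x hx => ?_) (e2.symm.mono fun x hx => ?_)
    · simp only [← hx]; rfl
    · simp only [← hx]; rfl

theorem isHdivT_hatPi {T : E → Mat} {v : E → Fin 3 → ℝ} (h : IsHdivT cube T v) :
    IsHdivT cube (hatPi3 K g T) (hatPi4 K g v) := by
  have hT := fun i j => (memL2_mat_iff.1 h.memL2 i j).integrableOn_two
  have hv := fun i => (memL2_vec_iff.1 h.div_memL2 i).integrableOn_two
  have e1 := hatPi3_ae (K := K) hg hr h.memL2
  have e2 := hatPi4_ae (K := K) hg hr h.div_memL2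
  refine ⟨(isKernelOp_hatPi3 hg hr).memL2 hg hr h.memL2, ?_,
    (isKernelOp_hatPi4 hg hr).memL2 hg hr h.div_memL2, ?_⟩
  · obtain ⟨s, -, hs, h⟩ := hatPi3_mem (K := K) hg hr h.memL2 h.trace
    filter_upwards [h] with x hx
    rw [hx, hs]
  · refine isWeakDiv_iff.2 fun i => ?_
    have d1 : ∀ i l, ((drop4 i l : Fin 3) : ℕ) = drop3 i l l + 1 := by decide
    have d2 : ∀ i l j, j ≠ l → drop3 i l j = drop4 i j := by decide
    refine ((isWeakDiv_iff.1 h.div i).kerProj (K := K) hg hr (hT i) (hv i) (k := drop4 i)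
      (m := drop3 i) fun l => Or.inr ⟨d1 i l, d2 i l⟩).congr (e1.symm.mono fun x hx => ?_)
      (e2.symm.mono fun x hx => ?_)
    · simp only [← hx]; rfl
    · simp only [← hx]

end

section

/-! ### The spline spaces on the cube form a subcomplex -/

theorem IsWeakDivRow.sub {D : Set E} {s s' : E → Fin 3 → ℝ} {w w' : E → ℝ}
    (h : IsWeakDivRow D s w) (h' : IsWeakDivRow D s' w')
    (hs : ∀ l, IntegrableOn (fun x => s x l) D) (hs' : ∀ l, IntegrableOn (fun x => s' x l) D)
    (hw : IntegrableOn w D) (hw' : IntegrableOn w' D) :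
    IsWeakDivRow D (fun x => s x - s' x) (fun x => w x - w' x) := by
  intro ψ hψ
  simp only [Pi.sub_apply, sub_mul, Finset.sum_sub_distrib]
  rw [integral_sub (hψ.integrable_sum_mul_pd hs) (hψ.integrable_sum_mul_pd hs'),
    integral_sub (hψ.integrable_mul hw) (hψ.integrable_mul hw'), h ψ hψ, h' ψ hψ]
  ring

theorem integrableOn_single {D : Set E} {f : E → ℝ} (hf : IntegrableOn f D) (i l : Fin 3) :
    IntegrableOn (fun x => (Pi.single i (f x) : Fin 3 → ℝ) l) D := by
  by_cases hl : l = i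
  · subst hl; simpa using hf
  · simp [hl]

variable {p r : Fin 3 → ℕ} {K : ∀ l, OpenKnots (p l) (r l)} {g : Fin 3 → ℝ → ℝ}

theorem exists_isH2_of_mem_hatV1 (hg : ∀ l, IsTransition (p l) (g l)) (hr : ∀ l, 1 ≤ r l)
    {φ : E → ℝ} (hφ : φ ∈ hatV1 K) : ∃ G H, IsH2 cube φ G H ∧ H ∈ hatV2 K := by
  obtain ⟨s, hs, h⟩ := id hφ
  have d1 : ∀ i, ((drop1 i : Fin 3) : ℕ) < 2 := by decide
  have d2 : ∀ i j, ((Function.update drop1 i (drop1 i + 1) j : Fin 3) : ℕ) < 2 := by decide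
  choose G hG hG' using fun i => exists_weakDeriv_of_mem_tensorSpace hr hs (d1 i)
  choose H hH hH' using fun i j => exists_weakDeriv_of_mem_tensorSpace hr (hG i) (d2 i j)
  have hgrad : IsWeakGrad cube s fun x i => G i x := isWeakGrad_iff.2 hG'
  have h2 : IsH2 cube s (fun x i => G i x) (fun x => Matrix.of fun i j => H i j x) :=
    ⟨memL2_scalar_iff.2 (tensorSpace_memLp hs),
      memL2_vec_iff.2 fun i => tensorSpace_memLp (hG i),
      memL2_mat_iff.2 fun i j => tensorSpace_memLp (hH i j), hgrad,
      hgrad.isWeakHess_iff.2 hH'⟩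
  have h3 := h2.congr h.symm EventuallyEq.rfl EventuallyEq.rfl
  exact ⟨_, _, (isH2_hatPi (K := K) hg hr h3).congr (hatPi1_eq_self hg hr hφ) EventuallyEq.rfl
    EventuallyEq.rfl, hatPi2_mem hg hr h3.hess_memL2 (h3.isHcurlS isOpen_cube).symm⟩

theorem exists_isHcurlS_of_mem_hatV2 (hg : ∀ l, IsTransition (p l) (g l)) (hr : ∀ l, 1 ≤ r l)
    {S : E → Mat} (hS : S ∈ hatV2 K) : ∃ C, IsHcurlS cube S C ∧ C ∈ hatV3 K := by
  obtain ⟨s, hs, hsym, h⟩ := id hS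
  have d1 : ∀ i j, ((drop2 i (j + 2) (j + 1) : Fin 3) : ℕ) < 2 := by decide
  have d2 : ∀ i j, ((drop2 i (j + 1) (j + 2) : Fin 3) : ℕ) < 2 := by decide
  choose X hX hX' using fun i j =>
    exists_weakDeriv_of_mem_tensorSpace hr (hs i (j + 2)) (d1 i j)
  choose Y hY hY' using fun i j =>
    exists_weakDeriv_of_mem_tensorSpace hr (hs i (j + 1)) (d2 i j)
  have hsI := fun i j => integrableOn_of_memLp (tensorSpace_memLp (hs i j))
  have h2 : IsHcurlS cube s (fun x => Matrix.of fun i j => X i j x - Y i j x) :=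
    ⟨memL2_mat_iff.2 fun i j => tensorSpace_memLp (hs i j), Eventually.of_forall hsym,
      memL2_mat_iff.2 fun i j => (tensorSpace_memLp (hX i j)).sub (tensorSpace_memLp (hY i j)),
      isWeakCurl_iff.2 fun i j => (hX' i j).sub (hY' i j)
        (integrableOn_single (hsI _ _) _) (integrableOn_single (hsI _ _) _)
        (integrableOn_of_memLp (tensorSpace_memLp (hX i j)))
        (integrableOn_of_memLp (tensorSpace_memLp (hY i j)))⟩
  have h3 := h2.congr h.symm EventuallyEq.rfl
  exact ⟨_, (isHcurlS_hatPi (K := K) hg hr h3).congr (hatPi2_eq_self hg hr hS) EventuallyEq.rfl,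
    hatPi3_mem hg hr h3.curl_memL2 (h3.isHdivT isOpen_cube).trace⟩

theorem exists_isHdivT_of_mem_hatV3 (hg : ∀ l, IsTransition (p l) (g l)) (hr : ∀ l, 1 ≤ r l)
    {T : E → Mat} (hT : T ∈ hatV3 K) : ∃ v, IsHdivT cube T v ∧ v ∈ hatV4 K := by
  obtain ⟨s, hs, htr, h⟩ := id hT
  have d1 : ∀ i j, ((drop3 i j j : Fin 3) : ℕ) < 2 := by decide
  choose X hX hX' using fun i j => exists_weakDeriv_of_mem_tensorSpace hr (hs i j) (d1 i j)
  have hsI := fun i j => integrableOn_of_memLp (tensorSpace_memLp (hs i j))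
  have h2 : IsHdivT cube s (fun x i => ∑ j, 1 * X i j x) := by
    refine ⟨memL2_mat_iff.2 fun i j => tensorSpace_memLp (hs i j), Eventually.of_forall htr,
      memL2_vec_iff.2 fun i => memLp_finsetSum _ fun j _ =>
        (tensorSpace_memLp (hX i j)).const_mul 1, isWeakDiv_iff.2 fun i => ?_⟩
    refine (IsWeakDivRow.sum Finset.univ (fun _ => 1) (fun j _ => hX' i j)
      (fun j _ => integrableOn_single (hsI i j) j)
      (fun j _ => integrableOn_of_memLp (tensorSpace_memLp (hX i j)))).congr
      (Eventually.of_forall fun x => ?_) EventuallyEq.rfl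
    funext l
    simp only [one_mul, Pi.single_apply]
    rw [Finset.sum_ite_eq]
    simp
  have h3 := h2.congr h.symm EventuallyEq.rfl
  exact ⟨_, (isHdivT_hatPi (K := K) hg hr h3).congr (hatPi3_eq_self hg hr hT) EventuallyEq.rfl,
    hatPi4_mem hg hr h3.div_memL2⟩

/-! ### Affine functions are splines -/

theorem prod_sum_mem_tensorSpace (c : Fin 3 → ℕ → ℝ) :
    (fun x : E => ∏ l, ∑ i ∈ Finset.range (K l).n, c l i * bspline (K l).ξ (p l) i (x l)) ∈
      tensorSpace K drop1 := by
  have d : ∀ l, ((drop1 l : Fin 3) : ℕ) = 0 := by decide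
  have e : (fun x : E => ∏ l, ∑ i ∈ Finset.range (K l).n, c l i * bspline (K l).ξ (p l) i (x l)) =
      ∑ j ∈ Fintype.piFinset fun l => Finset.range (K l).n, (∏ l, c l (j l)) •
        fun x : E => ∏ l, bspline (K l).ξ (p l) (j l) (x l) := by
    funext x
    rw [Finset.sum_apply, Finset.prod_univ_sum]
    simp only [Finset.prod_mul_distrib, Pi.smul_apply, smul_eq_mul]
  rw [e]
  refine Submodule.sum_mem _ fun j hj => Submodule.smul_mem _ _ (Submodule.subset_span ⟨j, ?_, ?_⟩)
  · intro l
    rw [d l]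
    exact ⟨Nat.zero_le _, Finset.mem_range.1 (Fintype.mem_piFinset.1 hj l)⟩
  · simp only [d, Nat.sub_zero]

theorem P1_subset_hatV1 {q : E → ℝ} (hq : q ∈ P1) : q ∈ hatV1 K := by
  obtain ⟨c, a, hq⟩ := hq
  set γ : ∀ l, ℕ → ℝ := fun l i => (∑ ν ∈ Finset.range (p l), (K l).ξ (i + ν + 1)) / p l with hγ
  set t : Fin 3 → E → ℝ := fun l x => ∏ m, ∑ i ∈ Finset.range (K m).n,
    (if m = l then γ m i else 1) * bspline (K m).ξ (p m) i (x m) with ht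
  set o : E → ℝ := fun x => ∏ m, ∑ i ∈ Finset.range (K m).n,
    (fun _ _ => 1 : Fin 3 → ℕ → ℝ) m i * bspline (K m).ξ (p m) i (x m) with ho
  refine ⟨c • o + ∑ l, a l • t l, Submodule.add_mem _ (Submodule.smul_mem _ _
    (prod_sum_mem_tensorSpace _)) (Submodule.sum_mem _ fun l _ => Submodule.smul_mem _ _
    (prod_sum_mem_tensorSpace fun m i => if m = l then γ m i else 1)), ?_⟩
  refine (ae_restrict_iff' measurableSet_cube).2 (Eventually.of_forall fun x hx => ?_)
  have hx' : ∀ m, x m ∈ Ico (0 : ℝ) 1 := fun m => Ioo_subset_Ico_self (hx m (mem_univ m))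
  have h1 : ∀ m, ∑ i ∈ Finset.range (K m).n, bspline (K m).ξ (p m) i (x m) = 1 := fun m =>
    (K m).sum_bspline le_rfl (hx' m)
  have h2 : ∀ m, ∑ i ∈ Finset.range (K m).n, γ m i * bspline (K m).ξ (p m) i (x m) = x m := by
    intro m
    have hp : (p m : ℝ) ≠ 0 := by have := (K m).lt; exact_mod_cast (by omega : p m ≠ 0)
    have := (K m).sum_greville le_rfl (hx' m)
    simp only [hγ, div_mul_eq_mul_div]
    rw [← Finset.sum_div, this]
    field_simp
  have h3 : o x = 1 := by simp only [ho, one_mul, h1, Finset.prod_const_one]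
  have h4 : ∀ l, t l x = x l := by
    intro l
    simp only [ht]
    rw [Finset.prod_eq_single l]
    · simp only [if_true, h2]
    · intro m _ hm
      simp only [if_neg hm, one_mul, h1]
    · simp
  rw [hq]
  simp [h3, h4, dotProduct]

end

section

/-! ### Affine changes of variables -/

theorem continuous_param (A : Mat) (b : E) : Continuous (param A b) :=
  ((Matrix.toLin' A).continuous_of_finiteDimensional).add continuous_const

theorem continuous_paramInv (A : Mat) (b : E) : Continuous (paramInv A b) :=
  ((Matrix.toLin' A⁻¹).continuous_of_finiteDimensional).comp (continuous_id.sub continuous_const)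

/-- The affine parametrization as a homeomorphism. -/
def paramHomeo {A : Mat} (hA : A.det ≠ 0) (b : E) : E ≃ₜ E where
  toFun := param A b
  invFun := paramInv A b
  left_inv := paramInv_param hA b
  right_inv := param_paramInv hA b
  continuous_toFun := continuous_param A b
  continuous_invFun := continuous_paramInv A b

theorem measurableEmbedding_param {A : Mat} (hA : A.det ≠ 0) (b : E) :
    MeasurableEmbedding (param A b) :=
  (paramHomeo hA b).measurableEmbedding

theorem map_param {A : Mat} (hA : A.det ≠ 0) (b : E) (D : Set E) :
    Measure.map (param A b) (volume.restrict D) =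
      ENNReal.ofReal |A.det⁻¹| • volume.restrict (param A b '' D) := by
  have h1 : Measure.map (param A b) volume = ENNReal.ofReal |A.det⁻¹| • volume := by
    have e : param A b = (fun x => x + b) ∘ Matrix.toLin' A := rfl
    rw [e, ← Measure.map_map (measurable_add_const b)
      (Matrix.toLin' A).continuous_of_finiteDimensional.measurable,
      Real.map_matrix_volume_pi_eq_smul_volume_pi hA, Measure.map_smul, map_add_right_eq_self]
  rw [← Measure.restrict_smul, ← h1, (measurableEmbedding_param hA b).restrict_map,
    preimage_image_eq _ (measurableEmbedding_param hA b).injective]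

theorem ofReal_abs_det_inv_ne_zero {A : Mat} (hA : A.det ≠ 0) :
    ENNReal.ofReal |A.det⁻¹| ≠ 0 := by
  simpa using hA

theorem ae_param_iff {A : Mat} (hA : A.det ≠ 0) (b : E) (D : Set E) {P : E → Prop} :
    (∀ᵐ y ∂(volume.restrict (param A b '' D)), P y) ↔
      ∀ᵐ x ∂(volume.restrict D), P (param A b x) := by
  rw [← (measurableEmbedding_param hA b).ae_map_iff, map_param hA,
    Measure.ae_ennreal_smul_measure_eq (ofReal_abs_det_inv_ne_zero hA)]

theorem memLp_param {A : Mat} (hA : A.det ≠ 0) (b : E) {D : Set E} {f : E → ℝ}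
    (hf : MemLp f 2 (volume.restrict (param A b '' D))) :
    MemLp (fun x => f (param A b x)) 2 (volume.restrict D) := by
  have h := hf.smul_measure (c := ENNReal.ofReal |A.det⁻¹|) ENNReal.ofReal_ne_top
  rw [← map_param hA] at h
  exact (measurableEmbedding_param hA b).memLp_map_measure_iff.1 h

theorem integral_param {A : Mat} (hA : A.det ≠ 0) (b : E) (D : Set E) (f : E → ℝ) :
    ∫ x in D, f (param A b x) = |A.det|⁻¹ * ∫ y in param A b '' D, f y := by
  rw [← (measurableEmbedding_param hA b).integral_map, map_param hA, integral_smul_measure,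
    ENNReal.toReal_ofReal (abs_nonneg _), abs_inv, smul_eq_mul]

theorem isOpen_param_image {A : Mat} (hA : A.det ≠ 0) (b : E) {D : Set E} (hD : IsOpen D) :
    IsOpen (param A b '' D) :=
  (paramHomeo hA b).isOpenMap D hD

instance (A : Mat) (b : E) : IsFiniteMeasure ((volume : Measure E).restrict (physDomain A b)) := by
  refine ⟨?_⟩
  rw [Measure.restrict_apply_univ]
  have hc : IsCompact (Set.pi univ fun _ : Fin 3 => Icc (0 : ℝ) 1) :=
    isCompact_univ_pi fun _ => isCompact_Icc
  refine (measure_mono (image_mono ?_)).trans_lt (hc.image (continuous_param A b)).measure_lt_top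
  exact pi_mono fun _ _ => Ioo_subset_Icc_self

/-- The translation vector of the inverse parametrization. -/
def invShift (A : Mat) (b : E) : E := -(A⁻¹.mulVec b)

theorem param_inv (A : Mat) (b : E) : param A⁻¹ (invShift A b) = paramInv A b := by
  funext y
  rw [param, paramInv, invShift, Matrix.mulVec_sub, sub_eq_add_neg]

theorem det_inv_ne_zero {A : Mat} (hA : A.det ≠ 0) : A⁻¹.det ≠ 0 := by
  rw [Matrix.det_nonsing_inv, Ring.inverse_eq_inv']
  exact inv_ne_zero hA

theorem param_inv_image {A : Mat} (hA : A.det ≠ 0) (b : E) (D : Set E) :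
    param A⁻¹ (invShift A b) '' (param A b '' D) = D := by
  rw [param_inv, image_image]
  simp [paramInv_param hA]

theorem IsTest.comp_paramInv {A : Mat} (hA : A.det ≠ 0) (b : E) {D : Set E} {ψ : E → ℝ}
    (h : IsTest D ψ) : IsTest (param A b '' D) fun y => ψ (paramInv A b y) := by
  have hs : tsupport (fun y => ψ (paramInv A b y)) = paramInv A b ⁻¹' tsupport ψ :=
    tsupport_comp_eq_preimage ψ (paramHomeo hA b).symm
  refine ⟨h.smooth.comp ?_, ?_, ?_⟩
  · exact (Matrix.toLin' A⁻¹).toContinuousLinearMap.contDiff.comp (contDiff_id.sub contDiff_const)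
  · exact h.compact.comp_homeomorph (paramHomeo hA b).symm
  · rw [hs]
    intro y hy
    exact ⟨_, h.supp hy, param_paramInv hA b y⟩

theorem fderiv_apply_eq_sum_pd (ψ : E → ℝ) (x a : E) : fderiv ℝ ψ x a = ∑ m, a m * pd m ψ x := by
  conv_lhs => rw [pi_eq_sum_univ' a]
  rw [map_sum]
  refine Finset.sum_congr rfl fun m _ => ?_
  rw [map_smul, smul_eq_mul, pd]

theorem IsTest.pd_comp_paramInv {A : Mat} (b : E) {D : Set E} {ψ : E → ℝ}
    (h : IsTest D ψ) (l : Fin 3) (y : E) :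
    HessianSpline.pd l (fun y => ψ (paramInv A b y)) y =
      ∑ m, A⁻¹ m l * HessianSpline.pd m ψ (paramInv A b y) := by
  have h1 : HasFDerivAt (paramInv A b) (Matrix.toLin' A⁻¹).toContinuousLinearMap y :=
    (Matrix.toLin' A⁻¹).toContinuousLinearMap.hasFDerivAt.comp y ((hasFDerivAt_id y).sub_const b)
  have h2 := ((h.smooth.differentiable (by simp)).differentiableAt.hasFDerivAt
    (x := paramInv A b y)).comp y h1
  rw [HessianSpline.pd, show (fun y => ψ (paramInv A b y)) = ψ ∘ paramInv A b from rfl, h2.fderiv,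
    ContinuousLinearMap.comp_apply, fderiv_apply_eq_sum_pd]
  refine Finset.sum_congr rfl fun m _ => ?_
  simp

/-- Weak divergences are compatible with the contravariant Piola transform. -/
theorem IsWeakDivRow.piola {A : Mat} (hA : A.det ≠ 0) (b : E) {D : Set E} {s : E → Fin 3 → ℝ}
    {w : E → ℝ} (h : IsWeakDivRow (param A b '' D) s w) :
    IsWeakDivRow D (fun x => A⁻¹.mulVec (s (param A b x))) (fun x => w (param A b x)) := by
  intro ψ hψ
  have key := h _ (hψ.comp_paramInv hA b)
  have e1 := integral_param hA b D fun y => ∑ l, s y l *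
    HessianSpline.pd l (fun y => ψ (paramInv A b y)) y
  have e2 := integral_param hA b D fun y => w y * ψ (paramInv A b y)
  simp only [hψ.pd_comp_paramInv, paramInv_param hA] at e1 e2 key
  rw [e2, ← mul_neg, ← key, ← e1]
  refine integral_congr_ae (Eventually.of_forall fun x => ?_)
  simp only [Matrix.mulVec, dotProduct, Finset.sum_mul, Finset.mul_sum]
  rw [Finset.sum_comm]
  exact Finset.sum_congr rfl fun l _ => Finset.sum_congr rfl fun m _ => by ring

end

section

/-! ### Linear maps of the values of fields -/

section Linear

variable {W ι : Type} [HasComponents W ι] [AddCommGroup W] [Module ℝ W] [LinearComponents W ι]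
  [Fintype ι]

theorem exists_matrix (L : W →ₗ[ℝ] W) : ∃ M : ι → ι → ℝ, ∀ w i,
    HasComponents.comp (L w) i = ∑ j, M i j * HasComponents.comp w j := by
  classical
  let e : W ≃ₗ[ℝ] (ι → ℝ) := LinearComponents.equiv
  refine ⟨fun i j => e (L (e.symm (Pi.single j 1))) i, fun w i => ?_⟩
  have h : L w = ∑ j, e w j • L (e.symm (Pi.single j 1)) := by
    conv_lhs => rw [← e.symm_apply_apply w, pi_eq_sum_univ' (e w)]
    simp only [map_sum, map_smul]
  rw [LinearComponents.comp_eq, h]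
  change e _ i = _
  rw [map_sum, Finset.sum_apply]
  refine Finset.sum_congr rfl fun j _ => ?_
  rw [map_smul, Pi.smul_apply, smul_eq_mul, LinearComponents.comp_eq, mul_comm]

theorem MemL2.linear {D : Set E} {f : E → W} (hf : MemL2 D f) (L : W →ₗ[ℝ] W) :
    MemL2 D fun x => L (f x) := by
  obtain ⟨M, hM⟩ := exists_matrix L
  intro i
  simp only [hM]
  exact memLp_finsetSum _ fun j _ => (hf j).const_mul _

theorem exists_l2_bound_linear (L : W →ₗ[ℝ] W) : ∃ N : ℝ, 0 ≤ N ∧ ∀ (D : Set E) (f : E → W),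
    MemL2 D f → l2NormSq D (fun x => L (f x)) ≤ N ^ 2 * l2NormSq D f := by
  obtain ⟨M, hM⟩ := exists_matrix L
  refine ⟨√(∑ i, ∑ j, M i j ^ 2), Real.sqrt_nonneg _, fun D f hf => ?_⟩
  rw [Real.sq_sqrt (Finset.sum_nonneg fun i _ => Finset.sum_nonneg fun j _ => sq_nonneg _),
    l2NormSq, l2NormSq, Finset.sum_mul]
  refine Finset.sum_le_sum fun i _ => ?_
  have hint : ∀ j, Integrable (fun x => HasComponents.comp (f x) j ^ 2) (volume.restrict D) :=
    fun j => (hf j).integrable_sq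
  rw [← integral_finsetSum _ fun j _ => hint j, ← integral_const_mul]
  refine integral_mono_of_nonneg (Eventually.of_forall fun x => sq_nonneg _)
    ((integrable_finsetSum _ fun j _ => hint j).const_mul _) (Eventually.of_forall fun x => ?_)
  simp only [hM]
  exact Finset.sum_mul_sq_le_sq_mul_sq _ _ _

omit [AddCommGroup W] [Module ℝ W] [LinearComponents W ι] [Fintype ι] in
theorem MemL2.param {A : Mat} (hA : A.det ≠ 0) (b : E) {D D' : Set E} (hD : param A b '' D = D')
    {f : E → W} (hf : MemL2 D' f) : MemL2 D fun x => f (HessianSpline.param A b x) := fun i => by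
  subst hD
  exact memLp_param hA b (hf i)

omit [AddCommGroup W] [Module ℝ W] [LinearComponents W ι] in
theorem l2NormSq_param {A : Mat} (hA : A.det ≠ 0) (b : E) (D : Set E) (f : E → W) :
    l2NormSq D (fun x => f (param A b x)) = |A.det|⁻¹ * l2NormSq (param A b '' D) f := by
  rw [l2NormSq, l2NormSq, Finset.mul_sum]
  exact Finset.sum_congr rfl fun i _ => integral_param hA b D fun y => HasComponents.comp (f y) i ^ 2

end Linear

/-! ### Pull-backs of the spaces of the Hessian complex -/

/-- The pointwise action of `Y2`. -/
def pullSym (A : Mat) : Mat →ₗ[ℝ] Mat where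
  toFun S := A.transpose * S * A
  map_add' S S' := by rw [Matrix.mul_add, Matrix.add_mul]
  map_smul' c S := by simp

/-- The pointwise action of `Y3`. -/
def pullTraceFree (A : Mat) : Mat →ₗ[ℝ] Mat where
  toFun T := A.det • (A.transpose * T * A.transpose⁻¹)
  map_add' S S' := by rw [Matrix.mul_add, Matrix.add_mul, smul_add]
  map_smul' c S := by simp [smul_comm c]

/-- The pointwise action of `Y4`. -/
def pullVec (A : Mat) : (Fin 3 → ℝ) →ₗ[ℝ] (Fin 3 → ℝ) where
  toFun v := A.det • A.transpose.mulVec v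
  map_add' v v' := by rw [Matrix.mulVec_add, smul_add]
  map_smul' c v := by simp [Matrix.mulVec_smul, smul_comm c]

/-- The pointwise action of the pull-back of gradients. -/
def pullGrad (A : Mat) : (Fin 3 → ℝ) →ₗ[ℝ] (Fin 3 → ℝ) := Matrix.toLin' A.transpose

section Pullback

variable {A : Mat} (hA : A.det ≠ 0) (b : E) {D D' : Set E}
  [IsFiniteMeasure ((volume : Measure E).restrict D')] (hD : param A b '' D = D')

include hA hD

theorem isWeakDivRow_single_pull {f : E → ℝ} {w : E → Fin 3 → ℝ}
    (h : ∀ k, IsWeakDivRow D' (fun y => Pi.single k (f y)) (fun y => w y k))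
    (hf : IntegrableOn f D') (hw : ∀ k, IntegrableOn (fun y => w y k) D') (i : Fin 3) :
    IsWeakDivRow D (fun x => Pi.single i (f (param A b x)))
      (fun x => ∑ k, A k i * w (param A b x) k) := by
  subst hD
  have key := (IsWeakDivRow.sum Finset.univ (fun k => A k i) (fun k _ => h k)
    (fun k _ => integrableOn_single hf k) (fun k _ => hw k)).piola hA b
  refine key.congr (Eventually.of_forall fun x => ?_) EventuallyEq.rfl
  simp only
  have e : (fun l => ∑ k, A k i * (Pi.single k (f (param A b x)) : Fin 3 → ℝ) l) =
      A.mulVec (Pi.single i (f (param A b x))) := by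
    funext l
    rw [Matrix.mulVec_single]
    simp [Pi.single_apply]
  rw [e, Matrix.mulVec_mulVec, Matrix.nonsing_inv_mul A (isUnit_iff_ne_zero.2 hA),
    Matrix.one_mulVec]

theorem IsH2.pull {φ : E → ℝ} {G : E → Fin 3 → ℝ} {H : E → Mat} (h : IsH2 D' φ G H) :
    IsH2 D (Y1 A b φ) (fun x => pullGrad A (G (param A b x))) (Y2 A b H) := by
  have hφ := (memL2_scalar_iff.1 h.memL2).integrableOn_two
  have hG := fun i => (memL2_vec_iff.1 h.grad_memL2 i).integrableOn_two
  have hH := fun i j => (memL2_mat_iff.1 h.hess_memL2 i j).integrableOn_two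
  have hgrad : IsWeakGrad D (Y1 A b φ) (fun x => pullGrad A (G (param A b x))) :=
    isWeakGrad_iff.2 fun i =>
      isWeakDivRow_single_pull hA b hD (isWeakGrad_iff.1 h.grad) hφ hG i
  refine ⟨h.memL2.param hA b hD, (h.grad_memL2.param hA b hD).linear (pullGrad A),
    (h.hess_memL2.param hA b hD).linear (pullSym A), hgrad,
    hgrad.isWeakHess_iff.2 fun i j => ?_⟩
  have hrow : ∀ k, IsWeakDivRow D' (fun y => Pi.single k (pullGrad A (G y) i))
      (fun y => ∑ m, A m i * H y m k) := by
    intro k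
    refine (IsWeakDivRow.sum Finset.univ (fun m => A m i)
      (fun m _ => h.grad.isWeakHess_iff.1 h.hess m k)
      (fun m _ => integrableOn_single (hG m) k) (fun m _ => hH m k)).congr
      (Eventually.of_forall fun y => ?_) EventuallyEq.rfl
    funext l
    by_cases hl : l = k
    · subst hl
      simp [pullGrad, Matrix.mulVec, dotProduct]
    · simp [hl]
  refine (isWeakDivRow_single_pull hA b hD hrow
    ((memL2_vec_iff.1 (h.grad_memL2.linear (pullGrad A)) i).integrableOn_two)
    (fun k => integrable_finsetSum _ fun m _ => (hH m k).const_mul _) j).congr EventuallyEq.rfl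
    (Eventually.of_forall fun x => ?_)
  simp only [Y2, Matrix.mul_apply, Matrix.transpose_apply]
  exact Finset.sum_congr rfl fun k _ => mul_comm _ _

theorem IsHdivT.pull {T : E → Mat} {v : E → Fin 3 → ℝ} (h : IsHdivT D' T v) :
    IsHdivT D (Y3 A b T) (Y4 A b v) := by
  have hT := fun i j => (memL2_mat_iff.1 h.memL2 i j).integrableOn_two
  have hv := fun i => (memL2_vec_iff.1 h.div_memL2 i).integrableOn_two
  refine ⟨(h.memL2.param hA b hD).linear (pullTraceFree A), ?_,
    (h.div_memL2.param hA b hD).linear (pullVec A), isWeakDiv_iff.2 fun i => ?_⟩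
  · have := h.trace
    rw [← hD, ae_param_iff hA b D] at this
    filter_upwards [this] with x hx
    rw [Y3, Matrix.trace_smul, Matrix.trace_mul_cycle, Matrix.nonsing_inv_mul _
      (by rw [Matrix.det_transpose]; exact isUnit_iff_ne_zero.2 hA), Matrix.one_mul, hx, smul_zero]
  · subst hD
    refine ((IsWeakDivRow.sum Finset.univ (fun k => A.det * A k i)
      (fun k _ => isWeakDiv_iff.1 h.div k) (fun k _ => hT k) (fun k _ => hv k)).piola hA b).congr
      (Eventually.of_forall fun x => ?_) (Eventually.of_forall fun x => ?_)
    · funext l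
      simp only [Y3, ← Matrix.transpose_nonsing_inv, Matrix.smul_apply, Matrix.mul_apply,
        Matrix.transpose_apply, Matrix.mulVec, dotProduct, Finset.mul_sum, Finset.sum_mul,
        smul_eq_mul]
      exact Finset.sum_congr rfl fun m _ => Finset.sum_congr rfl fun k _ => by ring
    · simp only [Y4, Pi.smul_apply, Matrix.mulVec, dotProduct, Matrix.transpose_apply, smul_eq_mul,
        Finset.mul_sum, mul_assoc]

omit hA hD [IsFiniteMeasure ((volume : Measure E).restrict D')] in
theorem sum_adjugate_mul_curlField (A : Mat) (s : Fin 3 → ℝ) (j : Fin 3) :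
    (fun l => ∑ k, A.adjugate j k * curlField s k l) =
      A.mulVec (curlField (A.transpose.mulVec s) j) := by
  have h : ∀ j l, ∑ k, A.adjugate j k * curlField s k l =
      A.mulVec (curlField (A.transpose.mulVec s) j) l := by
    intro j l
    rw [Matrix.adjugate_fin_three]
    fin_cases j <;> fin_cases l <;>
      simp [curlField, Fin.sum_univ_three, Matrix.mulVec, dotProduct, Pi.single_apply] <;> ring
  exact funext (h j)

omit hA hD [IsFiniteMeasure ((volume : Measure E).restrict D')] in
theorem sum_mul_curlField (c : Fin 3 → ℝ) (s : Fin 3 → Fin 3 → ℝ) (j : Fin 3) :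
    (fun l => ∑ k, c k * curlField (s k) j l) = curlField (fun m => ∑ k, c k * s k m) j := by
  funext l
  simp only [curlField, Pi.sub_apply, Pi.single_apply, mul_sub, Finset.sum_sub_distrib]
  congr 1 <;> split_ifs <;> simp

theorem isWeakDivRow_curlField_pull {s c : E → Fin 3 → ℝ}
    (h : ∀ j, IsWeakDivRow D' (fun y => curlField (s y) j) (fun y => c y j))
    (hs : ∀ l, IntegrableOn (fun y => s y l) D') (hc : ∀ l, IntegrableOn (fun y => c y l) D')
    (j : Fin 3) :
    IsWeakDivRow D (fun x => curlField (A.transpose.mulVec (s (param A b x))) j)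
      (fun x => ∑ k, A.adjugate j k * c (param A b x) k) := by
  subst hD
  have hcI : ∀ k l, IntegrableOn (fun y => curlField (s y) k l) (param A b '' D) := fun k l =>
    (integrableOn_single (hs _) _ l).sub (integrableOn_single (hs _) _ l)
  refine ((IsWeakDivRow.sum Finset.univ (fun k => A.adjugate j k) (fun k _ => h k)
    (fun k _ => hcI k) (fun k _ => hc k)).piola hA b).congr (Eventually.of_forall fun x => ?_)
    EventuallyEq.rfl
  simp only
  rw [sum_adjugate_mul_curlField, Matrix.mulVec_mulVec,
    Matrix.nonsing_inv_mul A (isUnit_iff_ne_zero.2 hA), Matrix.one_mulVec]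

theorem IsHcurlS.pull {S C : E → Mat} (h : IsHcurlS D' S C) :
    IsHcurlS D (Y2 A b S) (Y3 A b C) := by
  have hS := fun i j => (memL2_mat_iff.1 h.memL2 i j).integrableOn_two
  have hC := fun i j => (memL2_mat_iff.1 h.curl_memL2 i j).integrableOn_two
  refine ⟨(h.memL2.param hA b hD).linear (pullSym A), ?_,
    (h.curl_memL2.param hA b hD).linear (pullTraceFree A), isWeakCurl_iff.2 fun i j => ?_⟩
  · have := h.symm
    rw [← hD, ae_param_iff hA b D] at this
    filter_upwards [this] with x hx
    rw [Y2, Matrix.transpose_mul, Matrix.transpose_mul, Matrix.transpose_transpose, hx,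
      Matrix.mul_assoc]
  · have hcI : ∀ k m l, IntegrableOn (fun y => curlField (S y k) m l) D' := fun k m l =>
      (integrableOn_single (hS _ _) _ l).sub (integrableOn_single (hS _ _) _ l)
    have hrow : ∀ m, IsWeakDivRow D' (fun y => curlField (fun l => ∑ k, A k i * S y k l) m)
        (fun y => ∑ k, A k i * C y k m) := fun m =>
      (IsWeakDivRow.sum Finset.univ (fun k => A k i) (fun k _ => isWeakCurl_iff.1 h.curl k m)
        (fun k _ => hcI k m) (fun k _ => hC k m)).congr
        (Eventually.of_forall fun y => sum_mul_curlField _ _ _) EventuallyEq.rfl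
    refine (isWeakDivRow_curlField_pull hA b hD (s := fun y l => ∑ k, A k i * S y k l)
      (c := fun y m => ∑ k, A k i * C y k m) hrow
      (fun l => integrable_finsetSum _ fun k _ => (hS k l).const_mul _)
      (fun l => integrable_finsetSum _ fun k _ => (hC k l).const_mul _) j).congr
      (Eventually.of_forall fun x => ?_) (Eventually.of_forall fun x => ?_)
    · simp only
      congr 1
      funext l
      simp only [Y2, Matrix.mul_apply, Matrix.mulVec, dotProduct, Matrix.transpose_apply]
      exact Finset.sum_congr rfl fun k _ => mul_comm _ _
    · have hadj : A.adjugate = A.det • A⁻¹ := by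
        rw [Matrix.inv_def, Ring.inverse_eq_inv', smul_smul, mul_inv_cancel₀ hA, one_smul]
      simp only [Y3, hadj, ← Matrix.transpose_nonsing_inv, Matrix.smul_apply, Matrix.mul_apply,
        Matrix.transpose_apply, Finset.mul_sum, Finset.sum_mul, smul_eq_mul]
      exact Finset.sum_congr rfl fun m _ => Finset.sum_congr rfl fun k _ => by ring

end Pullback

theorem Y1inv_eq (A : Mat) (b : E) : Y1inv A b = Y1 A⁻¹ (invShift A b) := by
  funext f y
  rw [Y1inv, Y1, param_inv]

theorem Y2inv_eq (A : Mat) (b : E) : Y2inv A b = Y2 A⁻¹ (invShift A b) := by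
  funext f y
  rw [Y2inv, Y2, param_inv, Matrix.transpose_nonsing_inv]

theorem Y3inv_eq {A : Mat} (hA : A.det ≠ 0) (b : E) : Y3inv A b = Y3 A⁻¹ (invShift A b) := by
  funext f y
  rw [Y3inv, Y3, param_inv, Matrix.transpose_nonsing_inv, Matrix.nonsing_inv_nonsing_inv,
    Matrix.det_nonsing_inv, Ring.inverse_eq_inv']
  rw [Matrix.det_transpose]
  exact isUnit_iff_ne_zero.2 hA

theorem Y4inv_eq (A : Mat) (b : E) : Y4inv A b = Y4 A⁻¹ (invShift A b) := by
  funext f y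
  rw [Y4inv, Y4, param_inv, Matrix.transpose_nonsing_inv, Matrix.det_nonsing_inv,
    Ring.inverse_eq_inv']

end

section

/-! ### Transport of bounded operators to the physical domain -/

theorem physDomain_image {A : Mat} (hA : A.det ≠ 0) (b : E) :
    param A⁻¹ (invShift A b) '' physDomain A b = cube :=
  param_inv_image hA b cube

theorem ae_physDomain_iff {A : Mat} (hA : A.det ≠ 0) (b : E) {P : E → Prop} :
    (∀ᵐ y ∂(volume.restrict (physDomain A b)), P y) ↔
      ∀ᵐ x ∂(volume.restrict cube), P (param A b x) :=
  ae_param_iff hA b cube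

theorem ae_eq_pushforward {W : Type} {A : Mat} (hA : A.det ≠ 0) (b : E) {u u' : E → W}
    (h : u =ᵐ[volume.restrict cube] u') (L : W → W) :
    (fun y => L (u (param A⁻¹ (invShift A b) y))) =ᵐ[volume.restrict (physDomain A b)]
      fun y => L (u' (param A⁻¹ (invShift A b) y)) := by
  refine (ae_physDomain_iff hA b).2 ?_
  filter_upwards [h] with x hx
  rw [param_inv, paramInv_param hA, hx]

section Bounded

variable {W ι : Type} [HasComponents W ι] [AddCommGroup W] [Module ℝ W] [Fintype ι]

theorem IsBoundedL2.mono {D : Set E} {C C' : ℝ} {P : (E → W) → (E → W)} (h : IsBoundedL2 D C P)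
    (h0 : 0 ≤ C) (hC : C ≤ C') : IsBoundedL2 D C' P :=
  ⟨h.memL2, h.congr, h.add, h.smul, fun f hf => (h.bound f hf).trans
    (mul_le_mul_of_nonneg_right (pow_le_pow_left₀ h0 hC 2) (l2NormSq_nonneg D f))⟩

theorem exists_isBoundedL2_conj [LinearComponents W ι] {A : Mat} (hA : A.det ≠ 0) (b : E)
    (L L' : W →ₗ[ℝ] W) :
    ∃ c : ℝ, 0 ≤ c ∧ ∀ (C : ℝ) (P : (E → W) → (E → W)), IsBoundedL2 cube C P →
      IsBoundedL2 (physDomain A b) (c * C) fun f y =>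
        L' (P (fun x => L (f (param A b x))) (param A⁻¹ (invShift A b) y)) := by
  obtain ⟨N, hN0, hN⟩ := exists_l2_bound_linear L
  obtain ⟨N', hN'0, hN'⟩ := exists_l2_bound_linear L'
  refine ⟨N' * N, mul_nonneg hN'0 hN0, fun C P hP => ?_⟩
  have hA' := det_inv_ne_zero hA
  have h1 : ∀ f : E → W, MemL2 (physDomain A b) f → MemL2 cube fun x => f (param A b x) :=
    fun f hf => hf.param hA b rfl
  have h2 : ∀ f : E → W, MemL2 (physDomain A b) f → MemL2 cube fun x => L (f (param A b x)) :=
    fun f hf => (h1 f hf).linear L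
  have h3 : ∀ u : E → W, MemL2 cube u →
      MemL2 (physDomain A b) fun y => u (param A⁻¹ (invShift A b) y) :=
    fun u hu => hu.param hA' _ (physDomain_image hA b)
  refine ⟨fun f hf => (h3 _ (hP.memL2 _ (h2 f hf))).linear L', fun f f' hf hf' h => ?_,
    fun f f' hf hf' => ?_, fun c f hf => ?_, fun f hf => ?_⟩
  · refine ae_eq_pushforward hA b (hP.congr _ _ (h2 f hf) (h2 f' hf') ?_) L'
    filter_upwards [(ae_physDomain_iff hA b).1 h] with x hx
    rw [hx]
  · have e := ae_eq_pushforward hA b (hP.add _ _ (h2 f hf) (h2 f' hf')) L'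
    have e' : ((fun x => L (f (param A b x))) + fun x => L (f' (param A b x))) =
        fun x => L ((f + f') (param A b x)) := by
      funext x; simp
    rw [e'] at e
    filter_upwards [e] with y hy
    rw [hy, Pi.add_apply, map_add, Pi.add_apply]
  · have e := ae_eq_pushforward hA b (hP.smul c _ (h2 f hf)) L'
    have e' : (c • fun x => L (f (param A b x))) = fun x => L ((c • f) (param A b x)) := by
      funext x; simp
    rw [e'] at e
    filter_upwards [e] with y hy
    rw [hy, Pi.smul_apply, map_smul, Pi.smul_apply]
  · set u := P fun x => L (f (param A b x)) with hu
    have hu2 : MemL2 cube u := hP.memL2 _ (h2 f hf)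
    have b1 := hN' _ _ (h3 u hu2)
    have b2 := l2NormSq_param hA b cube fun y => u (param A⁻¹ (invShift A b) y)
    simp only [param_inv, paramInv_param hA] at b2
    have b3 := hP.bound _ (h2 f hf)
    have b4 := hN _ _ (h1 f hf)
    have b5 := l2NormSq_param hA b cube f
    have hd : 0 < |A.det| := abs_pos.2 hA
    rw [← physDomain] at b2 b5
    rw [b5] at b4
    rw [← param_inv] at b2
    have b2' : l2NormSq (physDomain A b) (fun y => u (param A⁻¹ (invShift A b) y)) =
        |A.det| * l2NormSq cube u := by
      rw [b2]; field_simp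
    rw [b2'] at b1
    refine b1.trans ?_
    calc N' ^ 2 * (|A.det| * l2NormSq cube u)
        ≤ N' ^ 2 * (|A.det| * (C ^ 2 * (N ^ 2 * (|A.det|⁻¹ * l2NormSq (physDomain A b) f)))) := by
          gcongr
          exact b3.trans (mul_le_mul_of_nonneg_left b4 (sq_nonneg C))
      _ = (N' * N * C) ^ 2 * l2NormSq (physDomain A b) f := by field_simp

end Bounded

/-! ### Uniqueness of derivatives, and affine functions -/

theorem IsH2.ae_unique {D : Set E} [IsFiniteMeasure ((volume : Measure E).restrict D)]
    (hD : IsOpen D) {φ : E → ℝ} {G G' : E → Fin 3 → ℝ} {H H' : E → Mat} (h : IsH2 D φ G H)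
    (h' : IsH2 D φ G' H') : G =ᵐ[volume.restrict D] G' ∧ H =ᵐ[volume.restrict D] H' := by
  constructor
  · exact ae_eq_of_comp fun i => (isWeakGrad_iff.1 h.grad i).ae_unique hD
      (isWeakGrad_iff.1 h'.grad i) (h.grad_memL2 i).integrableOn_two
      (h'.grad_memL2 i).integrableOn_two
  · exact ae_eq_of_comp fun ij => (h.grad.isWeakHess_iff.1 h.hess ij.1 ij.2).ae_unique hD
      (h.grad.isWeakHess_iff.1 h'.hess ij.1 ij.2) (h.hess_memL2 ij).integrableOn_two
      (h'.hess_memL2 ij).integrableOn_two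

theorem isWeakGrad_affine (D : Set E) (c : ℝ) (a : E) :
    IsWeakGrad D (fun x => c + a ⬝ᵥ x) fun _ => a := by
  intro i ψ hψ
  have hz : ∀ (χ : E → ℝ) (f : E → ℝ), IsTest D χ → ∫ x in D, f x * χ x = ∫ x, f x * χ x :=
    fun χ f hχ => setIntegral_eq_integral_of_forall_compl_eq_zero fun x hx => by
      rw [hχ.eq_zero hx, mul_zero]
  have hq : ∀ x, HasFDerivAt (fun x : E => c + a ⬝ᵥ x)
      (∑ l, a l • (ContinuousLinearMap.proj l : E →L[ℝ] ℝ)) x := by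
    intro x
    refine HasFDerivAt.const_add c ?_
    have e : dotProduct a = ⇑(∑ l, a l • (ContinuousLinearMap.proj l : E →L[ℝ] ℝ)) := by
      funext x; simp [dotProduct]
    rw [e]
    exact ContinuousLinearMap.hasFDerivAt _
  have hqc : Continuous fun x : E => c + a ⬝ᵥ x :=
    continuous_iff_continuousAt.2 fun x => (hq x).continuousAt
  have hd : ∀ x, fderiv ℝ (fun x : E => c + a ⬝ᵥ x) x (Pi.single i 1) = a i := fun x => by
    rw [(hq x).fderiv]; simp [Pi.single_apply]
  rw [hz _ _ (hψ.pd i), hz _ _ hψ]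
  have hI : ∀ (f χ : E → ℝ), Continuous f → IsTest D χ → Integrable fun x => f x * χ x :=
    fun f χ hf hχ => (hf.mul hχ.smooth.continuous).integrable_of_hasCompactSupport
      hχ.compact.mul_left
  have key := integral_mul_fderiv_eq_neg_fderiv_mul_of_integrable (μ := (volume : Measure E))
    (f := fun x : E => c + a ⬝ᵥ x) (g := ψ) (v := Pi.single i 1)
    (by simp only [hd]; exact hI _ _ continuous_const hψ) (hI _ _ hqc (hψ.pd i)) (hI _ _ hqc hψ)
    (fun x _ => (hq x).differentiableAt) (fun x _ => hψ.smooth.differentiable (by simp) x)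
  simp only [hd] at key
  exact key

theorem isH2_affine {D : Set E} [IsFiniteMeasure ((volume : Measure E).restrict D)] (c : ℝ) (a : E)
    (h : MemL2 D fun x => c + a ⬝ᵥ x) : IsH2 D (fun x => c + a ⬝ᵥ x) (fun _ => a) 0 := by
  refine ⟨h, memL2_vec_iff.2 fun i => memLp_const _, memL2_mat_iff.2 fun i j => MemLp.zero,
    isWeakGrad_affine D c a, (isWeakGrad_affine D c a).isWeakHess_iff.2 fun i j => ?_⟩
  have := isWeakGrad_iff.1 (isWeakGrad_affine D (a i) 0) j
  simpa using this

theorem Y1_mem_P1 (A : Mat) (b : E) {q : E → ℝ} (hq : q ∈ P1) : Y1 A b q ∈ P1 := by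
  obtain ⟨c, a, hq⟩ := hq
  refine ⟨c + a ⬝ᵥ b, A.transpose.mulVec a, fun x => ?_⟩
  rw [Y1, hq, param, dotProduct_add, Matrix.dotProduct_mulVec, Matrix.mulVec_transpose]
  ring

end

section

/-! ### The Hessian complex and the projections on the physical domain -/

variable {p r : Fin 3 → ℕ} {K : ∀ l, OpenKnots (p l) (r l)} {g : Fin 3 → ℝ → ℝ} {A : Mat}

theorem param_image_cube (A : Mat) (b : E) : param A b '' cube = physDomain A b := rfl

theorem isOpen_physDomain (hA : A.det ≠ 0) (b : E) : IsOpen (physDomain A b) :=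
  isOpen_param_image hA b isOpen_cube

theorem IsH2.push (hA : A.det ≠ 0) (b : E) {φ : E → ℝ} {G : E → Fin 3 → ℝ} {H : E → Mat}
    (h : IsH2 cube φ G H) : IsH2 (physDomain A b) (Y1inv A b φ)
      (fun y => pullGrad A⁻¹ (G (param A⁻¹ (invShift A b) y))) (Y2inv A b H) := by
  rw [Y1inv_eq, Y2inv_eq]
  exact h.pull (det_inv_ne_zero hA) _ (physDomain_image hA b)

theorem IsHcurlS.push (hA : A.det ≠ 0) (b : E) {S C : E → Mat} (h : IsHcurlS cube S C) :
    IsHcurlS (physDomain A b) (Y2inv A b S) (Y3inv A b C) := by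
  rw [Y2inv_eq, Y3inv_eq hA]
  exact h.pull (det_inv_ne_zero hA) _ (physDomain_image hA b)

theorem IsHdivT.push (hA : A.det ≠ 0) (b : E) {T : E → Mat} {v : E → Fin 3 → ℝ}
    (h : IsHdivT cube T v) : IsHdivT (physDomain A b) (Y3inv A b T) (Y4inv A b v) := by
  rw [Y3inv_eq hA, Y4inv_eq]
  exact h.pull (det_inv_ne_zero hA) _ (physDomain_image hA b)

/-- The projection of gradients on the physical domain. -/
def physGradProj (K : ∀ l, OpenKnots (p l) (r l)) (g : Fin 3 → ℝ → ℝ) (A : Mat) (b : E)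
    (G : E → Fin 3 → ℝ) : E → Fin 3 → ℝ := fun y =>
  pullGrad A⁻¹ (gradProj K g (fun x => pullGrad A (G (param A b x))) (param A⁻¹ (invShift A b) y))

section Commute

variable (hg : ∀ l, IsTransition (p l) (g l)) (hr : ∀ l, 1 ≤ r l) (hA : A.det ≠ 0) (b : E)

include hg hr hA

theorem isH2_Pi {φ : E → ℝ} {G : E → Fin 3 → ℝ} {H : E → Mat}
    (h : IsH2 (physDomain A b) φ G H) :
    IsH2 (physDomain A b) (Pi1 K g A b φ) (physGradProj K g A b G) (Pi2 K g A b H) :=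
  (isH2_hatPi hg hr (h.pull hA b (param_image_cube A b))).push hA b

theorem isHcurlS_Pi {S C : E → Mat} (h : IsHcurlS (physDomain A b) S C) :
    IsHcurlS (physDomain A b) (Pi2 K g A b S) (Pi3 K g A b C) :=
  (isHcurlS_hatPi hg hr (h.pull hA b (param_image_cube A b))).push hA b

theorem isHdivT_Pi {T : E → Mat} {v : E → Fin 3 → ℝ} (h : IsHdivT (physDomain A b) T v) :
    IsHdivT (physDomain A b) (Pi3 K g A b T) (Pi4 K g A b v) :=
  (isHdivT_hatPi hg hr (h.pull hA b (param_image_cube A b))).push hA b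

theorem Pi1_mem {φ : E → ℝ} (h : MemL2 (physDomain A b) φ) : Pi1 K g A b φ ∈ V1 K A b := by
  rw [V1, mem_ofPred_eq, Pi1, (Y1_inverse hA b).2]
  exact hatPi1_mem hg hr (h.param hA b rfl)

theorem Pi2_mem {S C : E → Mat} (h : IsHcurlS (physDomain A b) S C) :
    Pi2 K g A b S ∈ V2 K A b := by
  rw [V2, mem_ofPred_eq, Pi2, (Y2_inverse hA b).2]
  have h' := h.pull hA b (param_image_cube A b)
  exact hatPi2_mem hg hr h'.memL2 h'.symm

theorem Pi3_mem {T : E → Mat} {v : E → Fin 3 → ℝ} (h : IsHdivT (physDomain A b) T v) :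
    Pi3 K g A b T ∈ V3 K A b := by
  rw [V3, mem_ofPred_eq, Pi3, (Y3_inverse hA b).2]
  have h' := h.pull hA b (param_image_cube A b)
  exact hatPi3_mem hg hr h'.memL2 h'.trace

theorem Pi4_mem {v : E → Fin 3 → ℝ} (h : MemL2 (physDomain A b) v) :
    Pi4 K g A b v ∈ V4 K A b := by
  rw [V4, mem_ofPred_eq, Pi4, (Y4_inverse hA b).2]
  exact hatPi4_mem hg hr ((h.param hA b rfl).linear (pullVec A))

theorem Pi1_eq_self {φ : E → ℝ} (h : φ ∈ V1 K A b) :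
    Pi1 K g A b φ =ᵐ[volume.restrict (physDomain A b)] φ := by
  have e := ae_eq_pushforward hA b (hatPi1_eq_self hg hr h) id
  have e' : Pi1 K g A b φ =ᵐ[volume.restrict (physDomain A b)] Y1inv A b (Y1 A b φ) := by
    rw [Pi1, Y1inv_eq]; exact e
  rwa [(Y1_inverse hA b).1] at e'

theorem Pi2_eq_self {S : E → Mat} (h : S ∈ V2 K A b) :
    Pi2 K g A b S =ᵐ[volume.restrict (physDomain A b)] S := by
  have e := ae_eq_pushforward hA b (hatPi2_eq_self hg hr h) (pullSym A⁻¹)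
  have e' : Pi2 K g A b S =ᵐ[volume.restrict (physDomain A b)] Y2inv A b (Y2 A b S) := by
    rw [Pi2, Y2inv_eq]; exact e
  rwa [(Y2_inverse hA b).1] at e'

theorem Pi3_eq_self {T : E → Mat} (h : T ∈ V3 K A b) :
    Pi3 K g A b T =ᵐ[volume.restrict (physDomain A b)] T := by
  have e := ae_eq_pushforward hA b (hatPi3_eq_self hg hr h) (pullTraceFree A⁻¹)
  have e' : Pi3 K g A b T =ᵐ[volume.restrict (physDomain A b)] Y3inv A b (Y3 A b T) := by
    rw [Pi3, Y3inv_eq hA]; exact e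
  rwa [(Y3_inverse hA b).1] at e'

theorem Pi4_eq_self {v : E → Fin 3 → ℝ} (h : v ∈ V4 K A b) :
    Pi4 K g A b v =ᵐ[volume.restrict (physDomain A b)] v := by
  have e := ae_eq_pushforward hA b (hatPi4_eq_self hg hr h) (pullVec A⁻¹)
  have e' : Pi4 K g A b v =ᵐ[volume.restrict (physDomain A b)] Y4inv A b (Y4 A b v) := by
    rw [Pi4, Y4inv_eq]; exact e
  rwa [(Y4_inverse hA b).1] at e'

theorem exists_isH2_of_mem_V1 {φ : E → ℝ} (h : φ ∈ V1 K A b) :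
    ∃ G H, IsH2 (physDomain A b) φ G H ∧ H ∈ V2 K A b := by
  obtain ⟨G, H, h1, h2⟩ := exists_isH2_of_mem_hatV1 hg hr h
  have h3 := h1.push hA b
  rw [(Y1_inverse hA b).1] at h3
  exact ⟨_, _, h3, by rwa [V2, mem_ofPred_eq, (Y2_inverse hA b).2]⟩

theorem exists_isHcurlS_of_mem_V2 {S : E → Mat} (h : S ∈ V2 K A b) :
    ∃ C, IsHcurlS (physDomain A b) S C ∧ C ∈ V3 K A b := by
  obtain ⟨C, h1, h2⟩ := exists_isHcurlS_of_mem_hatV2 hg hr h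
  have h3 := h1.push hA b
  rw [(Y2_inverse hA b).1] at h3
  exact ⟨_, h3, by rwa [V3, mem_ofPred_eq, (Y3_inverse hA b).2]⟩

theorem exists_isHdivT_of_mem_V3 {T : E → Mat} (h : T ∈ V3 K A b) :
    ∃ v, IsHdivT (physDomain A b) T v ∧ v ∈ V4 K A b := by
  obtain ⟨v, h1, h2⟩ := exists_isHdivT_of_mem_hatV3 hg hr h
  have h3 := h1.push hA b
  rw [(Y3_inverse hA b).1] at h3
  exact ⟨_, h3, by rwa [V4, mem_ofPred_eq, (Y4_inverse hA b).2]⟩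

end Commute

theorem V4_memL2 (hA : A.det ≠ 0) (b : E) {v : E → Fin 3 → ℝ} (h : v ∈ V4 K A b) :
    MemL2 (physDomain A b) v := by
  have h1 := ((hatV4_memL2 h).param (det_inv_ne_zero hA) _ (physDomain_image hA b)).linear
    (pullVec A⁻¹)
  have h2 : MemL2 (physDomain A b) (Y4inv A b (Y4 A b v)) := by rw [Y4inv_eq]; exact h1
  rwa [(Y4_inverse hA b).1] at h2

theorem P1_subset_V1 (b : E) {q : E → ℝ} (hq : q ∈ P1) : q ∈ V1 K A b :=
  P1_subset_hatV1 (Y1_mem_P1 A b hq)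

theorem exists_isH2_of_mem_P1 (hA : A.det ≠ 0) (b : E) (K : ∀ l, OpenKnots (p l) (r l))
    {q : E → ℝ} (hq : q ∈ P1) : ∃ G, IsH2 (physDomain A b) q G 0 := by
  have h1 := (hatV1_memL2 (P1_subset_V1 (K := K) (A := A) b hq)).param (det_inv_ne_zero hA) _
    (physDomain_image hA b)
  have h2 : MemL2 (physDomain A b) (Y1inv A b (Y1 A b q)) := by rw [Y1inv_eq]; exact h1
  rw [(Y1_inverse hA b).1] at h2
  obtain ⟨c, a, h⟩ := hq
  obtain rfl : q = fun x => c + a ⬝ᵥ x := funext h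
  exact ⟨_, isH2_affine c a h2⟩

/-- The projections are bounded on `L²`, uniformly with respect to the mesh. -/
theorem exists_bound_Pi (hg : ∀ l, IsTransition (p l) (g l)) (hA : A.det ≠ 0) (b : E) (θ : ℝ) :
    ∃ C : ℝ, ∀ (r : Fin 3 → ℕ) (_ : ∀ l, 1 ≤ r l) (K : ∀ l, OpenKnots (p l) (r l)),
      (∀ l, LocallyQuasiUniform θ (K l)) →
      IsBoundedL2 (physDomain A b) C (Pi1 K g A b) ∧
      IsBoundedL2 (physDomain A b) C (Pi2 K g A b) ∧
      IsBoundedL2 (physDomain A b) C (Pi3 K g A b) ∧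
      IsBoundedL2 (physDomain A b) C (Pi4 K g A b) ∧
      IsBoundedL2 (physDomain A b) C (physGradProj K g A b) := by
  obtain ⟨C, hC0, hC⟩ := exists_l2_bound_kerProj hg θ
  obtain ⟨c₁, h₁, H₁⟩ := exists_isBoundedL2_conj (W := ℝ) hA b LinearMap.id LinearMap.id
  obtain ⟨c₂, h₂, H₂⟩ := exists_isBoundedL2_conj hA b (pullSym A) (pullSym A⁻¹)
  obtain ⟨c₃, h₃, H₃⟩ := exists_isBoundedL2_conj hA b (pullTraceFree A) (pullTraceFree A⁻¹)
  obtain ⟨c₄, h₄, H₄⟩ := exists_isBoundedL2_conj hA b (pullVec A) (pullVec A⁻¹)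
  obtain ⟨c₅, h₅, H₅⟩ := exists_isBoundedL2_conj hA b (pullGrad A) (pullGrad A⁻¹)
  refine ⟨(c₁ + c₂ + c₃ + c₄ + c₅) * C, fun r hr K hK => ?_⟩
  have hCK := hC r hr K hK
  have B₁ := (H₁ C _ ((isKernelOp_hatPi1 hg hr).isBoundedL2 hg hr hCK)).mono
    (C' := (c₁ + c₂ + c₃ + c₄ + c₅) * C) (by positivity) (by gcongr; linarith)
  have B₂ := (H₂ C _ ((isKernelOp_hatPi2 hg hr).isBoundedL2 hg hr hCK)).mono
    (C' := (c₁ + c₂ + c₃ + c₄ + c₅) * C) (by positivity) (by gcongr; linarith)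
  have B₃ := (H₃ C _ ((isKernelOp_hatPi3 hg hr).isBoundedL2 hg hr hCK)).mono
    (C' := (c₁ + c₂ + c₃ + c₄ + c₅) * C) (by positivity) (by gcongr; linarith)
  have B₄ := (H₄ C _ ((isKernelOp_hatPi4 hg hr).isBoundedL2 hg hr hCK)).mono
    (C' := (c₁ + c₂ + c₃ + c₄ + c₅) * C) (by positivity) (by gcongr; linarith)
  have B₅ := (H₅ C _ (isKernelOp_gradProj.isBoundedL2 hg hr hCK)).mono
    (C' := (c₁ + c₂ + c₃ + c₄ + c₅) * C) (by positivity) (by gcongr; linarith)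
  refine ⟨?_, ?_, ?_, ?_, B₅⟩
  · have e : Pi1 K g A b = fun φ => Y1 A⁻¹ (invShift A b) (hatPi1 K g (Y1 A b φ)) := by
      funext φ; rw [Pi1, Y1inv_eq]
    rw [e]; exact B₁
  · have e : Pi2 K g A b = fun S => Y2 A⁻¹ (invShift A b) (hatPi2 K g (Y2 A b S)) := by
      funext φ; rw [Pi2, Y2inv_eq]
    rw [e]; exact B₂
  · have e : Pi3 K g A b = fun S => Y3 A⁻¹ (invShift A b) (hatPi3 K g (Y3 A b S)) := by
      funext φ; rw [Pi3, Y3inv_eq hA]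
    rw [e]; exact B₃
  · have e : Pi4 K g A b = fun S => Y4 A⁻¹ (invShift A b) (hatPi4 K g (Y4 A b S)) := by
      funext φ; rw [Pi4, Y4inv_eq]
    rw [e]; exact B₄

end

end HessianSpline

end

open HessianSpline MeasureTheory in
theorem mainTheorem3 (p : Fin 3 → ℕ) (g : Fin 3 → ℝ → ℝ) (hg : ∀ l, IsTransition (p l) (g l))
    (A : Mat) (hA : A.det ≠ 0) (b : E) :
    (∀ (r : Fin 3 → ℕ) (_ : ∀ l, 1 ≤ r l) (K : ∀ l, OpenKnots (p l) (r l)),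
      -- the parametric projections map into the spline spaces and fix them
      ((∀ φ G H, IsH2 cube φ G H → hatPi1 K g φ ∈ hatV1 K) ∧
        (∀ S C, IsHcurlS cube S C → hatPi2 K g S ∈ hatV2 K) ∧
        (∀ T v, IsHdivT cube T v → hatPi3 K g T ∈ hatV3 K) ∧
        (∀ v, MemL2 cube v → hatPi4 K g v ∈ hatV4 K) ∧
        (∀ φ ∈ hatV1 K, hatPi1 K g φ =ᵐ[volume.restrict cube] φ) ∧
        (∀ S ∈ hatV2 K, hatPi2 K g S =ᵐ[volume.restrict cube] S) ∧
        (∀ T ∈ hatV3 K, hatPi3 K g T =ᵐ[volume.restrict cube] T) ∧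
        (∀ v ∈ hatV4 K, hatPi4 K g v =ᵐ[volume.restrict cube] v)) ∧
      -- the parametric projections commute with Hessian, curl and divergence
      ((∀ φ G H, IsH2 cube φ G H → ∃ G', IsH2 cube (hatPi1 K g φ) G' (hatPi2 K g H)) ∧
        (∀ S C, IsHcurlS cube S C → IsHcurlS cube (hatPi2 K g S) (hatPi3 K g C)) ∧
        (∀ T v, IsHdivT cube T v → IsHdivT cube (hatPi3 K g T) (hatPi4 K g v))) ∧
      -- so do the projections on the physical domain
      ((∀ q ∈ P1, Pi1 K g A b q =ᵐ[volume.restrict (physDomain A b)] q) ∧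
        (∀ φ G H, IsH2 (physDomain A b) φ G H →
          ∃ G', IsH2 (physDomain A b) (Pi1 K g A b φ) G' (Pi2 K g A b H)) ∧
        (∀ S C, IsHcurlS (physDomain A b) S C →
          IsHcurlS (physDomain A b) (Pi2 K g A b S) (Pi3 K g A b C)) ∧
        (∀ T v, IsHdivT (physDomain A b) T v →
          IsHdivT (physDomain A b) (Pi3 K g A b T) (Pi4 K g A b v))) ∧
      -- the spline spaces on the physical domain form a subcomplex of the Hessian complex
      ((∀ q ∈ P1, q ∈ V1 K A b ∧ ∃ G, IsH2 (physDomain A b) q G 0) ∧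
        (∀ φ G H, IsH2 (physDomain A b) φ G H → IsHcurlS (physDomain A b) H 0) ∧
        (∀ S C, IsHcurlS (physDomain A b) S C → IsHdivT (physDomain A b) C 0) ∧
        (∀ φ ∈ V1 K A b, ∃ G H, IsH2 (physDomain A b) φ G H ∧ H ∈ V2 K A b) ∧
        (∀ S ∈ V2 K A b, ∃ C, IsHcurlS (physDomain A b) S C ∧ C ∈ V3 K A b) ∧
        (∀ T ∈ V3 K A b, ∃ v, IsHdivT (physDomain A b) T v ∧ v ∈ V4 K A b) ∧
        (∀ v ∈ V4 K A b, MemL2 (physDomain A b) v)) ∧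
      -- the projections on the physical domain are projections onto the spline spaces
      ((∀ φ G H, IsH2 (physDomain A b) φ G H → Pi1 K g A b φ ∈ V1 K A b) ∧
        (∀ S C, IsHcurlS (physDomain A b) S C → Pi2 K g A b S ∈ V2 K A b) ∧
        (∀ T v, IsHdivT (physDomain A b) T v → Pi3 K g A b T ∈ V3 K A b) ∧
        (∀ v, MemL2 (physDomain A b) v → Pi4 K g A b v ∈ V4 K A b) ∧
        (∀ φ ∈ V1 K A b, Pi1 K g A b φ =ᵐ[volume.restrict (physDomain A b)] φ) ∧
        (∀ S ∈ V2 K A b, Pi2 K g A b S =ᵐ[volume.restrict (physDomain A b)] S) ∧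
        (∀ T ∈ V3 K A b, Pi3 K g A b T =ᵐ[volume.restrict (physDomain A b)] T) ∧
        (∀ v ∈ V4 K A b, Pi4 K g A b v =ᵐ[volume.restrict (physDomain A b)] v))) ∧
    -- they are bounded, with a constant that does not depend on the mesh
    (∀ θ : ℝ, ∃ C₀ : ℝ, ∀ (r : Fin 3 → ℕ) (_ : ∀ l, 1 ≤ r l) (K : ∀ l, OpenKnots (p l) (r l)),
      (∀ l, LocallyQuasiUniform θ (K l)) →
      IsBoundedL2 (physDomain A b) C₀ (Pi1 K g A b) ∧
      IsBoundedL2 (physDomain A b) C₀ (Pi2 K g A b) ∧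
      IsBoundedL2 (physDomain A b) C₀ (Pi3 K g A b) ∧
      IsBoundedL2 (physDomain A b) C₀ (Pi4 K g A b) ∧
      (∀ φ G H G' H', IsH2 (physDomain A b) φ G H →
        IsH2 (physDomain A b) (Pi1 K g A b φ) G' H' →
        l2NormSq (physDomain A b) (Pi1 K g A b φ) + l2NormSq (physDomain A b) G' +
            l2NormSq (physDomain A b) H' ≤
          C₀ ^ 2 * (l2NormSq (physDomain A b) φ + l2NormSq (physDomain A b) G +
            l2NormSq (physDomain A b) H)) ∧
      (∀ S C, IsHcurlS (physDomain A b) S C →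
        l2NormSq (physDomain A b) (Pi2 K g A b S) + l2NormSq (physDomain A b) (Pi3 K g A b C) ≤
          C₀ ^ 2 * (l2NormSq (physDomain A b) S + l2NormSq (physDomain A b) C)) ∧
      (∀ T v, IsHdivT (physDomain A b) T v →
        l2NormSq (physDomain A b) (Pi3 K g A b T) + l2NormSq (physDomain A b) (Pi4 K g A b v) ≤
          C₀ ^ 2 * (l2NormSq (physDomain A b) T + l2NormSq (physDomain A b) v))) := by
  refine ⟨fun r hr K => ⟨⟨?_, ?_, ?_, ?_, ?_, ?_, ?_, ?_⟩, ⟨?_, ?_, ?_⟩, ⟨?_, ?_, ?_, ?_⟩,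
    ⟨?_, ?_, ?_, ?_, ?_, ?_, ?_⟩, ⟨?_, ?_, ?_, ?_, ?_, ?_, ?_, ?_⟩⟩, fun θ => ?_⟩
  · exact fun φ G H h => hatPi1_mem hg hr h.memL2
  · exact fun S C h => hatPi2_mem hg hr h.memL2 h.symm
  · exact fun T v h => hatPi3_mem hg hr h.memL2 h.trace
  · exact fun v h => hatPi4_mem hg hr h
  · exact fun φ h => hatPi1_eq_self hg hr h
  · exact fun S h => hatPi2_eq_self hg hr h
  · exact fun T h => hatPi3_eq_self hg hr h
  · exact fun v h => hatPi4_eq_self hg hr h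
  · exact fun φ G H h => ⟨_, isH2_hatPi hg hr h⟩
  · exact fun S C h => isHcurlS_hatPi hg hr h
  · exact fun T v h => isHdivT_hatPi hg hr h
  · exact fun q hq => Pi1_eq_self hg hr hA b (P1_subset_V1 b hq)
  · exact fun φ G H h => ⟨_, isH2_Pi hg hr hA b h⟩
  · exact fun S C h => isHcurlS_Pi hg hr hA b h
  · exact fun T v h => isHdivT_Pi hg hr hA b h
  · exact fun q hq => ⟨P1_subset_V1 b hq, exists_isH2_of_mem_P1 hA b K hq⟩
  · exact fun φ G H h => h.isHcurlS (isOpen_physDomain hA b)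
  · exact fun S C h => h.isHdivT (isOpen_physDomain hA b)
  · exact fun φ h => exists_isH2_of_mem_V1 hg hr hA b h
  · exact fun S h => exists_isHcurlS_of_mem_V2 hg hr hA b h
  · exact fun T h => exists_isHdivT_of_mem_V3 hg hr hA b h
  · exact fun v h => V4_memL2 hA b h
  · exact fun φ G H h => Pi1_mem hg hr hA b h.memL2
  · exact fun S C h => Pi2_mem hg hr hA b h
  · exact fun T v h => Pi3_mem hg hr hA b h
  · exact fun v h => Pi4_mem hg hr hA b h
  · exact fun φ h => Pi1_eq_self hg hr hA b h
  · exact fun S h => Pi2_eq_self hg hr hA b h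
  · exact fun T h => Pi3_eq_self hg hr hA b h
  · exact fun v h => Pi4_eq_self hg hr hA b h
  · obtain ⟨C₀, hC₀⟩ := exists_bound_Pi hg hA b θ
    refine ⟨C₀, fun r hr K hK => ?_⟩
    obtain ⟨h1, h2, h3, h4, h5⟩ := hC₀ r hr K hK
    refine ⟨h1, h2, h3, h4, fun φ G H G' H' h h' => ?_, fun S C h => ?_, fun T v h => ?_⟩
    · obtain ⟨eG, eH⟩ := h'.ae_unique (isOpen_physDomain hA b) (isH2_Pi hg hr hA b h)
      rw [l2NormSq_congr eG, l2NormSq_congr eH, mul_add, mul_add]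
      exact add_le_add (add_le_add (h1.bound _ h.memL2) (h5.bound _ h.grad_memL2))
        (h2.bound _ h.hess_memL2)
    · rw [mul_add]
      exact add_le_add (h2.bound _ h.memL2) (h3.bound _ h.curl_memL2)
    · rw [mul_add]
      exact add_le_add (h3.bound _ h.memL2) (h4.bound _ h.div_memL2)
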